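/- **Lemma (Reflector and projector).** A unitary $U$ on $m+n$ qubits is an $(\alpha,m,\epsilon)$-block-encoding of $A\in\mathbb{C}^{2^n\times 2^n}$ if $\|A-\alpha(\langle 0^m|\otimes I)U(|0^m\rangle\otimes I)\|_2\le\epsilon$. For a Hermitian $H=\sum_k\lambda_k|\psi_k\rangle\langle\psi_k|$ with $(\psi_k)$ orthonormal, and $\mu\in\mathbb{R}$, put $$P_{<\mu}=\sum_{k:\lambda_k<\mu}|\psi_k\rangle\langle\psi_k|,\qquad R_{<\mu}=\sum_{k:\lambda_k<\mu}|\psi_k\rangle\langle\psi_k|-\sum_{k:\lambda_k>\mu}|\psi_k\rangle\langle\psi_k| .$$ There is an absolute constant $C>0$ such that for all integers $n,m\ge 0$ and all reals $\alpha,\Delta>0$, $\mu\in\mathbb{R}$, $0<\epsilon<1$ there are quantum circuits $\mathrm{REF}$ on $m+2+n$ qubits and $\mathrm{PROJ}$ on $m+3+n$ qubits (with no further qubits), built from arbitrary one- and two-qubit gates and from possibly controlled applications of an oracle $U_H$ on $m+n$ qubits and of $U_H^\dagger$, such that the following hold. 1. For every Hermitian $H\in\mathbb{C}^{2^n\times 2^n}$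 all of whose eigenvalues $\lambda$ satisfy $|\mu-\lambda|\ge\Delta/2$, and every $(\alpha,m,0)$-block-encoding $U_H$ of $H$, the circuit $\mathrm{REF}$ run with the oracle $U_H$ is a $(1,m+2,\epsilon)$-block-encoding of $R_{<\mu}$, and $\mathrm{PROJ}$ run with the oracle $U_H$ is a $(1,m+3,\epsilon/2)$-block-encoding of $P_{<\mu}$. 2. Each of the two circuits uses at most $C\,\frac{\alpha}{\Delta}\log\frac{2}{\epsilon}$ applications of $U_H$ and $U_H^\dagger$ in total, which is $O(\frac{\alpha}{\Delta}\log\frac1\epsilon)$ for $\epsilon\le\frac12$, and at most $C\,(m+1)\max(1,\frac{\alpha}{\Delta})\log\frac{2}{\epsilon}$ one- and two-qubit gates. -/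

import Mathlib

noncomputable section

open scoped Matrix.Norms.L2Operator

/-- Matrices acting on the state space of a register whose qubits are labelled by `Q`.
The computational basis states are the bit strings `Q → Fin 2`. -/
abbrev QMatrix (Q : Type) : Type := Matrix (Q → Fin 2) (Q → Fin 2) ℂ

/-- The block `(⟨0^m| ⊗ I) U (|0^m⟩ ⊗ I)` of an operator on `m` ancilla qubits (left summand) and
`n` system qubits (right summand). -/
def zeroBlock {m n : ℕ} (U : QMatrix (Fin m ⊕ Fin n)) : QMatrix (Fin n) :=
  fun x y => U (Sum.elim (fun _ => 0) x) (Sum.elim (fun _ => 0) y)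

/-- `U` is an `(α, m, ε)`-block-encoding of the `2 ^ n × 2 ^ n` matrix `A`: it is a unitary on
`m + n` qubits with `‖A - α (⟨0^m| ⊗ I) U (|0^m⟩ ⊗ I)‖ ≤ ε` in the spectral norm. -/
def IsBlockEncoding {n : ℕ} (α : ℝ) (m : ℕ) (ε : ℝ) (U : QMatrix (Fin m ⊕ Fin n))
    (A : QMatrix (Fin n)) : Prop :=
  U ∈ Matrix.unitaryGroup (Fin m ⊕ Fin n → Fin 2) ℂ ∧ ‖A - (α : ℂ) • zeroBlock U‖ ≤ ε

/-- The rank one projector `|ψ_k⟩⟨ψ_k|` onto the `k`-th vector of an orthonormal eigenbasis. -/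
def eigenKetBra {n : ℕ} {H : QMatrix (Fin n)} (hH : H.IsHermitian) (k : Fin n → Fin 2) :
    QMatrix (Fin n) :=
  Matrix.vecMulVec (fun x => hH.eigenvectorBasis k x) (fun y => star (hH.eigenvectorBasis k y))

/-- The spectral projector `P_{<μ} = ∑_{k : λ_k < μ} |ψ_k⟩⟨ψ_k|`. -/
def projectorLT {n : ℕ} {H : QMatrix (Fin n)} (hH : H.IsHermitian) (μ : ℝ) : QMatrix (Fin n) :=
  ∑ k with hH.eigenvalues k < μ, eigenKetBra hH k

/-- The reflector
`R_{<μ} = ∑_{k : λ_k < μ} |ψ_k⟩⟨ψ_k| - ∑_{k : λ_k > μ} |ψ_k⟩⟨ψ_k|`. -/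
def reflectorLT {n : ℕ} {H : QMatrix (Fin n)} (hH : H.IsHermitian) (μ : ℝ) : QMatrix (Fin n) :=
  (∑ k with hH.eigenvalues k < μ, eigenKetBra hH k)
    - ∑ k with μ < hH.eigenvalues k, eigenKetBra hH k

/-- The operator on the register `Q` that applies `G` to the wires selected by `e` and the identity
to all the other wires. -/
def onWires {R Q : Type} [Fintype R] [Fintype Q] [DecidableEq Q] (e : R ↪ Q) (G : QMatrix R) :
    QMatrix Q :=
  fun x y => if ∀ q, (∀ r, e r ≠ q) → x q = y q then G (x ∘ e) (y ∘ e) else 0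

/-- The controlled operator `|0⟩⟨0| ⊗ I + |1⟩⟨1| ⊗ U`; the wire `none` is the control. -/
def controlled {R : Type} [Fintype R] (U : QMatrix R) : QMatrix (Option R) :=
  fun x y =>
    if x none = y none then
      if x none = 1 then U (x ∘ some) (y ∘ some) else (1 : QMatrix R) (x ∘ some) (y ∘ some)
    else 0

/-- The elements of a circuit on the wires `Q` with access to an oracle acting on a register `R`:
arbitrary one-qubit gates, arbitrary two-qubit gates, and applications of the oracle or of its
adjoint (`adj = true`), possibly controlled by a further qubit. -/
inductive CircuitElement (R Q : Type) : Type
  | oneQubit (e : Fin 1 ↪ Q) (G : Matrix.unitaryGroup (Fin 1 → Fin 2) ℂ) : CircuitElement R Q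
  | twoQubit (e : Fin 2 ↪ Q) (G : Matrix.unitaryGroup (Fin 2 → Fin 2) ℂ) : CircuitElement R Q
  | query (adj : Bool) (e : R ↪ Q) : CircuitElement R Q
  | controlledQuery (adj : Bool) (e : Option R ↪ Q) : CircuitElement R Q

/-- Whether a circuit element is an application of the oracle or of its adjoint. -/
def CircuitElement.isQuery {R Q : Type} : CircuitElement R Q → Bool
  | .oneQubit _ _ => false
  | .twoQubit _ _ => false
  | .query _ _ => true
  | .controlledQuery _ _ => true

/-- The operator of a circuit element when the oracle is `U`. -/
def CircuitElement.toMatrix {R Q : Type} [Fintype R] [Fintype Q] [DecidableEq Q] (U : QMatrix R) :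
    CircuitElement R Q → QMatrix Q
  | .oneQubit e G => onWires e (G : QMatrix (Fin 1))
  | .twoQubit e G => onWires e (G : QMatrix (Fin 2))
  | .query adj e => onWires e (if adj then U.conjTranspose else U)
  | .controlledQuery adj e => onWires e (controlled (if adj then U.conjTranspose else U))

/-- A circuit on the wires `Q` with an oracle acting on a register `R`; the head of the list is
applied first. There are no wires besides `Q`. -/
abbrev OracleCircuit (R Q : Type) : Type := List (CircuitElement R Q)

/-- The operator implemented by a circuit when the oracle is `U`. -/
def OracleCircuit.toMatrix {R Q : Type} [Fintype R] [Fintype Q] [DecidableEq Q] (U : QMatrix R) :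
    OracleCircuit R Q → QMatrix Q
  | [] => 1
  | g :: c => OracleCircuit.toMatrix U c * g.toMatrix U

/-- The number of applications of the oracle and of its adjoint. -/
def OracleCircuit.queryCount {R Q : Type} (c : OracleCircuit R Q) : ℕ :=
  c.countP (fun g => g.isQuery)

/-- The number of one- and two-qubit gates. -/
def OracleCircuit.gateCount {R Q : Type} (c : OracleCircuit R Q) : ℕ :=
  c.countP (fun g => !g.isQuery)

end

/-! Both circuits are instances of one construction: a block encoding of the function of `H` equal
to `v₁` below `μ` and to `v₂` above it, with values `1, -1` for the reflector and `1, 0` for the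
projector.

Write `H = α B` with `B` the zero block of the oracle. A controlled query between two Hadamard gates
has block `(1 + B) / 2`, whose eigenvalues `x = (1 + λ / α) / 2` lie in `[0, 1]`
(`compress_shiftedOracle`). Let `v` be this shifted oracle and `r` the reflection about the zero
state of its ancillas. Since `r` is twice a projector minus one, the blocks of the powers of the
walk `r v† r v` obey the Chebyshev recurrence, and the `l`-th power has block `cos (2 l arccos x)`
(`compress_walk_zpow`). Only even functions of `x` are reachable; because of the shift `x ≥ 0`, so
the threshold at `μ` is a threshold for `|x|` and nothing is lost.

It remains to apply a polynomial to the walk. `exists_step_polynomial` approximates the step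
function of `|cos θ|` by a polynomial in `exp (2 i θ)` of degree `O(δ⁻¹ log (2 / ε))`, by averaging
the step against powers of a Dirichlet-type kernel over roots of unity. Fejér–Riesz gives a
complementary polynomial (`exists_complement`), and stripping off one rotation at a time writes the
pair as a column of a product of rotations and signal factors (`exists_signalProduct`). Instead of
controlling the walk, `signalOperator_eq` puts reflections around the rotations, so that `v` and
`v†` are used in alternation without the signal processing qubit as a control.

Each reflected rotation is a rotation of one qubit selected by whether `m + 1` wires vanish. It
costs `O(m)` gates and no ancilla (`realizable_multiGated`): the gate is diagonalized, its phase is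
produced by commutators with controlled flips, and each half of the control wires serves as borrowed
workspace for the other half.

If `Δ > 2 α` all eigenvalues lie on one side of `μ`, and a single constant gate without queries
suffices (`exists_threshold_circuit`). -/

open scoped Matrix.Norms.L2Operator

/-! ### Conjugate reciprocal polynomials and Fejér–Riesz factorization. -/

/-- The polynomial `w ^ N * conj (P (1 / conj w))`. -/
noncomputable def conjReflect (N : ℕ) (P : Polynomial ℂ) : Polynomial ℂ :=
  Polynomial.reflect N (P.map (starRingEnd ℂ))

theorem conjReflect_natDegree_le {N : ℕ} {P : Polynomial ℂ} (hP : P.natDegree ≤ N) :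
    (conjReflect N P).natDegree ≤ N := by
  refine Polynomial.natDegree_reflect_le.trans ?_
  rw [Polynomial.natDegree_map]
  exact max_le le_rfl hP

theorem conjReflect_coeff {N i : ℕ} (hi : i ≤ N) (P : Polynomial ℂ) :
    (conjReflect N P).coeff i = star (P.coeff (N - i)) := by
  rw [conjReflect, Polynomial.coeff_reflect, Polynomial.revAt_le hi, Polynomial.coeff_map]
  rfl

theorem conjReflect_eval {N : ℕ} {P : Polynomial ℂ} (hP : P.natDegree ≤ N) {w : ℂ} (hw : w ≠ 0) :
    (conjReflect N P).eval w = w ^ N * star (P.eval (star w)⁻¹) := by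
  let : Invertible w := invertibleOfNonzero hw
  have h := Polynomial.eval₂_reflect_mul_pow (RingHom.id ℂ) w N (conjReflect N P)
    (conjReflect_natDegree_le hP)
  rw [conjReflect, Polynomial.reflect_reflect, invOf_eq_inv] at h
  change Polynomial.eval _ _ * _ = Polynomial.eval _ _ at h
  rw [conjReflect, ← h, mul_comm]
  congr 1
  have h2 := Polynomial.eval_map_apply (f := starRingEnd ℂ) (p := P) (star w)⁻¹
  simp only [map_inv₀, Complex.star_def, Complex.conj_conj] at h2 ⊢
  rw [h2]

theorem inv_star_of_norm_one {w : ℂ} (hw : ‖w‖ = 1) : (star w)⁻¹ = w := by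
  have h : w * star w = 1 := by
    rw [Complex.star_def, Complex.mul_conj, Complex.normSq_eq_norm_sq, hw]; simp
  exact inv_eq_of_mul_eq_one_left h

theorem ne_zero_of_norm_one {w : ℂ} (hw : ‖w‖ = 1) : w ≠ 0 := by
  rintro rfl; simp at hw

theorem conjReflect_eval_circle {N : ℕ} {P : Polynomial ℂ} (hP : P.natDegree ≤ N) {w : ℂ}
    (hw : ‖w‖ = 1) : (conjReflect N P).eval w = w ^ N * star (P.eval w) := by
  rw [conjReflect_eval hP (ne_zero_of_norm_one hw), inv_star_of_norm_one hw]

theorem mul_star_eq_normSq (z : ℂ) : z * star z = ((‖z‖ ^ 2 : ℝ) : ℂ) := by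
  rw [Complex.star_def, Complex.mul_conj, Complex.normSq_eq_norm_sq]

theorem infinite_unit_circle : {w : ℂ | ‖w‖ = 1}.Infinite := by
  have h : Set.Infinite (Metric.sphere (0 : ℂ) 1) := by
    apply Set.infinite_of_injective_forall_mem (f := fun n : ℕ =>
      Complex.exp ((1 / (n + 1 : ℝ) : ℝ) * Complex.I))
    · intro a b hab
      have h1 : ∀ n : ℕ, 0 < 1 / (n + 1 : ℝ) := fun n => by positivity
      have h2 : ∀ n : ℕ, 1 / (n + 1 : ℝ) ≤ 1 := fun n => by
        rw [div_le_one (by positivity)]; linarith [(Nat.cast_nonneg n : (0 : ℝ) ≤ n)]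
      have h3 : ∀ n : ℕ, Complex.arg (Complex.exp ((1 / (n + 1 : ℝ) : ℝ) * Complex.I))
          = 1 / (n + 1 : ℝ) := fun n => by
        rw [Complex.arg_exp_mul_I, toIocMod_eq_self]
        exact ⟨by linarith [h1 n, Real.pi_pos], by linarith [h2 n, Real.pi_gt_three]⟩
      have h4 := congrArg Complex.arg hab
      simp only [h3] at h4
      rw [one_div, one_div, inv_inj] at h4
      exact_mod_cast add_right_cancel h4
    · intro n
      simp only [mem_sphere_iff_norm, sub_zero]
      exact Complex.norm_exp_ofReal_mul_I _
  convert h using 1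
  ext; simp

theorem polynomial_eq_of_eq_on_circle {P Q : Polynomial ℂ}
    (h : ∀ w : ℂ, ‖w‖ = 1 → P.eval w = Q.eval w) : P = Q :=
  Polynomial.eq_of_infinite_eval_eq P Q (infinite_unit_circle.mono fun w hw => h w hw)

/-- Fejér–Riesz factorization of a strictly positive trigonometric polynomial. -/
theorem fejer_riesz (N : ℕ) : ∀ F : Polynomial ℂ, F.natDegree ≤ 2 * N →
    (∀ w : ℂ, ‖w‖ = 1 → ∃ r : ℝ, 0 < r ∧ F.eval w = w ^ N * r) →
    ∃ Q : Polynomial ℂ, Q.natDegree ≤ N ∧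
      ∀ w : ℂ, ‖w‖ = 1 → F.eval w = w ^ N * ((‖Q.eval w‖ ^ 2 : ℝ) : ℂ) := by
  induction N with
  | zero =>
    intro F hF hpos
    obtain ⟨r, hr, h1⟩ := hpos 1 (by simp)
    have hF0 : F = Polynomial.C (F.coeff 0) := Polynomial.eq_C_of_natDegree_le_zero (by simpa using hF)
    refine ⟨Polynomial.C (Real.sqrt r : ℂ), by simp, fun w hw => ?_⟩
    rw [hF0] at h1 ⊢
    simp only [Polynomial.eval_C] at h1 ⊢
    rw [h1]
    simp [Real.sq_sqrt hr.le]
  | succ N ih =>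
    intro F hF hpos
    -- On the circle `F / w ^ (N + 1)` is real, so `F` is its own conjugate reciprocal and its roots
    -- come in pairs `ρ`, `1 / conj ρ`; positivity keeps them off the circle.
    have hself : conjReflect (2 * (N + 1)) F = F := by
      refine polynomial_eq_of_eq_on_circle fun w hw => ?_
      obtain ⟨r, -, hr⟩ := hpos w hw
      have h1 := mul_star_eq_normSq w
      rw [hw] at h1
      rw [conjReflect_eval_circle hF hw, hr, star_mul', star_pow, Complex.star_def,
        Complex.conj_ofReal, mul_comm 2, pow_mul, ← Complex.star_def]
      calc (w ^ (N + 1)) ^ 2 * (star w ^ (N + 1) * (r : ℂ))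
          = (w * star w) ^ (N + 1) * (w ^ (N + 1) * r) := by rw [mul_pow]; ring
        _ = _ := by rw [h1]; simp
    by_cases hroot : ∃ ρ : ℂ, ρ ≠ 0 ∧ F.IsRoot ρ
    · obtain ⟨ρ, hρ0, hρ⟩ := hroot
      have hρ1 : ‖ρ‖ ≠ 1 := by
        intro h
        obtain ⟨r, hr, h1⟩ := hpos ρ h
        rw [hρ] at h1
        have := mul_ne_zero (pow_ne_zero (N + 1) hρ0) (Complex.ofReal_ne_zero.2 hr.ne')
        exact this h1.symm
      have hsρ : star ρ ≠ 0 := star_ne_zero.2 hρ0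
      have hne : (star ρ)⁻¹ ≠ ρ := by
        intro h
        have h2 : ρ * star ρ = 1 := by nth_rewrite 1 [← h]; exact inv_mul_cancel₀ hsρ
        rw [mul_star_eq_normSq] at h2
        have h3 : ‖ρ‖ ^ 2 = 1 := by exact_mod_cast h2
        exact hρ1 ((pow_eq_one_iff_of_nonneg (norm_nonneg _) two_ne_zero).1 h3)
      have hσ : F.IsRoot (star ρ)⁻¹ := by
        have h := conjReflect_eval hF (inv_ne_zero hsρ)
        rw [hself] at h
        rw [Polynomial.IsRoot, h]
        simp only [star_inv₀, star_star, inv_inv]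
        rw [show F.eval ρ = 0 from hρ]; simp
      obtain ⟨F1, hF1⟩ := Polynomial.dvd_iff_isRoot.2 hρ
      have hσ1 : F1.IsRoot (star ρ)⁻¹ := by
        rw [hF1, Polynomial.IsRoot, Polynomial.eval_mul] at hσ
        rcases mul_eq_zero.1 hσ with h | h
        · simp at h; exact absurd (sub_eq_zero.1 h) (by simpa using hne)
        · exact h
      obtain ⟨F2, hF2⟩ := Polynomial.dvd_iff_isRoot.2 hσ1
      have hF0 : F ≠ 0 := by
        rintro rfl
        obtain ⟨r, hr, h1⟩ := hpos 1 (by simp)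
        simp at h1; exact hr.ne (by exact_mod_cast h1)
      have hF10 : F1 ≠ 0 := by rintro rfl; simp at hF1; exact hF0 hF1
      have hF20 : F2 ≠ 0 := by rintro rfl; simp at hF2; exact hF10 hF2
      have hdeg : F.natDegree = F2.natDegree + 2 := by
        rw [hF1, Polynomial.natDegree_mul (Polynomial.X_sub_C_ne_zero _) hF10, hF2,
          Polynomial.natDegree_mul (Polynomial.X_sub_C_ne_zero _) hF20,
          Polynomial.natDegree_X_sub_C, Polynomial.natDegree_X_sub_C]
        ring
      -- On the circle the pair of linear factors equals `-(1 / conj ρ) * w * ‖w - ρ‖ ^ 2`. The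
      -- constant is moved into the cofactor, which is therefore again positive in the sense
      -- required by the induction.
      have hev : ∀ w : ℂ, ‖w‖ = 1 → F.eval w =
          w * ((‖w - ρ‖ ^ 2 : ℝ) : ℂ) * (Polynomial.C (-(star ρ)⁻¹) * F2).eval w := by
        intro w hw
        have h1 := mul_star_eq_normSq w
        rw [hw] at h1
        rw [hF1, hF2, ← mul_star_eq_normSq]
        simp only [Polynomial.eval_mul, Polynomial.eval_sub, Polynomial.eval_X, Polynomial.eval_C,
          star_sub]
        have h3 : w * (star w - star ρ) = - (star ρ) * (w - (star ρ)⁻¹) := by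
          rw [mul_sub, h1, mul_sub]
          have : -star ρ * (star ρ)⁻¹ = -1 := by field_simp
          rw [this]; push_cast; ring
        calc (w - ρ) * ((w - (star ρ)⁻¹) * F2.eval w)
            = (star ρ * (star ρ)⁻¹) * ((w - ρ) * ((w - (star ρ)⁻¹) * F2.eval w)) := by
              rw [mul_inv_cancel₀ hsρ, one_mul]
          _ = (w - ρ) * (- (star ρ) * (w - (star ρ)⁻¹)) * (-(star ρ)⁻¹ * F2.eval w) := by ring
          _ = _ := by rw [← h3]; ring
      obtain ⟨Q, hQ, hQe⟩ := ih (Polynomial.C (-(star ρ)⁻¹) * F2)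
        ((Polynomial.natDegree_C_mul_le _ _).trans (by omega)) (fun w hw => by
          obtain ⟨r, hr, h1⟩ := hpos w hw
          have hwρ : 0 < ‖w - ρ‖ := norm_pos_iff.2 (sub_ne_zero.2 (by rintro rfl; exact hρ1 hw))
          refine ⟨r / ‖w - ρ‖ ^ 2, by positivity, ?_⟩
          rw [hev w hw, pow_succ] at h1
          have hw0 := ne_zero_of_norm_one hw
          have h4 : ((‖w - ρ‖ ^ 2 : ℝ) : ℂ) ≠ 0 := Complex.ofReal_ne_zero.2 (by positivity)
          push_cast at h1 h4 ⊢
          rw [mul_div_assoc', eq_div_iff h4]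
          apply mul_left_cancel₀ hw0
          linear_combination h1)
      refine ⟨(Polynomial.X - Polynomial.C ρ) * Q, ?_, fun w hw => ?_⟩
      · refine Polynomial.natDegree_mul_le.trans ?_
        rw [Polynomial.natDegree_X_sub_C]; omega
      · rw [hev w hw, hQe w hw]
        simp only [Polynomial.eval_mul, Polynomial.eval_sub, Polynomial.eval_X, Polynomial.eval_C,
          norm_mul]
        push_cast; ring
    -- A nonzero constant coefficient would force a nonzero top coefficient by symmetry, hence
    -- positive degree and a root, necessarily nonzero. So both end coefficients vanish and a factor
    -- `X` can be removed.
    · have h0 : F.coeff 0 = 0 := by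
        by_contra h0
        have hlead : F.coeff (2 * (N + 1)) ≠ 0 := by
          have h := conjReflect_coeff (le_refl (2 * (N + 1))) F
          rw [hself, Nat.sub_self] at h
          rw [h]; exact star_ne_zero.2 h0
        have hd : 2 * (N + 1) ≤ F.natDegree := Polynomial.le_natDegree_of_ne_zero hlead
        obtain ⟨z, hz⟩ := Complex.exists_root (f := F)
          (Polynomial.natDegree_pos_iff_degree_pos.1 (by omega))
        refine hroot ⟨z, ?_, hz⟩
        rintro rfl
        exact h0 (by rw [Polynomial.coeff_zero_eq_eval_zero]; exact hz)
      obtain ⟨F1, hF1⟩ := Polynomial.X_dvd_iff.2 h0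
      have htop : F.coeff (2 * (N + 1)) = 0 := by
        have h := conjReflect_coeff (le_refl (2 * (N + 1))) F
        rw [hself, Nat.sub_self, h0] at h
        simpa using h
      have hdeg : F1.natDegree ≤ 2 * N := by
        rw [Polynomial.natDegree_le_iff_coeff_eq_zero]
        intro i hi
        have h : F1.coeff i = F.coeff (i + 1) := by rw [hF1, Polynomial.coeff_X_mul]
        rw [h]
        rcases Nat.lt_or_ge (2 * (N + 1)) (i + 1) with h | h
        · exact Polynomial.coeff_eq_zero_of_natDegree_lt (by omega)
        · rw [show i + 1 = 2 * (N + 1) by omega, htop]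
      have hev : ∀ w, F.eval w = w * F1.eval w := fun w => by rw [hF1]; simp
      obtain ⟨Q, hQ, hQe⟩ := ih F1 hdeg (fun w hw => by
        obtain ⟨r, hr, h1⟩ := hpos w hw
        refine ⟨r, hr, mul_left_cancel₀ (ne_zero_of_norm_one hw) ?_⟩
        rw [← hev, h1]; ring)
      refine ⟨Q, by omega, fun w hw => ?_⟩
      rw [hev, hQe w hw]; ring

/-- A polynomial of modulus less than one on the unit circle has a complement. -/
theorem exists_complement {N : ℕ} {P : Polynomial ℂ} (hP : P.natDegree ≤ N)
    (hlt : ∀ w : ℂ, ‖w‖ = 1 → ‖P.eval w‖ < 1) :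
    ∃ Q : Polynomial ℂ, Q.natDegree ≤ N ∧
      ∀ w : ℂ, ‖w‖ = 1 → ‖P.eval w‖ ^ 2 + ‖Q.eval w‖ ^ 2 = 1 := by
  have hev : ∀ w : ℂ, ‖w‖ = 1 → (Polynomial.X ^ N - P * conjReflect N P).eval w
      = w ^ N * ((1 - ‖P.eval w‖ ^ 2 : ℝ) : ℂ) := fun w hw => by
    simp only [Polynomial.eval_sub, Polynomial.eval_mul, Polynomial.eval_pow, Polynomial.eval_X]
    rw [conjReflect_eval_circle hP hw, Complex.ofReal_sub, ← mul_star_eq_normSq]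
    push_cast; ring
  obtain ⟨Q, hQ, h⟩ := fejer_riesz N (Polynomial.X ^ N - P * conjReflect N P) (by
      refine (Polynomial.natDegree_sub_le _ _).trans (max_le ?_ ?_)
      · exact (Polynomial.natDegree_X_pow_le N).trans (by omega)
      · exact Polynomial.natDegree_mul_le.trans (by have := conjReflect_natDegree_le hP; omega))
    (fun w hw => ⟨1 - ‖P.eval w‖ ^ 2, by
      have := hlt w hw
      have := norm_nonneg (P.eval w)
      nlinarith, hev w hw⟩)
  refine ⟨Q, hQ, fun w hw => ?_⟩
  have h1 := h w hw
  rw [hev w hw] at h1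
  have h2 := mul_left_cancel₀ (pow_ne_zero N (ne_zero_of_norm_one hw)) h1
  have h3 : 1 - ‖P.eval w‖ ^ 2 = ‖Q.eval w‖ ^ 2 := by exact_mod_cast h2
  linarith

/-! ### Layer stripping for generalized quantum signal processing. -/

/-- The matrix of `SU(2)` with first column `(a, b)`. -/
def su2 (a b : ℂ) : Matrix (Fin 2) (Fin 2) ℂ := !![a, -star b; b, star a]

theorem su2_mem {a b : ℂ} (h : ‖a‖ ^ 2 + ‖b‖ ^ 2 = 1) :
    su2 a b ∈ Matrix.specialUnitaryGroup (Fin 2) ℂ := by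
  have h1 : a * star a + b * star b = 1 := by
    rw [mul_star_eq_normSq, mul_star_eq_normSq]; exact_mod_cast h
  rw [Matrix.mem_specialUnitaryGroup_iff, Matrix.mem_unitaryGroup_iff]
  constructor
  · ext i j
    fin_cases i <;> fin_cases j <;>
      simp [su2, Matrix.mul_apply, Fin.sum_univ_two, Matrix.star_apply] at h1 ⊢ <;>
      first | linear_combination h1 | ring
  · rw [su2, Matrix.det_fin_two_of]; linear_combination h1

/-- In `ℂ²` the vector `(a, b)` must be orthogonal to `(p₀, q₀)` and parallel to `(p, q)`. These
demands agree because the two given vectors are orthogonal; normalize whichever of `(p, q)` and the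
complement of `(p₀, q₀)` is nonzero. -/
theorem exists_su2_of_orthogonal {p q p₀ q₀ : ℂ} (h : p * star p₀ + q * star q₀ = 0) :
    ∃ a b : ℂ, ‖a‖ ^ 2 + ‖b‖ ^ 2 = 1 ∧ star a * p₀ + star b * q₀ = 0 ∧ a * q - b * p = 0 := by
  have key : ∀ x y : ℂ, (x ≠ 0 ∨ y ≠ 0) → ∃ r : ℝ, 0 < r ∧
      ‖(r : ℂ) * x‖ ^ 2 + ‖(r : ℂ) * y‖ ^ 2 = 1 := fun x y hxy => by
    have hs : 0 < ‖x‖ ^ 2 + ‖y‖ ^ 2 := by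
      rcases hxy with h | h
      · have := norm_pos_iff.2 h; positivity
      · have := norm_pos_iff.2 h; positivity
    refine ⟨(Real.sqrt (‖x‖ ^ 2 + ‖y‖ ^ 2))⁻¹, by positivity, ?_⟩
    rw [norm_mul, norm_mul, mul_pow, mul_pow, ← mul_add]
    simp only [Complex.norm_real, Real.norm_eq_abs, sq_abs, inv_pow]
    rw [Real.sq_sqrt hs.le, inv_mul_cancel₀ hs.ne']
  have h' := congrArg star h
  simp only [star_add, star_mul', star_star, star_zero] at h'
  by_cases h1 : p ≠ 0 ∨ q ≠ 0
  · obtain ⟨r, hr, hn⟩ := key p q h1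
    refine ⟨r * p, r * q, hn, ?_, by ring⟩
    simp only [star_mul', Complex.star_def, Complex.conj_ofReal] at h' ⊢
    linear_combination r * h'
  · push Not at h1
    obtain ⟨rfl, rfl⟩ := h1
    by_cases h2 : -star q₀ ≠ 0 ∨ star p₀ ≠ 0
    · obtain ⟨r, hr, hn⟩ := key _ _ h2
      refine ⟨r * -star q₀, r * star p₀, hn, ?_, by ring⟩
      simp only [star_mul', star_neg, star_star]
      simp only [Complex.star_def, Complex.conj_ofReal]
      ring
    · push Not at h2
      have h3 : q₀ = 0 := by simpa using h2.1
      have h4 : p₀ = 0 := by simpa using h2.2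
      exact ⟨1, 0, by simp, by simp [h3, h4], by simp⟩

/-- The product `g_N diag(X, 1) g_{N-1} ⋯ diag(X, 1) g_0` of generalized quantum signal
processing. -/
noncomputable def signalProduct (g : ℕ → Matrix (Fin 2) (Fin 2) ℂ) :
    ℕ → Matrix (Fin 2) (Fin 2) (Polynomial ℂ)
  | 0 => (g 0).map Polynomial.C
  | N + 1 => (g (N + 1)).map Polynomial.C * Matrix.diagonal ![Polynomial.X, 1] * signalProduct g N

theorem signalProduct_congr {g g' : ℕ → Matrix (Fin 2) (Fin 2) ℂ} {N : ℕ}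
    (h : ∀ i ≤ N, g i = g' i) : signalProduct g N = signalProduct g' N := by
  induction N with
  | zero => rw [signalProduct, signalProduct, h 0 le_rfl]
  | succ N ih =>
    rw [signalProduct, signalProduct, h _ le_rfl, ih fun i hi => h i (by omega)]

/-- Induction on the degree: the outermost rotation is chosen so that undoing it kills the constant
coefficient of the first polynomial and the top coefficient of the second. The first is then
divisible by `X`, both degrees drop, and the normalization on the circle is preserved. -/
theorem exists_signalProduct (N : ℕ) : ∀ P Q : Polynomial ℂ, P.natDegree ≤ N → Q.natDegree ≤ N →
    (∀ w : ℂ, ‖w‖ = 1 → ‖P.eval w‖ ^ 2 + ‖Q.eval w‖ ^ 2 = 1) →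
    ∃ g : ℕ → Matrix (Fin 2) (Fin 2) ℂ, (∀ i, g i ∈ Matrix.specialUnitaryGroup (Fin 2) ℂ) ∧
      signalProduct g N 0 0 = P ∧ signalProduct g N 1 0 = Q := by
  induction N with
  | zero =>
    intro P Q hP hQ h
    rw [Polynomial.eq_C_of_natDegree_le_zero hP, Polynomial.eq_C_of_natDegree_le_zero hQ] at h ⊢
    refine ⟨fun _ => su2 (P.coeff 0) (Q.coeff 0), fun _ => su2_mem (by simpa using h 1 (by simp)),
      ?_, ?_⟩ <;> simp [signalProduct, su2]
  | succ N ih =>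
    intro P Q hP hQ h
    -- This is the coefficient of degree `2 * (N + 1)` in the normalization identity, whose right
    -- side `X ^ (N + 1)` does not reach that degree.
    have horth : P.coeff (N + 1) * star (P.coeff 0) + Q.coeff (N + 1) * star (Q.coeff 0) = 0 := by
      have h1 : P * conjReflect (N + 1) P + Q * conjReflect (N + 1) Q = Polynomial.X ^ (N + 1) := by
        refine polynomial_eq_of_eq_on_circle fun w hw => ?_
        simp only [Polynomial.eval_add, Polynomial.eval_mul, Polynomial.eval_pow, Polynomial.eval_X]
        rw [conjReflect_eval_circle hP hw, conjReflect_eval_circle hQ hw]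
        have h2 := h w hw
        have h3 : P.eval w * star (P.eval w) + Q.eval w * star (Q.eval w) = 1 := by
          rw [mul_star_eq_normSq, mul_star_eq_normSq]; exact_mod_cast h2
        linear_combination w ^ (N + 1) * h3
      have h2 := congrArg (fun F => Polynomial.coeff F (N + 1 + (N + 1))) h1
      simp only [Polynomial.coeff_add, Polynomial.coeff_X_pow] at h2
      rw [Polynomial.coeff_mul_add_eq_of_natDegree_le hP (conjReflect_natDegree_le hP),
        Polynomial.coeff_mul_add_eq_of_natDegree_le hQ (conjReflect_natDegree_le hQ),
        conjReflect_coeff le_rfl, conjReflect_coeff le_rfl, if_neg (by omega)] at h2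
      simpa using h2
    obtain ⟨a, b, hab, h0, htop⟩ := exists_su2_of_orthogonal horth
    have hab' : a * star a + b * star b = 1 := by
      rw [mul_star_eq_normSq, mul_star_eq_normSq]; exact_mod_cast hab
    set P' := Polynomial.C (star a) * P + Polynomial.C (star b) * Q with hP'
    set Q' := Polynomial.C a * Q - Polynomial.C b * P with hQ'
    have habC : Polynomial.C a * Polynomial.C (star a) + Polynomial.C b * Polynomial.C (star b)
        = 1 := by
      rw [← Polynomial.C_mul, ← Polynomial.C_mul, ← Polynomial.C_add, hab', Polynomial.C_1]
    have hPr : P = Polynomial.C a * P' + Polynomial.C (-star b) * Q' := by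
      rw [hP', hQ', Polynomial.C_neg]; linear_combination (-P) * habC
    have hQr : Q = Polynomial.C b * P' + Polynomial.C (star a) * Q' := by
      rw [hP', hQ']; linear_combination (-Q) * habC
    have hP'd : P'.natDegree ≤ N + 1 := by
      refine Polynomial.natDegree_add_le_of_degree_le ?_ ?_
      · exact (Polynomial.natDegree_C_mul_le _ _).trans hP
      · exact (Polynomial.natDegree_C_mul_le _ _).trans hQ
    have hQ'd : Q'.natDegree ≤ N := by
      rw [Polynomial.natDegree_le_iff_coeff_eq_zero]
      intro i hi
      rw [hQ', Polynomial.coeff_sub, Polynomial.coeff_C_mul, Polynomial.coeff_C_mul]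
      rcases Nat.lt_or_ge (N + 1) i with h3 | h3
      · rw [Polynomial.coeff_eq_zero_of_natDegree_lt (by omega : P.natDegree < i),
          Polynomial.coeff_eq_zero_of_natDegree_lt (by omega : Q.natDegree < i)]
        simp
      · rw [show i = N + 1 by omega, htop]
    obtain ⟨P'', hP''⟩ := Polynomial.X_dvd_iff.2 (show P'.coeff 0 = 0 by
      rw [hP', Polynomial.coeff_add, Polynomial.coeff_C_mul, Polynomial.coeff_C_mul, h0])
    have hP''d : P''.natDegree ≤ N := by
      rw [Polynomial.natDegree_le_iff_coeff_eq_zero]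
      intro i hi
      rw [← Polynomial.coeff_X_mul, ← hP'']
      exact Polynomial.coeff_eq_zero_of_natDegree_lt (by omega)
    obtain ⟨g, hg, hg0, hg1⟩ := ih P'' Q' hP''d hQ'd (fun w hw => by
      have e1 : ‖P''.eval w‖ ^ 2 = ‖P'.eval w‖ ^ 2 := by
        rw [hP'']; simp [hw]
      rw [e1]
      have h2 := h w hw
      have h3 : P.eval w * star (P.eval w) + Q.eval w * star (Q.eval w) = 1 := by
        rw [mul_star_eq_normSq, mul_star_eq_normSq]; exact_mod_cast h2
      have h4 : P'.eval w * star (P'.eval w) + Q'.eval w * star (Q'.eval w) = 1 := by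
        rw [hP', hQ']
        simp only [Polynomial.eval_add, Polynomial.eval_sub, Polynomial.eval_mul,
          Polynomial.eval_C, star_add, star_sub, star_mul', star_star]
        linear_combination hab' * (P.eval w * star (P.eval w) + Q.eval w * star (Q.eval w)) + h3
      rw [mul_star_eq_normSq, mul_star_eq_normSq] at h4
      exact_mod_cast h4)
    refine ⟨fun i => if i ≤ N then g i else su2 a b, fun i => ?_, ?_⟩
    · by_cases hi : i ≤ N
      · simp only [if_pos hi]; exact hg i
      · simp only [if_neg hi]; exact su2_mem hab
    · rw [signalProduct, signalProduct_congr (g' := g) (fun i hi => if_pos hi)]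
      simp only [if_neg (Nat.not_succ_le_self N)]
      constructor
      · conv_rhs => rw [hPr, hP'', ← hg0, ← hg1]
        simp [Matrix.mul_apply, Fin.sum_univ_two, su2, Matrix.diagonal, mul_assoc]
      · conv_rhs => rw [hQr, hP'', ← hg0, ← hg1]
        simp [Matrix.mul_apply, Fin.sum_univ_two, su2, Matrix.diagonal, mul_assoc]

/-! ### Polynomial approximation of a step function on the circle. -/

theorem sum_pow_primitiveRoot {M : ℕ} {ζ : ℂ} (hζ : IsPrimitiveRoot ζ M) {l l' : ℕ}
    (hl : l < M) (hl' : l' < M) (hnorm : ‖ζ‖ = 1) :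
    ∑ j ∈ Finset.range M, (ζ ^ l * star ζ ^ l') ^ j = if l = l' then (M : ℂ) else 0 := by
  have h1 : ζ * star ζ = 1 := by rw [mul_star_eq_normSq, hnorm]; simp
  split_ifs with h
  · subst h
    rw [← mul_pow, h1]; simp
  · have hx : (ζ ^ l * star ζ ^ l') ^ M = 1 := by
      rw [mul_pow, ← pow_mul, ← pow_mul, mul_comm l, mul_comm l', pow_mul, pow_mul, hζ.pow_eq_one,
        ← star_pow, hζ.pow_eq_one]; simp
    have hne : ζ ^ l * star ζ ^ l' ≠ 1 := by
      intro h2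
      apply h
      apply hζ.pow_inj hl hl'
      calc ζ ^ l = ζ ^ l * (ζ * star ζ) ^ l' := by rw [h1]; simp
        _ = (ζ ^ l * star ζ ^ l') * ζ ^ l' := by rw [mul_pow]; ring
        _ = ζ ^ l' := by rw [h2, one_mul]
    have h3 := geom_sum_mul (ζ ^ l * star ζ ^ l') M
    rw [hx, sub_self] at h3
    exact (mul_eq_zero.1 h3).resolve_right (sub_ne_zero.2 hne)

/-- Parseval's identity on a coset of the `M`-th roots of unity. -/
theorem sum_normSq_eval_roots {M : ℕ} {ζ : ℂ} (hζ : IsPrimitiveRoot ζ M) (hnorm : ‖ζ‖ = 1)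
    {f : Polynomial ℂ} (hf : f.natDegree < M) {w : ℂ} (hw : ‖w‖ = 1) :
    ∑ j ∈ Finset.range M, ‖f.eval (w * ζ ^ j)‖ ^ 2
      = M * ∑ l ∈ Finset.range M, ‖f.coeff l‖ ^ 2 := by
  have hww : w * star w = 1 := by rw [mul_star_eq_normSq, hw]; simp
  have h : ∑ j ∈ Finset.range M, f.eval (w * ζ ^ j) * star (f.eval (w * ζ ^ j))
      = M * ∑ l ∈ Finset.range M, f.coeff l * star (f.coeff l) := by
    calc ∑ j ∈ Finset.range M, f.eval (w * ζ ^ j) * star (f.eval (w * ζ ^ j))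
        = ∑ j ∈ Finset.range M, ∑ l ∈ Finset.range M, ∑ l' ∈ Finset.range M,
            f.coeff l * star (f.coeff l') * (w ^ l * star w ^ l') *
              (ζ ^ l * star ζ ^ l') ^ j := by
          refine Finset.sum_congr rfl fun j _ => ?_
          rw [Polynomial.eval_eq_sum_range' hf, star_sum, Finset.sum_mul_sum]
          refine Finset.sum_congr rfl fun l _ => Finset.sum_congr rfl fun l' _ => ?_
          simp only [star_mul', star_pow]
          ring
      _ = ∑ l ∈ Finset.range M, ∑ l' ∈ Finset.range M,
            f.coeff l * star (f.coeff l') * (w ^ l * star w ^ l') *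
              (if l = l' then (M : ℂ) else 0) := by
          rw [Finset.sum_comm]
          refine Finset.sum_congr rfl fun l hl => ?_
          rw [Finset.sum_comm]
          refine Finset.sum_congr rfl fun l' hl' => ?_
          rw [← Finset.mul_sum, sum_pow_primitiveRoot hζ (Finset.mem_range.1 hl)
            (Finset.mem_range.1 hl') hnorm]
      _ = _ := by
          rw [Finset.mul_sum]
          refine Finset.sum_congr rfl fun l hl => ?_
          simp only [mul_ite, mul_zero, Finset.sum_ite_eq, hl, if_true]
          rw [← mul_pow, hww]; simp; ring
  simp only [mul_star_eq_normSq] at h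
  exact_mod_cast h

/-- With `z = exp (i θ)` and `w = exp (i φ)` the right side is `2 |sin (θ - φ)|`, and expanding `θ =
(θ - φ) + φ` gives `|cos θ| ≤ |cos φ| + |sin (θ - φ)|`, symmetrically in the two angles. -/
theorem abs_re_sub_abs_re_le {z w : ℂ} (hz : ‖z‖ = 1) (hw : ‖w‖ = 1) :
    2 * |(|z.re| - |w.re|)| ≤ ‖z ^ 2 - w ^ 2‖ := by
  have hz2 : z * star z = 1 := by rw [mul_star_eq_normSq, hz]; simp
  have hw2 : w * star w = 1 := by rw [mul_star_eq_normSq, hw]; simp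
  set u := z * star w with hu
  have hun : ‖u‖ = 1 := by rw [hu, norm_mul, norm_star, hz, hw, one_mul]
  have h1 : ‖z ^ 2 - w ^ 2‖ = 2 * |u.im| := by
    have h2 : z ^ 2 - w ^ 2 = z * w * (u - star u) := by
      rw [hu, star_mul', star_star]
      linear_combination (-z ^ 2) * hw2 + w ^ 2 * hz2
    have h3 : u - star u = ((2 * u.im : ℝ) : ℂ) * Complex.I := by
      apply Complex.ext <;> simp
      ring
    rw [h2, h3, norm_mul, norm_mul, hz, hw, norm_mul, Complex.norm_real, Complex.norm_I,
      Real.norm_eq_abs, abs_mul]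
    simp
  rw [h1]
  have hure : |u.re| ≤ 1 := hun ▸ Complex.abs_re_le_norm u
  have hzim : |z.im| ≤ 1 := hz ▸ Complex.abs_im_le_norm z
  have hwim : |w.im| ≤ 1 := hw ▸ Complex.abs_im_le_norm w
  have e1 : z = u * w := by rw [hu]; linear_combination (-z) * hw2
  have e2 : w = star u * z := by rw [hu, star_mul', star_star]; linear_combination (-w) * hz2
  have e1' : z.re = u.re * w.re - u.im * w.im := by
    conv_lhs => rw [e1]
    exact Complex.mul_re _ _
  have e2' : w.re = u.re * z.re + u.im * z.im := by
    conv_lhs => rw [e2]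
    simp [Complex.mul_re]
  have key : ∀ a b c d : ℝ, |a| ≤ 1 → |d| ≤ 1 → |a * b + c * d| ≤ |b| + |c| := fun a b c d ha hd => by
    refine (abs_add_le _ _).trans ?_
    rw [abs_mul, abs_mul]
    exact add_le_add (mul_le_of_le_one_left (abs_nonneg _) ha)
      (mul_le_of_le_one_right (abs_nonneg _) hd)
  have k1 : |z.re| ≤ |w.re| + |u.im| := by
    rw [e1', sub_eq_add_neg, ← neg_mul]
    simpa using key u.re w.re (-u.im) w.im hure hwim
  have k2 : |w.re| ≤ |z.re| + |u.im| := by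
    rw [e2']; exact key _ _ _ _ hure hzim
  have : |(|z.re| - |w.re|)| ≤ |u.im| := abs_le.2 ⟨by linarith, by linarith⟩
  linarith

theorem norm_geom_sum_le {N : ℕ} {u : ℂ} {δ : ℝ} (hδ : 0 < δ) (hu : ‖u‖ = 1)
    (h : 2 * δ ≤ ‖u - 1‖) : ‖∑ i ∈ Finset.range N, u ^ i‖ ≤ 1 / δ := by
  have h1 : ‖∑ i ∈ Finset.range N, u ^ i‖ * ‖u - 1‖ ≤ 2 := by
    rw [← norm_mul, geom_sum_mul]
    refine (norm_sub_le _ _).trans ?_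
    rw [norm_pow, hu]; norm_num
  rw [le_div_iff₀ hδ]
  have := mul_le_mul_of_nonneg_left h (norm_nonneg (∑ i ∈ Finset.range N, u ^ i))
  linarith

/-- The weights `‖f (u ζ ^ j)‖ ^ 2` form a discrete kernel whose total mass is independent of `u` by
Parseval. Taking `f` to be a power of a geometric sum makes the mass at nodes with a different
`|cos|` exponentially small in the exponent. The node `w j` is a square root of `ζ ^ (-j)`, the
point where the `j`-th weight peaks as a function of `z ^ 2`. -/
theorem exists_concentrated_kernel {δ ε : ℝ} (hδ : 0 < δ) (hδ1 : δ ≤ 1) (hε : 0 < ε) (hε1 : ε < 1) :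
    ∃ (D M : ℕ) (f : Polynomial ℂ) (ζ : ℂ) (w : ℕ → ℂ) (Z : ℝ),
      (D : ℝ) ≤ 24 / δ * Real.log (2 / ε) ∧ f.natDegree ≤ D ∧ 0 < Z ∧ ‖ζ‖ = 1 ∧
      (∀ j, ‖w j‖ = 1) ∧
      (∀ u : ℂ, ‖u‖ = 1 → ∑ j ∈ Finset.range M, ‖f.eval (u * ζ ^ j)‖ ^ 2 = Z) ∧
      ∀ z : ℂ, ‖z‖ = 1 →
        ∑ j ∈ Finset.range M with δ ≤ |(|z.re| - |(w j).re|)|, ‖f.eval (z ^ 2 * ζ ^ j)‖ ^ 2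
          ≤ Z * (ε / 4) := by
  set L := Real.log (2 / ε) with hL
  have hLlog : Real.log 2 ≤ L := Real.log_le_log (by norm_num) (by
    rw [le_div_iff₀ hε]; linarith)
  have hlog2 := Real.log_two_gt_d9
  have hL0 : 0 < L := by linarith
  -- The length `N` makes the geometric sum at most `N / 2` away from its peak; the exponent `k`
  -- turns this factor `1 / 2` into an error of order `ε`.
  set k := ⌈6 * L⌉₊ with hk
  set N := ⌈2 / δ⌉₊ with hN
  have hk0 : 0 < k := Nat.ceil_pos.2 (by positivity)
  have hN0 : 0 < N := Nat.ceil_pos.2 (by positivity)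
  have hkle : (k : ℝ) ≤ 8 * L := by
    have := (Nat.ceil_lt_add_one (by positivity : 0 ≤ 6 * L)).le
    linarith
  have hNle : (N : ℝ) ≤ 3 / δ := by
    have := (Nat.ceil_lt_add_one (by positivity : 0 ≤ 2 / δ)).le
    have h1 : 1 ≤ 1 / δ := by rw [le_div_iff₀ hδ]; linarith
    have h2 : 3 / δ = 2 / δ + 1 / δ := by ring
    linarith
  have hNge : 2 / δ ≤ N := Nat.le_ceil _
  have hk2 : 8 / ε ≤ 2 ^ k := by
    have h1 : (6 * L) ≤ k := Nat.le_ceil _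
    have h2 : Real.exp (3 * L) ≤ 2 ^ k := by
      rw [← Real.rpow_natCast, Real.rpow_def_of_pos (by norm_num)]
      apply Real.exp_le_exp.2
      nlinarith
    have h3 : Real.exp (3 * L) = (2 / ε) ^ 3 := by
      rw [show 3 * L = ((3 : ℕ) : ℝ) * L by norm_num, Real.exp_nat_mul, hL,
        Real.exp_log (by positivity)]
    refine le_trans ?_ (h3 ▸ h2)
    rw [div_pow, div_le_div_iff₀ hε (by positivity)]
    nlinarith [pow_pos hε 2, pow_pos hε 3]
  set M := k * N with hM
  have hM0 : 0 < M := Nat.mul_pos hk0 hN0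
  set G : Polynomial ℂ := ∑ i ∈ Finset.range N, Polynomial.X ^ i with hG
  have hGe : ∀ u : ℂ, G.eval u = ∑ i ∈ Finset.range N, u ^ i := fun u => by
    rw [hG, Polynomial.eval_finsetSum]; simp
  have hGd : G.natDegree ≤ N - 1 := by
    refine Polynomial.natDegree_sum_le_of_forall_le _ _ fun i hi => ?_
    refine (Polynomial.natDegree_X_pow_le i).trans ?_
    have := Finset.mem_range.1 hi; omega
  have hGc : ∀ l, G.coeff l = if l < N then 1 else 0 := fun l => by
    rw [hG, Polynomial.finsetSum_coeff]
    simp [Polynomial.coeff_X_pow]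
  have hfd : (G ^ k).natDegree ≤ k * (N - 1) :=
    Polynomial.natDegree_pow_le.trans (Nat.mul_le_mul_left k hGd)
  have hDM : k * (N - 1) < M := Nat.mul_lt_mul_of_pos_left (by omega) hk0
  have hNM : N - 1 < M := by
    have : N ≤ M := Nat.le_mul_of_pos_left N hk0
    omega
  have hζ := Complex.isPrimitiveRoot_exp M hM0.ne'
  set ζ := Complex.exp (2 * Real.pi * Complex.I / M) with hζdef
  have hζn : ‖ζ‖ = 1 := hζ.norm'_eq_one hM0.ne'
  have hw : ∀ j : ℕ, ∃ w : ℂ, w ^ 2 = (ζ ^ j)⁻¹ := fun j =>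
    IsAlgClosed.exists_pow_nat_eq _ two_pos
  choose w hw using hw
  have hwn : ∀ j, ‖w j‖ = 1 := fun j => by
    have h : ‖w j‖ ^ 2 = 1 := by rw [← norm_pow, hw, norm_inv, norm_pow, hζn]; simp
    exact (pow_eq_one_iff_of_nonneg (norm_nonneg _) two_ne_zero).1 h
  set Z : ℝ := M * ∑ l ∈ Finset.range M, ‖(G ^ k).coeff l‖ ^ 2 with hZ
  -- Cauchy–Schwarz for the `M` coefficients, whose sum is the value `N ^ k` at `1`.
  have hZge : (N : ℝ) ^ (2 * k) ≤ Z := by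
    have h1 : ‖(G ^ k).eval 1‖ = (N : ℝ) ^ k := by
      rw [Polynomial.eval_pow, hGe]; simp
    have h2 : (G ^ k).eval 1 = ∑ l ∈ Finset.range M, (G ^ k).coeff l := by
      rw [Polynomial.eval_eq_sum_range' (lt_of_le_of_lt hfd hDM)]; simp
    have h3 : (N : ℝ) ^ k ≤ ∑ l ∈ Finset.range M, ‖(G ^ k).coeff l‖ := by
      rw [← h1, h2]; exact norm_sum_le _ _
    have h4 := sq_sum_le_card_mul_sum_sq (s := Finset.range M) (f := fun l => ‖(G ^ k).coeff l‖)
    rw [Finset.card_range] at h4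
    refine le_trans ?_ h4
    rw [mul_comm, pow_mul]
    exact pow_le_pow_left₀ (by positivity) h3 2
  have hNR : (0 : ℝ) < N := by exact_mod_cast hN0
  have hZ0 : 0 < Z := lt_of_lt_of_le (by positivity) hZge
  refine ⟨k * (N - 1), M, G ^ k, ζ, w, Z, ?_, hfd, hZ0, hζn, hwn, fun u hu =>
    sum_normSq_eval_roots hζ hζn (lt_of_le_of_lt hfd hDM) hu, fun z hz => ?_⟩
  · have h1 : ((k * (N - 1) : ℕ) : ℝ) ≤ k * N := by
      exact_mod_cast Nat.mul_le_mul_left k (Nat.sub_le N 1)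
    refine h1.trans ((mul_le_mul hkle hNle hNR.le (by positivity)).trans (le_of_eq ?_))
    ring
  · have hz2 : ‖z ^ 2‖ = 1 := by rw [norm_pow, hz, one_pow]
    -- All but one of the `k` factors are bounded pointwise; the last one is kept so that its sum
    -- over all nodes can be evaluated by Parseval as `M * N`.
    have hbound : ∀ j ∈ (Finset.range M).filter (fun j => δ ≤ |(|z.re| - |(w j).re|)|),
        ‖(G ^ k).eval (z ^ 2 * ζ ^ j)‖ ^ 2
          ≤ ((N : ℝ) / 2) ^ (2 * (k - 1)) * ‖G.eval (z ^ 2 * ζ ^ j)‖ ^ 2 := by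
      intro j hj
      have hj2 := (Finset.mem_filter.1 hj).2
      have hun : ‖z ^ 2 * ζ ^ j‖ = 1 := by rw [norm_mul, hz2, norm_pow, hζn]; simp
      have h1 : ‖z ^ 2 * ζ ^ j - 1‖ = ‖z ^ 2 - w j ^ 2‖ := by
        have hζ0 : ζ ^ j ≠ 0 := pow_ne_zero _ (ne_zero_of_norm_one hζn)
        have : z ^ 2 * ζ ^ j - 1 = (z ^ 2 - w j ^ 2) * ζ ^ j := by
          rw [hw, sub_mul, inv_mul_cancel₀ hζ0]
        rw [this, norm_mul, norm_pow, hζn]; simp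
      have h2 : ‖G.eval (z ^ 2 * ζ ^ j)‖ ≤ N / 2 := by
        rw [hGe]
        refine (norm_geom_sum_le hδ hun ?_).trans ?_
        · rw [h1]
          exact le_trans (by linarith) (abs_re_sub_abs_re_le hz (hwn j))
        · have : 1 / δ = (2 / δ) / 2 := by ring
          rw [this]; linarith
      rw [Polynomial.eval_pow, norm_pow]
      obtain ⟨k', hk'⟩ : ∃ k', k = k' + 1 := ⟨k - 1, by omega⟩
      rw [hk', Nat.add_sub_cancel, ← pow_mul, show (k' + 1) * 2 = 2 * k' + 2 by ring, pow_add]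
      gcongr
    refine (Finset.sum_le_sum hbound).trans ?_
    have h1 : ∑ j ∈ Finset.range M with δ ≤ |(|z.re| - |(w j).re|)|,
        ((N : ℝ) / 2) ^ (2 * (k - 1)) * ‖G.eval (z ^ 2 * ζ ^ j)‖ ^ 2
        ≤ ((N : ℝ) / 2) ^ (2 * (k - 1)) * (M * N) := by
      rw [← Finset.mul_sum]
      refine mul_le_mul_of_nonneg_left ?_ (by positivity)
      refine (Finset.sum_le_sum_of_subset_of_nonneg (Finset.filter_subset _ _)
        fun _ _ _ => by positivity).trans (le_of_eq ?_)
      rw [sum_normSq_eval_roots hζ hζn (lt_of_le_of_lt hGd hNM) hz2]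
      congr 1
      have : ∀ l ∈ Finset.range M, ‖G.coeff l‖ ^ 2 = if l < N then (1 : ℝ) else 0 := fun l _ => by
        rw [hGc]; split_ifs <;> simp
      rw [Finset.sum_congr rfl this, Finset.sum_ite]
      simp only [Finset.sum_const, nsmul_eq_mul, mul_one, mul_zero, add_zero]
      have : (Finset.range M).filter (fun l => l < N) = Finset.range N := by
        ext l; simp only [Finset.mem_filter, Finset.mem_range]; omega
      rw [this, Finset.card_range]
    -- The tail relative to `N ^ (2 * k)` is exactly `k / 4 ^ (k - 1)`, which is at most `1 / 2 ^ (k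
    -- - 1)`.
    refine h1.trans ((le_of_eq ?_).trans (mul_le_mul_of_nonneg_right hZge (by positivity)
      |>.trans' (mul_le_mul_of_nonneg_left (?_ : (k : ℝ) / 4 ^ (k - 1) ≤ ε / 4) (by positivity))))
    · obtain ⟨k', hk'⟩ : ∃ k', k = k' + 1 := ⟨k - 1, by omega⟩
      rw [hM, hk', Nat.add_sub_cancel, div_pow, pow_mul 2 2]
      push_cast
      field_simp
      ring
    · obtain ⟨k', hk'⟩ : ∃ k', k = k' + 1 := ⟨k - 1, by omega⟩
      rw [hk'] at hk2 ⊢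
      rw [Nat.add_sub_cancel]
      have h3 : ((k' + 1 : ℕ) : ℝ) ≤ 2 ^ k' := by exact_mod_cast Nat.lt_two_pow_self
      rw [div_le_iff₀ hε, pow_succ] at hk2
      rw [div_le_iff₀ (by positivity), show (4 : ℝ) = 2 * 2 by norm_num, mul_pow]
      have h4 : (1 : ℝ) ≤ 2 ^ k' * ε / 4 := by linarith
      have h5 : (0 : ℝ) < 2 ^ k' := by positivity
      calc ((k' + 1 : ℕ) : ℝ) ≤ 2 ^ k' * 1 := by linarith
        _ ≤ 2 ^ k' * (2 ^ k' * ε / 4) := by gcongr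
        _ = _ := by ring

/-- Polynomial approximation of a step function of `|cos θ|` in the variable `exp (2 i θ)`. -/
theorem exists_step_polynomial {δ ε x₀ v₁ v₂ : ℝ} (hδ : 0 < δ) (hδ1 : δ ≤ 1) (hε : 0 < ε)
    (hε1 : ε < 1) (hv₁ : |v₁| ≤ 1) (hv₂ : |v₂| ≤ 1) :
    ∃ (D : ℕ) (P : Polynomial ℂ), (D : ℝ) ≤ 24 / δ * Real.log (2 / ε) ∧ P.natDegree ≤ 2 * D ∧
      (∀ w : ℂ, ‖w‖ = 1 → ‖P.eval w‖ < 1) ∧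
      ∀ z : ℂ, ‖z‖ = 1 →
        (|z.re| ≤ x₀ - δ → ‖P.eval (z ^ 2) - v₁ * (z ^ 2) ^ D‖ ≤ ε) ∧
        (x₀ + δ ≤ |z.re| → ‖P.eval (z ^ 2) - v₂ * (z ^ 2) ^ D‖ ≤ ε) := by
  obtain ⟨D, M, f, ζ, w, Z, hD, hf, hZ, hζ, hw, hsum, htail⟩ :=
    exists_concentrated_kernel hδ hδ1 hε hε1
  set S : ℕ → ℝ := fun j => if |(w j).re| < x₀ then v₁ else v₂ with hS
  have hS1 : ∀ j, |S j| ≤ 1 := fun j => by rw [hS]; dsimp only; split_ifs <;> assumption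
  -- The kernel average of the node values `S j`, multiplied by `u ^ D` to become a polynomial. The
  -- factor `((ζ ^ j) ^ D)⁻¹` cancels the phase of `f * conjReflect D f` at `u * ζ ^ j`, and `1 - ε
  -- / 2` makes the modulus strictly less than one.
  set P : Polynomial ℂ := Polynomial.C (((1 - ε / 2) / Z : ℝ) : ℂ) * ∑ j ∈ Finset.range M,
    Polynomial.C ((S j : ℂ) * ((ζ ^ j) ^ D)⁻¹) *
      (f * conjReflect D f).comp (Polynomial.C (ζ ^ j) * Polynomial.X) with hP
  have heval : ∀ u : ℂ, ‖u‖ = 1 → P.eval u =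
      u ^ D * (((1 - ε / 2) / Z * ∑ j ∈ Finset.range M, S j * ‖f.eval (u * ζ ^ j)‖ ^ 2 : ℝ) : ℂ) := by
    intro u hu
    rw [hP, Polynomial.eval_mul, Polynomial.eval_C, Polynomial.eval_finsetSum, Complex.ofReal_mul,
      Complex.ofReal_sum, mul_left_comm (u ^ D)]
    congr 1
    rw [Finset.mul_sum]
    refine Finset.sum_congr rfl fun j _ => ?_
    have hun : ‖u * ζ ^ j‖ = 1 := by rw [norm_mul, hu, norm_pow, hζ]; simp
    have hz0 : (ζ ^ j) ^ D ≠ 0 := pow_ne_zero _ (pow_ne_zero _ (ne_zero_of_norm_one hζ))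
    simp only [Polynomial.eval_mul, Polynomial.eval_C, Polynomial.eval_comp, Polynomial.eval_X]
    rw [mul_comm (ζ ^ j) u, conjReflect_eval_circle hf hun, Complex.ofReal_mul,
      ← mul_star_eq_normSq, mul_pow]
    field_simp
  have hupper : ∀ u : ℂ, ‖u‖ = 1 →
      |∑ j ∈ Finset.range M, S j * ‖f.eval (u * ζ ^ j)‖ ^ 2| ≤ Z := fun u hu => by
    refine (Finset.abs_sum_le_sum_abs _ _).trans ?_
    rw [← hsum u hu]
    refine Finset.sum_le_sum fun j _ => ?_
    rw [abs_mul, abs_of_nonneg (by positivity : 0 ≤ ‖f.eval (u * ζ ^ j)‖ ^ 2)]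
    exact mul_le_of_le_one_left (by positivity) (hS1 j)
  have happrox : ∀ (z : ℂ) (v : ℝ), ‖z‖ = 1 → |v| ≤ 1 →
      (∀ j, S j ≠ v → δ ≤ |(|z.re| - |(w j).re|)|) →
      ‖P.eval (z ^ 2) - v * (z ^ 2) ^ D‖ ≤ ε := by
    intro z v hz hv hj
    have hz2 : ‖z ^ 2‖ = 1 := by rw [norm_pow, hz, one_pow]
    set T := ∑ j ∈ Finset.range M, S j * ‖f.eval (z ^ 2 * ζ ^ j)‖ ^ 2 with hT
    have h1 : ‖P.eval (z ^ 2) - v * (z ^ 2) ^ D‖ = |(1 - ε / 2) / Z * T - v| := by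
      rw [heval _ hz2, mul_comm (v : ℂ), ← mul_sub, ← Complex.ofReal_sub, norm_mul, norm_pow, hz2,
        Complex.norm_real, Real.norm_eq_abs]
      simp [hT]
    have h2 : |T - v * Z| ≤ 2 * (Z * (ε / 4)) := by
      have h3 : T - v * Z = ∑ j ∈ Finset.range M, (S j - v) * ‖f.eval (z ^ 2 * ζ ^ j)‖ ^ 2 := by
        rw [← hsum _ hz2, Finset.mul_sum, hT, ← Finset.sum_sub_distrib]
        exact Finset.sum_congr rfl fun j _ => by ring
      rw [h3]
      refine (Finset.abs_sum_le_sum_abs _ _).trans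
        (le_trans ?_ (mul_le_mul_of_nonneg_left (htail z hz) zero_le_two))
      rw [Finset.mul_sum, Finset.sum_filter]
      refine Finset.sum_le_sum fun j _ => ?_
      rw [abs_mul, abs_of_nonneg (by positivity : 0 ≤ ‖f.eval (z ^ 2 * ζ ^ j)‖ ^ 2)]
      by_cases hSv : S j = v
      · rw [hSv]
        split_ifs <;> simp
      · rw [if_pos (hj j hSv)]
        refine mul_le_mul_of_nonneg_right ?_ (by positivity)
        refine (abs_sub _ _).trans ?_
        linarith [hS1 j]
    rw [h1]
    -- One half of `ε` pays for the kernel tail, where node values differ from `v` by at most `2`,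
    -- the other for the shrinking factor.
    have h4 : (1 - ε / 2) / Z * T - v = (1 - ε / 2) * ((T - v * Z) / Z) - ε / 2 * v := by
      field_simp; ring
    have h5 : |(T - v * Z) / Z| ≤ ε / 2 := by
      rw [abs_div, abs_of_pos hZ, div_le_iff₀ hZ]; linarith
    rw [h4]
    refine (abs_sub _ _).trans ?_
    rw [abs_mul, abs_mul, abs_of_pos (by linarith : 0 < 1 - ε / 2), abs_of_pos (by linarith : 0 < ε / 2)]
    have h6 : (1 - ε / 2) * |(T - v * Z) / Z| ≤ 1 * (ε / 2) :=
      mul_le_mul (by linarith) h5 (abs_nonneg _) zero_le_one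
    have h7 : ε / 2 * |v| ≤ ε / 2 * 1 := mul_le_mul_of_nonneg_left hv (by linarith)
    linarith
  refine ⟨D, P, hD, ?_, fun u hu => ?_, fun z hz => ⟨fun h => ?_, fun h => ?_⟩⟩
  · refine (Polynomial.natDegree_C_mul_le _ _).trans ?_
    refine Polynomial.natDegree_sum_le_of_forall_le _ _ fun j _ => ?_
    refine (Polynomial.natDegree_C_mul_le _ _).trans ?_
    refine Polynomial.natDegree_comp_le.trans ?_
    have h1 : (f * conjReflect D f).natDegree ≤ 2 * D :=
      Polynomial.natDegree_mul_le.trans (by have := conjReflect_natDegree_le hf; omega)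
    have h2 : (Polynomial.C (ζ ^ j) * Polynomial.X).natDegree ≤ 1 :=
      (Polynomial.natDegree_C_mul_le _ _).trans Polynomial.natDegree_X_le
    calc _ ≤ 2 * D * 1 := Nat.mul_le_mul h1 h2
      _ = _ := by ring
  · rw [heval u hu, norm_mul, norm_pow, hu, one_pow, one_mul, Complex.norm_real, Real.norm_eq_abs,
      abs_mul, abs_of_pos (by have : 0 < 1 - ε / 2 := by linarith
                              positivity : 0 < (1 - ε / 2) / Z)]
    have h1 := mul_le_mul_of_nonneg_left (hupper u hu)
      (by have : 0 < 1 - ε / 2 := by linarith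
          positivity : 0 ≤ (1 - ε / 2) / Z)
    rw [div_mul_cancel₀ _ hZ.ne'] at h1
    linarith
  · refine happrox z v₁ hz hv₁ fun j hj => ?_
    have h1 : x₀ ≤ |(w j).re| := by
      by_contra h2; exact hj (if_pos (not_le.1 h2))
    rw [abs_sub_comm]; exact le_trans (by linarith) (le_abs_self _)
  · refine happrox z v₂ hz hv₂ fun j hj => ?_
    have h1 : |(w j).re| < x₀ := by
      by_contra h2; exact hj (if_neg h2)
    exact le_trans (by linarith) (le_abs_self _)

/-! ### Operators on selected wires, and circuits with resource counts. -/

theorem extend_of_forall_ne {R Q : Type} (e : R ↪ Q) (w : R → Fin 2) (x : Q → Fin 2) {q : Q}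
    (h : ∀ r, e r ≠ q) : Function.extend e w x q = x q :=
  Function.extend_apply' _ _ _ (by rintro ⟨r, hr⟩; exact h r hr)

theorem extend_comp_embedding {R Q : Type} (e : R ↪ Q) (w : R → Fin 2) (x : Q → Fin 2) :
    Function.extend e w x ∘ e = w := by
  funext r; exact e.injective.extend_apply _ _ _

section OnWires

set_option linter.unusedSectionVars false

variable {R S Q : Type} [Fintype R] [Fintype S] [Fintype Q] [DecidableEq R] [DecidableEq S]
  [DecidableEq Q]

theorem onWires_mul (e : R ↪ Q) (G H : QMatrix R) :
    onWires e (G * H) = onWires e G * onWires e H := by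
  ext x y
  rw [Matrix.mul_apply]
  simp only [onWires]
  -- Only intermediate states agreeing with `x` off the selected wires contribute, and they are
  -- parametrized by their values on `R`.
  have hsum : ∑ w : R → Fin 2, G (x ∘ e) w * (if ∀ q, (∀ r, e r ≠ q) → x q = y q
        then H w (y ∘ e) else 0)
      = ∑ z : Q → Fin 2, (if ∀ q, (∀ r, e r ≠ q) → x q = z q then G (x ∘ e) (z ∘ e) else 0) *
        (if ∀ q, (∀ r, e r ≠ q) → z q = y q then H (z ∘ e) (y ∘ e) else 0) := by
    refine Fintype.sum_of_injective (fun w => Function.extend e w x) ?_ _ _ ?_ ?_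
    · intro w w' h
      have := congrArg (fun f => f ∘ e) h
      simpa only [extend_comp_embedding] using this
    · intro z hz
      rw [if_neg, zero_mul]
      intro h
      apply hz
      refine ⟨z ∘ e, funext fun q => ?_⟩
      by_cases hq : ∃ r, e r = q
      · obtain ⟨r, rfl⟩ := hq
        exact e.injective.extend_apply _ _ _
      · push Not at hq
        exact (extend_of_forall_ne e _ _ hq).trans (h q hq)
    · intro w
      simp only [extend_comp_embedding]
      rw [if_pos fun q hq => (extend_of_forall_ne e w x hq).symm]
      congr 1
      refine if_congr ?_ rfl rfl
      exact forall₂_congr fun q hq => by rw [extend_of_forall_ne e w x hq]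
  rw [← hsum]
  split_ifs with h
  · rw [Matrix.mul_apply]
  · simp

theorem onWires_one (e : R ↪ Q) : onWires e (1 : QMatrix R) = 1 := by
  ext x y
  simp only [onWires, Matrix.one_apply]
  by_cases hxy : x = y
  · subst hxy; simp
  · rw [if_neg hxy]
    by_cases h : ∀ q, (∀ r, e r ≠ q) → x q = y q
    · rw [if_pos h, if_neg]
      intro h2
      apply hxy
      funext q
      by_cases hq : ∃ r, e r = q
      · obtain ⟨r, rfl⟩ := hq
        exact congrFun h2 r
      · push Not at hq
        exact h q hq
    · rw [if_neg h]

theorem onWires_star (e : R ↪ Q) (G : QMatrix R) : onWires e (star G) = star (onWires e G) := by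
  ext x y
  simp only [onWires, Matrix.star_apply, apply_ite star, star_zero]
  refine if_congr ?_ rfl rfl
  exact forall₂_congr fun q _ => eq_comm

theorem onWires_mem_unitary (e : R ↪ Q) {G : QMatrix R}
    (hG : G ∈ Matrix.unitaryGroup (R → Fin 2) ℂ) :
    onWires e G ∈ Matrix.unitaryGroup (Q → Fin 2) ℂ := by
  rw [Matrix.mem_unitaryGroup_iff] at hG ⊢
  rw [← onWires_star, ← onWires_mul, hG, onWires_one]

theorem onWires_onWires (e : R ↪ S) (f : S ↪ Q) (G : QMatrix R) :
    onWires f (onWires e G) = onWires (e.trans f) G := by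
  ext x y
  simp only [onWires]
  by_cases h : ∀ q, (∀ r, (e.trans f) r ≠ q) → x q = y q
  · rw [if_pos h, if_pos, if_pos]
    · rfl
    · intro s hs
      exact h (f s) fun r hr => hs r (f.injective hr)
    · intro q hq
      exact h q fun r => hq (e r)
  · rw [if_neg h]
    by_cases h1 : ∀ q, (∀ s, f s ≠ q) → x q = y q
    · rw [if_pos h1, if_neg]
      intro h2
      apply h
      intro q hq
      by_cases hs : ∃ s, f s = q
      · obtain ⟨s, rfl⟩ := hs
        exact h2 s fun r hr => hq r (congrArg f hr)
      · push Not at hs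
        exact h1 q hs
    · rw [if_neg h1]

theorem controlled_mul (U V : QMatrix R) : controlled (U * V) = controlled U * controlled V := by
  ext x y
  rw [Matrix.mul_apply]
  have hsum : ∑ w : R → Fin 2,
      (if x none = 1 then U (x ∘ some) w else (1 : QMatrix R) (x ∘ some) w) *
        (if x none = y none then (if x none = 1 then V w (y ∘ some)
          else (1 : QMatrix R) w (y ∘ some)) else 0)
      = ∑ z : Option R → Fin 2, controlled U x z * controlled V z y := by
    refine Fintype.sum_of_injective (fun w => fun o : Option R => o.elim (x none) w) ?_ _ _ ?_ ?_
    · intro w w' h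
      exact congrArg (fun f => f ∘ some) h
    · intro z hz
      have : x none ≠ z none := by
        intro h
        apply hz
        refine ⟨z ∘ some, funext fun o => ?_⟩
        cases o
        · exact h
        · rfl
      simp only [controlled]
      rw [if_neg this, zero_mul]
    · intro w
      simp only [controlled, Option.elim_none, if_true]
      rfl
  rw [← hsum]
  simp only [controlled]
  by_cases h : x none = y none
  · simp only [if_pos h]
    by_cases h1 : x none = 1
    · simp only [if_pos h1, Matrix.mul_apply]
    · simp only [if_neg h1, ← Matrix.mul_apply, one_mul]
  · simp [if_neg h]

theorem controlled_one : controlled (1 : QMatrix R) = 1 := by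
  ext x y
  simp only [controlled, ite_self, Matrix.one_apply]
  by_cases h : x = y
  · subst h; simp
  · rw [if_neg h]
    split_ifs with h1 h2
    · exfalso
      apply h
      funext o
      cases o
      · exact h1
      · exact congrFun h2 _
    · rfl
    · rfl

theorem controlled_star (U : QMatrix R) : controlled (star U) = star (controlled U) := by
  ext x y
  simp only [controlled, Matrix.star_apply]
  by_cases h : x none = y none
  · rw [if_pos h, if_pos h.symm, h]
    by_cases h1 : y none = 1
    · simp [if_pos h1]
    · simp only [if_neg h1, Matrix.one_apply, eq_comm (a := x ∘ some)]
      split_ifs <;> simp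
  · rw [if_neg h, if_neg (Ne.symm h), star_zero]

theorem controlled_mem_unitary {U : QMatrix R} (hU : U ∈ Matrix.unitaryGroup (R → Fin 2) ℂ) :
    controlled U ∈ Matrix.unitaryGroup (Option R → Fin 2) ℂ := by
  rw [Matrix.mem_unitaryGroup_iff] at hU ⊢
  rw [← controlled_star, ← controlled_mul, hU, controlled_one]

theorem CircuitElement.toMatrix_mem_unitary {U : QMatrix R}
    (hU : U ∈ Matrix.unitaryGroup (R → Fin 2) ℂ) (g : CircuitElement R Q) :
    g.toMatrix U ∈ Matrix.unitaryGroup (Q → Fin 2) ℂ := by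
  have hU' : ∀ adj : Bool, (if adj then U.conjTranspose else U)
      ∈ Matrix.unitaryGroup (R → Fin 2) ℂ := fun adj => by
    cases adj
    · simpa using hU
    · exact Unitary.star_mem hU
  cases g with
  | oneQubit e G => exact onWires_mem_unitary e G.2
  | twoQubit e G => exact onWires_mem_unitary e G.2
  | query adj e => exact onWires_mem_unitary e (hU' adj)
  | controlledQuery adj e => exact onWires_mem_unitary e (controlled_mem_unitary (hU' adj))

theorem OracleCircuit.toMatrix_mem_unitary {U : QMatrix R}
    (hU : U ∈ Matrix.unitaryGroup (R → Fin 2) ℂ) (c : OracleCircuit R Q) :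
    c.toMatrix U ∈ Matrix.unitaryGroup (Q → Fin 2) ℂ := by
  induction c with
  | nil => exact one_mem _
  | cons g c ih => exact mul_mem ih (g.toMatrix_mem_unitary hU)

theorem OracleCircuit.toMatrix_append (U : QMatrix R) (c d : OracleCircuit R Q) :
    OracleCircuit.toMatrix U (c ++ d) = d.toMatrix U * c.toMatrix U := by
  induction c with
  | nil => simp [OracleCircuit.toMatrix]
  | cons g c ih =>
    rw [List.cons_append, OracleCircuit.toMatrix, ih, OracleCircuit.toMatrix, mul_assoc]

/-- Relabelling of the wires of a circuit element. -/
def CircuitElement.map (f : S ↪ Q) : CircuitElement R S → CircuitElement R Q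
  | .oneQubit e G => .oneQubit (e.trans f) G
  | .twoQubit e G => .twoQubit (e.trans f) G
  | .query adj e => .query adj (e.trans f)
  | .controlledQuery adj e => .controlledQuery adj (e.trans f)

theorem CircuitElement.toMatrix_map (f : S ↪ Q) (U : QMatrix R) (g : CircuitElement R S) :
    (g.map f).toMatrix U = onWires f (g.toMatrix U) := by
  cases g <;> simp only [CircuitElement.map, CircuitElement.toMatrix, onWires_onWires]

theorem CircuitElement.isQuery_map (f : S ↪ Q) (g : CircuitElement R S) :
    (g.map f).isQuery = g.isQuery := by
  cases g <;> rfl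

variable (R) in
/-- The operators `F U`, for an oracle `U`, are implemented by one circuit with at most `q` queries
and at most `k` gates. -/
def Realizable (F : QMatrix R → QMatrix Q) (q k : ℕ) : Prop :=
  ∃ c : OracleCircuit R Q, (∀ U, c.toMatrix U = F U) ∧ c.queryCount ≤ q ∧ c.gateCount ≤ k

theorem Realizable.one : Realizable R (fun _ => (1 : QMatrix Q)) 0 0 :=
  ⟨[], fun _ => rfl, le_rfl, le_rfl⟩

theorem Realizable.mul {F G : QMatrix R → QMatrix Q} {q k q' k' : ℕ} (hG : Realizable R G q' k')
    (hF : Realizable R F q k) : Realizable R (fun U => G U * F U) (q' + q) (k' + k) := by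
  obtain ⟨c, hc, hcq, hck⟩ := hF
  obtain ⟨d, hd, hdq, hdk⟩ := hG
  refine ⟨c ++ d, fun U => by rw [OracleCircuit.toMatrix_append, hc, hd], ?_, ?_⟩
  · rw [OracleCircuit.queryCount, List.countP_append]
    exact (add_le_add hcq hdq).trans_eq (add_comm _ _)
  · rw [OracleCircuit.gateCount, List.countP_append]
    exact (add_le_add hck hdk).trans_eq (add_comm _ _)

theorem Realizable.mono {F : QMatrix R → QMatrix Q} {q k q' k' : ℕ} (hF : Realizable R F q k)
    (hq : q ≤ q') (hk : k ≤ k') : Realizable R F q' k' := by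
  obtain ⟨c, hc, hcq, hck⟩ := hF
  exact ⟨c, hc, hcq.trans hq, hck.trans hk⟩

theorem Realizable.onWires {F : QMatrix R → QMatrix S} {q k : ℕ} (hF : Realizable R F q k)
    (f : S ↪ Q) : Realizable R (fun U => onWires f (F U)) q k := by
  obtain ⟨c, hc, hcq, hck⟩ := hF
  refine ⟨List.map (CircuitElement.map f) c, fun U => ?_, ?_, ?_⟩
  · change _ = _root_.onWires f (F U)
    rw [← hc]
    clear hc hcq hck
    induction c with
    | nil => exact (onWires_one f).symm
    | cons g c ih =>
      rw [List.map_cons, OracleCircuit.toMatrix, ih, OracleCircuit.toMatrix, onWires_mul,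
        CircuitElement.toMatrix_map]
  · refine le_of_eq_of_le ?_ hcq
    simp only [OracleCircuit.queryCount, List.countP_map]
    congr 1
    funext g
    exact CircuitElement.isQuery_map f g
  · refine le_of_eq_of_le ?_ hck
    simp only [OracleCircuit.gateCount, List.countP_map]
    congr 1
    funext g
    exact congrArg _ (CircuitElement.isQuery_map f g)

end OnWires

/-! ### One-qubit gates selected by the other wires; the Toffoli gate. -/

section Fiberwise

set_option linter.unusedSectionVars false

variable {R S Q : Type} [Fintype R] [Fintype S] [Fintype Q] [DecidableEq R] [DecidableEq S]
  [DecidableEq Q]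

/-- The operator that applies to the wire `t` the one-qubit operator `G x` selected by the values of
the other wires. -/
def fiberwise (t : Q) (G : (Q → Fin 2) → Matrix (Fin 2) (Fin 2) ℂ) : QMatrix Q :=
  fun x y => if ∀ q, q ≠ t → x q = y q then G x (x t) (y t) else 0

/-- `G` does not depend on the wire `t`. -/
def IndependentOf {A : Type*} (t : Q) (G : (Q → Fin 2) → A) : Prop :=
  ∀ x b, G (Function.update x t b) = G x

theorem IndependentOf.eq_of_agree {A : Type*} {t : Q} {G : (Q → Fin 2) → A}
    (hG : IndependentOf t G) {x y : Q → Fin 2} (h : ∀ q, q ≠ t → x q = y q) : G x = G y := by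
  have : x = Function.update y t (x t) := by
    funext q
    by_cases hq : q = t
    · subst hq; simp
    · rw [Function.update_of_ne hq, h q hq]
  rw [this]; exact hG _ _

theorem fiberwise_mul {t : Q} (G : (Q → Fin 2) → Matrix (Fin 2) (Fin 2) ℂ)
    {H : (Q → Fin 2) → Matrix (Fin 2) (Fin 2) ℂ} (hH : IndependentOf t H) :
    fiberwise t G * fiberwise t H = fiberwise t (fun x => G x * H x) := by
  ext x y
  rw [Matrix.mul_apply]
  have hsum : ∑ b : Fin 2, G x (x t) b * (if ∀ q, q ≠ t → x q = y q then H x b (y t) else 0)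
      = ∑ z : Q → Fin 2, fiberwise t G x z * fiberwise t H z y := by
    refine Fintype.sum_of_injective (fun b => Function.update x t b) ?_ _ _ ?_ ?_
    · exact Function.update_injective x t
    · intro z hz
      simp only [fiberwise]
      rw [if_neg, zero_mul]
      intro h
      apply hz
      refine ⟨z t, funext fun q => ?_⟩
      by_cases hq : q = t
      · subst hq; simp
      · simp only [Function.update_of_ne hq, h q hq]
    · intro b
      simp only [fiberwise, Function.update_self, hH x b]
      rw [if_pos fun q hq => show x q = Function.update x t b q by rw [Function.update_of_ne hq]]
      congr 1
      refine if_congr ?_ rfl rfl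
      exact forall₂_congr fun q hq => by rw [Function.update_of_ne hq]
  rw [← hsum]
  simp only [fiberwise]
  split_ifs
  · rw [Matrix.mul_apply]
  · simp

theorem fiberwise_one (t : Q) : fiberwise t (fun _ => 1) = 1 := by
  ext x y
  simp only [fiberwise, Matrix.one_apply]
  by_cases h : x = y
  · subst h; simp
  · rw [if_neg h]
    split_ifs with h1 h2
    · exfalso
      apply h
      funext q
      by_cases hq : q = t
      · subst hq; exact h2
      · exact h1 q hq
    · rfl
    · rfl

theorem fiberwise_star {t : Q} {G : (Q → Fin 2) → Matrix (Fin 2) (Fin 2) ℂ}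
    (hG : IndependentOf t G) : star (fiberwise t G) = fiberwise t (fun x => star (G x)) := by
  ext x y
  simp only [fiberwise, Matrix.star_apply]
  by_cases h : ∀ q, q ≠ t → x q = y q
  · rw [if_pos h, if_pos fun q hq => (h q hq).symm, hG.eq_of_agree h]
  · rw [if_neg h, if_neg fun h2 => h fun q hq => (h2 q hq).symm, star_zero]

theorem IndependentOf.comp {A B : Type*} {t : Q} {G : (Q → Fin 2) → A} (hG : IndependentOf t G)
    (f : A → B) : IndependentOf t (fun x => f (G x)) := fun x b => congrArg f (hG x b)

theorem independentOf_const {A : Type*} (t : Q) (a : A) :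
    IndependentOf t (fun _ : Q → Fin 2 => a) := fun _ _ => rfl

theorem independentOf_apply {t p : Q} (h : p ≠ t) : IndependentOf t (fun x : Q → Fin 2 => x p) :=
  fun x b => Function.update_of_ne h b x

theorem fiberwise_mem_unitary {t : Q} {G : (Q → Fin 2) → Matrix (Fin 2) (Fin 2) ℂ}
    (hG : IndependentOf t G) (hu : ∀ x, G x ∈ Matrix.unitaryGroup (Fin 2) ℂ) :
    fiberwise t G ∈ Matrix.unitaryGroup (Q → Fin 2) ℂ := by
  rw [Matrix.mem_unitaryGroup_iff, fiberwise_star hG, fiberwise_mul _ (hG.comp star)]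
  have : (fun x => G x * star (G x)) = fun _ => 1 :=
    funext fun x => Matrix.mem_unitaryGroup_iff.1 (hu x)
  rw [this, fiberwise_one]

theorem onWires_fiberwise (e : R ↪ Q) (r : R) (G : (R → Fin 2) → Matrix (Fin 2) (Fin 2) ℂ) :
    onWires e (fiberwise r G) = fiberwise (e r) (fun x => G (x ∘ e)) := by
  ext x y
  simp only [onWires, fiberwise]
  by_cases h : ∀ q, q ≠ e r → x q = y q
  · rw [if_pos h, if_pos, if_pos]
    · rfl
    · exact fun r' hr' => h (e r') fun h2 => hr' (e.injective h2)
    · exact fun q hq => h q (hq r).symm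
  · rw [if_neg h]
    by_cases h1 : ∀ q, (∀ r, e r ≠ q) → x q = y q
    · rw [if_pos h1, if_neg]
      intro h2
      apply h
      intro q hq
      by_cases hs : ∃ s, e s = q
      · obtain ⟨s, rfl⟩ := hs
        exact h2 s fun h3 => hq (congrArg e h3)
      · push Not at hs
        exact h1 q hs
    · rw [if_neg h1]

theorem realizable_oneQubit (t : Q) {g : Matrix (Fin 2) (Fin 2) ℂ}
    (hg : g ∈ Matrix.unitaryGroup (Fin 2) ℂ) :
    Realizable R (fun _ => fiberwise t (fun _ => g)) 0 1 := by
  let e : Fin 1 ↪ Q := ⟨fun _ => t, fun a b _ => Subsingleton.elim a b⟩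
  let G : Matrix.unitaryGroup (Fin 1 → Fin 2) ℂ :=
    ⟨fiberwise 0 (fun _ => g), fiberwise_mem_unitary (independentOf_const _ _) fun _ => hg⟩
  refine ⟨[.oneQubit e G], fun U => ?_, by simp [OracleCircuit.queryCount, CircuitElement.isQuery],
    by simp [OracleCircuit.gateCount, CircuitElement.isQuery]⟩
  simp only [OracleCircuit.toMatrix, CircuitElement.toMatrix, one_mul, G]
  exact onWires_fiberwise e 0 _

theorem realizable_twoQubit {p t : Q} (hpt : p ≠ t) {g : Fin 2 → Matrix (Fin 2) (Fin 2) ℂ}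
    (hg : ∀ b, g b ∈ Matrix.unitaryGroup (Fin 2) ℂ) :
    Realizable R (fun _ => fiberwise t (fun x => g (x p))) 0 1 := by
  let e : Fin 2 ↪ Q := ⟨![p, t], by
    intro a b h
    fin_cases a <;> fin_cases b <;> simp_all [eq_comm]⟩
  let G : Matrix.unitaryGroup (Fin 2 → Fin 2) ℂ :=
    ⟨fiberwise 1 (fun x => g (x 0)), fiberwise_mem_unitary
      ((independentOf_apply (by decide)).comp g) fun _ => hg _⟩
  refine ⟨[.twoQubit e G], fun U => ?_, by simp [OracleCircuit.queryCount, CircuitElement.isQuery],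
    by simp [OracleCircuit.gateCount, CircuitElement.isQuery]⟩
  simp only [OracleCircuit.toMatrix, CircuitElement.toMatrix, one_mul, G]
  exact onWires_fiberwise e 1 _

/-- Flip the bit `t` when `P` holds. -/
noncomputable def toggle (P : (Q → Fin 2) → Prop) (t : Q) (x : Q → Fin 2) : Q → Fin 2 :=
  open Classical in if P x then Function.update x t (x t + 1) else x

/-- The operator permuting the computational basis by `f`. -/
def permMat (f : (Q → Fin 2) → (Q → Fin 2)) : QMatrix Q := fun x y => if x = f y then 1 else 0

theorem permMat_mul (f g : (Q → Fin 2) → (Q → Fin 2)) :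
    permMat f * permMat g = permMat (f ∘ g) := by
  ext x y
  simp [permMat, Matrix.mul_apply]

/-- `g` when `P` holds, and the identity otherwise. -/
noncomputable def gated (P : (Q → Fin 2) → Prop) (g : Matrix (Fin 2) (Fin 2) ℂ) (x : Q → Fin 2) :
    Matrix (Fin 2) (Fin 2) ℂ :=
  open Classical in if P x then g else 1

theorem IndependentOf.gated {P : (Q → Fin 2) → Prop} {t : Q} (hP : IndependentOf t P)
    (g : Matrix (Fin 2) (Fin 2) ℂ) : IndependentOf t (gated P g) := fun x b => by
  unfold _root_.gated
  rw [hP x b]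

/-- The Pauli matrix exchanging the two basis states. -/
def pauliX : Matrix (Fin 2) (Fin 2) ℂ := !![0, 1; 1, 0]

theorem pauliX_mul_self : pauliX * pauliX = 1 := by
  ext i j; fin_cases i <;> fin_cases j <;> simp [pauliX]

theorem pauliX_mem_unitary : pauliX ∈ Matrix.unitaryGroup (Fin 2) ℂ := by
  rw [Matrix.mem_unitaryGroup_iff]
  have : star pauliX = pauliX := by
    ext i j; fin_cases i <;> fin_cases j <;> simp [pauliX, Matrix.star_apply]
  rw [this, pauliX_mul_self]

theorem pauliX_apply (a b : Fin 2) : pauliX a b = if a = b + 1 then 1 else 0 := by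
  fin_cases a <;> fin_cases b <;> simp [pauliX]

theorem toggle_apply_of_ne {P : (Q → Fin 2) → Prop} {t q : Q} (h : q ≠ t) (x : Q → Fin 2) :
    toggle P t x q = x q := by
  unfold toggle
  split_ifs
  · exact Function.update_of_ne h _ _
  · rfl

theorem fiberwise_gated_pauliX {P : (Q → Fin 2) → Prop} {t : Q} (hP : IndependentOf t P) :
    fiberwise t (gated P pauliX) = permMat (toggle P t) := by
  ext x y
  simp only [fiberwise, permMat]
  by_cases h : ∀ q, q ≠ t → x q = y q
  · rw [if_pos h]
    have h2 : gated P pauliX x = gated P pauliX y := (hP.gated pauliX).eq_of_agree h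
    have h3 : x = toggle P t y ↔ x t = toggle P t y t := by
      refine ⟨fun h4 => congrFun h4 t, fun h4 => funext fun q => ?_⟩
      by_cases hq : q = t
      · subst hq; exact h4
      · rw [toggle_apply_of_ne hq, h q hq]
    simp only [h3, h2]
    unfold gated toggle
    split_ifs with h5 h6 h6
    · rw [pauliX_apply]; simp at h6; simp [h6]
    · rw [pauliX_apply]; simp at h6; simp [h6]
    · rw [h6, Matrix.one_apply_eq]
    · rw [Matrix.one_apply_ne h6]
  · rw [if_neg h, if_neg]
    rintro rfl
    exact h fun q hq => toggle_apply_of_ne hq y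

theorem update_toggle_comm {P : (Q → Fin 2) → Prop} {t s : Q} (hst : s ≠ t)
    (hP : IndependentOf s P) (x : Q → Fin 2) (b : Fin 2) :
    toggle P t (Function.update x s b) = Function.update (toggle P t x) s b := by
  unfold toggle
  rw [hP x b]
  split_ifs
  · rw [Function.update_of_ne hst.symm, Function.update_comm hst.symm]
  · rfl

theorem toggle_toggle {P : (Q → Fin 2) → Prop} {t : Q} (hP : IndependentOf t P) (x : Q → Fin 2) :
    toggle P t (toggle P t x) = x := by
  have h2 : ∀ b : Fin 2, b + 1 + 1 = b := by decide
  by_cases h : P x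
  · have h1 : toggle P t x = Function.update x t (x t + 1) := if_pos h
    rw [h1]
    unfold toggle
    rw [if_pos (by rw [hP]; exact h)]
    simp [h2]
  · have h1 : toggle P t x = x := if_neg h
    rw [h1, h1]

/-- Conjugation by an involutive basis permutation that fixes the wire `t`. -/
theorem permMat_conj_fiberwise {f : (Q → Fin 2) → (Q → Fin 2)} (hf : ∀ x, f (f x) = x) {t : Q}
    (hft : ∀ x b, f (Function.update x t b) = Function.update (f x) t b)
    (ht : ∀ x, f x t = x t) {G : (Q → Fin 2) → Matrix (Fin 2) (Fin 2) ℂ} :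
    permMat f * fiberwise t G * permMat f = fiberwise t (fun x => G (f x)) := by
  have hagree : ∀ x y : Q → Fin 2, (∀ q, q ≠ t → x q = y q) → ∀ q, q ≠ t → f x q = f y q := by
    intro x y h
    have : x = Function.update y t (x t) := by
      funext q
      by_cases hq : q = t
      · subst hq; simp
      · rw [Function.update_of_ne hq, h q hq]
    intro q hq
    rw [this, hft, Function.update_of_ne hq]
  ext x y
  have h1 : ∀ z, (x = f z) ↔ (f x = z) := fun z =>
    ⟨fun h => by rw [h, hf], fun h => by rw [← h, hf]⟩
  rw [Matrix.mul_apply]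
  simp only [permMat, Matrix.mul_apply, h1, ite_mul, one_mul, zero_mul, mul_ite, mul_one, mul_zero,
    Finset.sum_ite_eq, Finset.sum_ite_eq', Finset.mem_univ, if_true]
  simp only [fiberwise, ht]
  refine if_congr ⟨fun h q hq => ?_, fun h q hq => ?_⟩ rfl rfl
  · have := hagree _ _ h q hq
    rwa [hf, hf] at this
  · exact hagree _ _ h q hq

/-- A square root of `pauliX`. -/
noncomputable def sqrtX : Matrix (Fin 2) (Fin 2) ℂ :=
  !![(1 + Complex.I) / 2, (1 - Complex.I) / 2; (1 - Complex.I) / 2, (1 + Complex.I) / 2]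

theorem sqrtX_mul_self : sqrtX * sqrtX = pauliX := by
  have := Complex.I_sq
  ext i j
  fin_cases i <;> fin_cases j <;> simp [sqrtX, pauliX] <;> ring_nf <;> simp [this] <;> norm_num

theorem sqrtX_mem_unitary : sqrtX ∈ Matrix.unitaryGroup (Fin 2) ℂ := by
  have := Complex.I_sq
  rw [Matrix.mem_unitaryGroup_iff]
  ext i j
  fin_cases i <;> fin_cases j <;>
    simp [sqrtX, Matrix.mul_apply, Fin.sum_univ_two, Matrix.star_apply, map_ofNat] <;> ring_nf <;>
    simp [this] <;> norm_num

theorem realizable_cnot {p t : Q} (hpt : p ≠ t) (b : Fin 2) :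
    Realizable R (fun _ => permMat (toggle (fun x => x p = b) t)) 0 1 := by
  have hP : IndependentOf t (fun x : Q → Fin 2 => x p = b) :=
    (independentOf_apply hpt).comp (· = b)
  have h := realizable_twoQubit (R := R) hpt (g := fun a => if a = b then pauliX else 1) (fun a => by
    split_ifs
    exacts [pauliX_mem_unitary, one_mem _])
  rw [← fiberwise_gated_pauliX hP]
  convert h using 3
  unfold gated
  funext x
  congr

/-- With `V` a square root of `pauliX`, the five gates apply to `t` the power of `V` with exponent
`[q = 1] + [p = 0] - ([q = 1] xor [p = 0])`, which is twice the product of the two conditions. The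
flips of `q` by `p` around the inverse root create the exclusive or and then undo it. -/
theorem realizable_toffoli {p q t : Q} (hpt : p ≠ t) (hqt : q ≠ t) (hpq : p ≠ q) :
    Realizable R (fun _ => permMat (toggle (fun x => x p = 0 ∧ x q = 1) t)) 0 5 := by
  have hP : IndependentOf t (fun x : Q → Fin 2 => x p = 0 ∧ x q = 1) := fun x b => by
    dsimp only
    rw [Function.update_of_ne hpt, Function.update_of_ne hqt]
  have hc := realizable_cnot (R := R) hpq 0
  have hV : ∀ b : Fin 2, (if b = 1 then sqrtX else 1) ∈ Matrix.unitaryGroup (Fin 2) ℂ := fun b => by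
    split_ifs
    exacts [sqrtX_mem_unitary, one_mem _]
  have h1 := realizable_twoQubit (R := R) hqt (g := fun a => if a = 1 then sqrtX else 1) hV
  have h2 := realizable_twoQubit (R := R) hqt (g := fun a => star (if a = 1 then sqrtX else 1))
    fun b => Unitary.star_mem (hV b)
  have h3 := realizable_twoQubit (R := R) hpt (g := fun a => if a = 0 then sqrtX else 1) fun b => by
    split_ifs
    exacts [sqrtX_mem_unitary, one_mem _]
  have h := (h1.mul ((hc.mul h2).mul hc)).mul h3
  rw [← fiberwise_gated_pauliX hP]
  refine (congrArg (fun F => Realizable R F 0 5) (funext fun U => ?_)).mp h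
  have hPq : IndependentOf q (fun x : Q → Fin 2 => x p = 0) :=
    (independentOf_apply hpq).comp (· = 0)
  have hPt : IndependentOf t (fun x : Q → Fin 2 => x p = 0) :=
    (independentOf_apply hpt).comp (· = 0)
  rw [permMat_conj_fiberwise (toggle_toggle hPq) (fun x b => update_toggle_comm hqt.symm hPt x b)
    (fun x => toggle_apply_of_ne hqt.symm x), fiberwise_mul _ (fun x b => by
      rw [update_toggle_comm hqt.symm hPt, Function.update_of_ne hqt]), fiberwise_mul _ (fun x b => by
      rw [Function.update_of_ne hpt])]
  congr 1
  funext x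
  have hu := Matrix.mem_unitaryGroup_iff.1 sqrtX_mem_unitary
  have hu' := Matrix.mem_unitaryGroup_iff'.1 sqrtX_mem_unitary
  have h01 : ∀ b : Fin 2, b = 0 ∨ b = 1 := by decide
  unfold toggle gated
  rcases h01 (x p) with hp | hp <;> rcases h01 (x q) with hq | hq <;>
    simp [hp, hq, hu, hu', sqrtX_mul_self]

end Fiberwise

/-! ### Multiply controlled gates with borrowed wires only. -/

section Ladder

set_option linter.unusedSectionVars false

variable {R Q : Type} [Fintype R] [Fintype Q] [DecidableEq R] [DecidableEq Q]

/-- All the wires of the list `cs` carry the value `0`. -/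
def AllZero (cs : List Q) (x : Q → Fin 2) : Prop := ∀ c ∈ cs, x c = 0

theorem independentOf_allZero {cs : List Q} {t : Q} (h : t ∉ cs) : IndependentOf t (AllZero cs) :=
  fun x b => by
    unfold AllZero
    refine propext (forall₂_congr fun c hc => ?_)
    rw [Function.update_of_ne]
    rintro rfl
    exact h hc

theorem allZero_cons (c : Q) (cs : List Q) (x : Q → Fin 2) :
    AllZero (c :: cs) x ↔ x c = 0 ∧ AllZero cs x := by
  simp [AllZero]

theorem allZero_append (cs ds : List Q) (x : Q → Fin 2) :
    AllZero (cs ++ ds) x ↔ AllZero cs x ∧ AllZero ds x := by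
  simp [AllZero, or_imp, forall_and]

theorem permMat_id : permMat (id : (Q → Fin 2) → (Q → Fin 2)) = 1 := by
  ext x y; simp [permMat, Matrix.one_apply]

/-- For a list of pairs of a control and a target, flip every target when all the controls from
its own one on are zero. -/
noncomputable def ladder : List (Q × Q) → (Q → Fin 2) → (Q → Fin 2)
  | [] => id
  | (c, d) :: L => fun x => toggle (AllZero (c :: L.map Prod.fst)) d (ladder L x)

theorem ladder_cons (c d : Q) (L : List (Q × Q)) (x : Q → Fin 2) :
    ladder ((c, d) :: L) x = toggle (AllZero (c :: L.map Prod.fst)) d (ladder L x) := rfl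

theorem toggle_pos {P : (Q → Fin 2) → Prop} {x : Q → Fin 2} (h : P x) (t : Q) :
    toggle P t x = Function.update x t (x t + 1) := if_pos h

theorem toggle_neg {P : (Q → Fin 2) → Prop} {x : Q → Fin 2} (h : ¬ P x) (t : Q) :
    toggle P t x = x := if_neg h

theorem ladder_apply_of_notMem {L : List (Q × Q)} {q : Q} (h : q ∉ L.map Prod.snd)
    (x : Q → Fin 2) : ladder L x q = x q := by
  induction L with
  | nil => rfl
  | cons p L ih =>
    obtain ⟨c, d⟩ := p
    simp only [List.map_cons, List.mem_cons, not_or] at h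
    rw [ladder_cons, toggle_apply_of_ne h.1, ih h.2]

theorem ladder_update {L : List (Q × Q)} {q : Q} (h1 : q ∉ L.map Prod.fst)
    (h2 : q ∉ L.map Prod.snd) (x : Q → Fin 2) (b : Fin 2) :
    ladder L (Function.update x q b) = Function.update (ladder L x) q b := by
  induction L with
  | nil => rfl
  | cons p L ih =>
    obtain ⟨c, d⟩ := p
    simp only [List.map_cons, List.mem_cons, not_or] at h1 h2
    rw [ladder_cons, ih h1.2 h2.2,
      update_toggle_comm h2.1 (independentOf_allZero (by simpa using h1)), ladder_cons]

theorem allZero_ladder {L : List (Q × Q)} {cs : List Q} (h : ∀ c ∈ cs, c ∉ L.map Prod.snd)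
    (x : Q → Fin 2) : AllZero cs (ladder L x) ↔ AllZero cs x :=
  forall₂_congr fun c hc => by rw [ladder_apply_of_notMem (h c hc)]

/-- The controls and targets of a ladder are distinct. -/
def LadderNodup (L : List (Q × Q)) : Prop := (L.map Prod.fst ++ L.map Prod.snd).Nodup

theorem ladderNodup_cons {c d : Q} {L : List (Q × Q)} (h : LadderNodup ((c, d) :: L)) :
    LadderNodup L ∧ c ≠ d ∧ c ∉ L.map Prod.fst ∧ c ∉ L.map Prod.snd ∧ d ∉ L.map Prod.fst ∧
      d ∉ L.map Prod.snd := by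
  unfold LadderNodup at h ⊢
  simp only [List.map_cons, List.cons_append] at h
  rw [List.nodup_cons, List.nodup_middle, List.nodup_cons, List.mem_append, List.mem_append,
    List.mem_cons] at h
  tauto

theorem fst_notMem_snd {L : List (Q × Q)} (h : LadderNodup L) :
    ∀ c ∈ L.map Prod.fst, c ∉ L.map Prod.snd :=
  fun _ hc hc' => (List.disjoint_of_nodup_append h) hc hc'

theorem toggle_ladder_comm {L : List (Q × Q)} {cs : List Q} {d : Q}
    (hcs : ∀ c ∈ cs, c ∉ L.map Prod.snd) (h1 : d ∉ L.map Prod.fst) (h2 : d ∉ L.map Prod.snd)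
    (x : Q → Fin 2) :
    ladder L (toggle (AllZero cs) d x) = toggle (AllZero cs) d (ladder L x) := by
  by_cases h : AllZero cs x
  · rw [toggle_pos h, toggle_pos ((allZero_ladder hcs x).2 h), ladder_update h1 h2,
      ladder_apply_of_notMem h2]
  · rw [toggle_neg h, toggle_neg fun h' => h ((allZero_ladder hcs x).1 h')]

theorem ladder_ladder {L : List (Q × Q)} (hL : LadderNodup L) (x : Q → Fin 2) :
    ladder L (ladder L x) = x := by
  induction L generalizing x with
  | nil => rfl
  | cons p L ih =>
    obtain ⟨c, d⟩ := p
    obtain ⟨hL', hcd, hc1, hc2, hd1, hd2⟩ := ladderNodup_cons hL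
    have hcs : ∀ c' ∈ c :: L.map Prod.fst, c' ∉ L.map Prod.snd := by
      intro c' hc'
      rcases List.mem_cons.1 hc' with rfl | h
      · exact hc2
      · exact fst_notMem_snd hL' _ h
    simp only [ladder]
    rw [toggle_ladder_comm hcs hd1 hd2, ih hL', toggle_toggle]
    refine independentOf_allZero ?_
    simp only [List.mem_cons, not_or]
    exact ⟨hcd.symm, hd1⟩

/-- The shorter ladder is an involution, so it cancels the inner part of the longer one. Only the
outermost flip survives and every borrowed target recovers its value, whatever it was. -/
theorem ladder_comp_tail {c d : Q} {L : List (Q × Q)} (hL : LadderNodup L) :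
    ladder ((c, d) :: L) ∘ ladder L = toggle (AllZero (c :: L.map Prod.fst)) d := by
  funext x
  simp only [Function.comp, ladder]
  rw [ladder_ladder hL]

/-- The inner ladder flips `d'` exactly when all controls from `c'` on vanish. The two Toffoli flips
of `d` see `d'` before and after, so for `x c = 0` their sum modulo two records whether `d'` was
flipped. Thus one more rung costs two Toffoli gates. -/
theorem ladder_cons_cons {c d c' d' : Q} {L : List (Q × Q)}
    (hL : LadderNodup ((c, d) :: (c', d') :: L)) :
    ladder ((c, d) :: (c', d') :: L)
      = toggle (fun x => x c = 0 ∧ x d' = 1) d ∘ ladder ((c', d') :: L) ∘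
        toggle (fun x => x c = 0 ∧ x d' = 1) d := by
  obtain ⟨hL', hcd, hc1, hc2, hd1, hd2⟩ := ladderNodup_cons hL
  obtain ⟨hL'', -, -, hc2', hd1', hd2'⟩ := ladderNodup_cons hL'
  have hdd : d' ≠ d := by rintro rfl; simp at hd2
  have hP : IndependentOf d (fun x : Q → Fin 2 => x c = 0 ∧ x d' = 1) := fun x b => by
    dsimp only
    rw [Function.update_of_ne hcd, Function.update_of_ne hdd]
  funext x
  set y := ladder ((c', d') :: L) x with hy
  have hyc : y c = x c := ladder_apply_of_notMem hc2 x
  have hyd : y d = x d := ladder_apply_of_notMem hd2 x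
  have hA : AllZero (c' :: L.map Prod.fst) y ↔ AllZero (c' :: L.map Prod.fst) x :=
    allZero_ladder (fst_notMem_snd hL') x
  have hz1 : AllZero (c' :: L.map Prod.fst) (ladder L x) ↔ AllZero (c' :: L.map Prod.fst) x := by
    refine allZero_ladder (fun q hq => ?_) x
    rcases List.mem_cons.1 hq with rfl | h
    · exact hc2'
    · exact fst_notMem_snd hL'' _ h
  have hyd₁ : AllZero (c' :: L.map Prod.fst) y → y d' = x d' + 1 := fun h => by
    rw [hy, ladder_cons, toggle_pos (hz1.2 (hA.1 h)), Function.update_self,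
      ladder_apply_of_notMem hd2']
  have hyd₀ : ¬ AllZero (c' :: L.map Prod.fst) y → y d' = x d' := fun h => by
    rw [hy, ladder_cons, toggle_neg fun h' => h (hA.2 (hz1.1 h')), ladder_apply_of_notMem hd2']
  have hlhs : ladder ((c, d) :: (c', d') :: L) x
      = toggle (AllZero (c :: c' :: L.map Prod.fst)) d y := rfl
  rw [hlhs]
  simp only [Function.comp]
  have h01 : ∀ b : Fin 2, b = 0 ∨ b = 1 := by decide
  have h11 : (1 : Fin 2) + 1 = 0 := by decide
  have hbb : ∀ b : Fin 2, b + 1 + 1 = b := by decide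
  by_cases hx : x c = 0 ∧ x d' = 1
  · rw [toggle_pos (P := fun x : Q → Fin 2 => x c = 0 ∧ x d' = 1) hx, ladder_update hd1 hd2, ← hy]
    by_cases hz : AllZero (c' :: L.map Prod.fst) y
    · rw [toggle_pos ((allZero_cons _ _ _).2 ⟨hyc.trans hx.1, hz⟩), toggle_neg, hyd]
      rw [Function.update_of_ne hdd, hyd₁ hz, hx.2, h11]
      simp
    · rw [toggle_neg fun h => hz ((allZero_cons _ _ _).1 h).2, toggle_pos, Function.update_self,
        Function.update_idem, hbb, ← hyd, Function.update_eq_self]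
      rw [Function.update_of_ne hcd, Function.update_of_ne hdd, hyd₀ hz, hyc]
      exact hx
  · rw [toggle_neg (P := fun x : Q → Fin 2 => x c = 0 ∧ x d' = 1) hx, ← hy]
    by_cases hz : AllZero (c' :: L.map Prod.fst) y
    · by_cases hc : x c = 0
      · rw [toggle_pos ((allZero_cons _ _ _).2 ⟨hyc.trans hc, hz⟩), toggle_pos]
        refine ⟨hyc.trans hc, ?_⟩
        rw [hyd₁ hz, (h01 (x d')).resolve_right fun h => hx ⟨hc, h⟩]
        rfl
      · rw [toggle_neg fun h => hc (hyc.symm.trans ((allZero_cons _ _ _).1 h).1),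
          toggle_neg fun h => hc (hyc.symm.trans h.1)]
    · rw [toggle_neg fun h => hz ((allZero_cons _ _ _).1 h).2, toggle_neg]
      rw [hyc, hyd₀ hz]
      exact hx

theorem realizable_ladder {L : List (Q × Q)} (hL : LadderNodup L) :
    Realizable R (fun _ => permMat (ladder L)) 0 (10 * L.length) := by
  induction L with
  | nil => rw [ladder, permMat_id]; exact Realizable.one
  | cons p L ih =>
    obtain ⟨c, d⟩ := p
    obtain ⟨hL', hcd, hc1, hc2, hd1, hd2⟩ := ladderNodup_cons hL
    cases L with
    | nil =>
      have : ladder [(c, d)] = toggle (fun x => x c = 0) d := by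
        funext x
        simp only [ladder, List.map_nil, id]
        congr 1
        funext y
        simp [AllZero]
      rw [this]
      exact (realizable_cnot hcd 0).mono le_rfl (by simp)
    | cons p' L =>
      obtain ⟨c', d'⟩ := p'
      have hdd : d' ≠ d := by rintro rfl; simp at hd2
      have hcd' : c ≠ d' := by rintro rfl; simp at hc2
      rw [ladder_cons_cons hL]
      simp only [← permMat_mul]
      have hT := realizable_toffoli (R := R) hcd hdd hcd'
      refine (hT.mul ((ih hL').mul hT)).mono (by simp) ?_
      simp only [List.length_cons]
      omega

/-- The multiply controlled flip of `t`, with borrowed wires `ds`. -/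
theorem realizable_toggle_allZero {cs ds : List Q} {t : Q} (hnd : (t :: (cs ++ ds)).Nodup)
    (hlen : cs.length ≤ ds.length + 1) :
    Realizable R (fun _ => fiberwise t (gated (AllZero cs) pauliX)) 0 (20 * cs.length + 1) := by
  cases cs with
  | nil =>
    have : (gated (AllZero []) pauliX : (Q → Fin 2) → _) = fun _ => pauliX := by
      funext x; simp [gated, AllZero]
    rw [this]
    exact (realizable_oneQubit t pauliX_mem_unitary).mono le_rfl (by simp)
  | cons c cs =>
    have hlen' : cs.length ≤ ds.length := by simpa using hlen
    have ht : t ∉ c :: cs := fun h => (List.nodup_cons.1 hnd).1 (List.mem_append_left _ h)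
    have hfst : (cs.zip ds).map Prod.fst = cs := List.map_fst_zip hlen'
    have hsnd : ((cs.zip ds).map Prod.snd).Sublist ds := by
      have h : cs.zip ds = cs.zip (ds.take cs.length) := by
        rw [List.zip_eq_zip_take_min, min_eq_left hlen', List.take_length]
      rw [h, List.map_snd_zip (by simp)]
      exact List.take_sublist _ _
    -- The first control is paired with the true target and each later control with one borrowed
    -- wire; this is why one borrowed wire fewer than controls is enough.
    have hL : LadderNodup ((c, t) :: cs.zip ds) := by
      unfold LadderNodup
      simp only [List.map_cons, hfst]
      rw [List.nodup_middle]
      exact hnd.sublist (List.Sublist.cons_cons t (List.Sublist.append_left hsnd (c :: cs)))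
    have hL' := (ladderNodup_cons hL).1
    rw [fiberwise_gated_pauliX (independentOf_allZero ht)]
    have h := ladder_comp_tail (c := c) (d := t) hL'
    rw [hfst] at h
    rw [← h, ← permMat_mul]
    refine ((realizable_ladder hL).mul (realizable_ladder hL')).mono (by simp) ?_
    simp only [List.length_cons, List.length_zip, min_eq_left hlen']
    omega

/-- The diagonal matrix `diag(β, conj β)`. -/
noncomputable def phaseGate (β : ℂ) : Matrix (Fin 2) (Fin 2) ℂ := !![β, 0; 0, star β]

theorem phaseGate_mul (β γ : ℂ) : phaseGate β * phaseGate γ = phaseGate (β * γ) := by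
  ext i j; fin_cases i <;> fin_cases j <;> simp [phaseGate, mul_comm]

theorem phaseGate_star (β : ℂ) : star (phaseGate β) = phaseGate (star β) := by
  ext i j; fin_cases i <;> fin_cases j <;> simp [phaseGate, Matrix.star_apply]

theorem phaseGate_one : phaseGate 1 = 1 := by
  ext i j; fin_cases i <;> fin_cases j <;> simp [phaseGate]

theorem pauliX_mul_phaseGate_mul (β : ℂ) : pauliX * phaseGate β * pauliX = phaseGate (star β) := by
  ext i j; fin_cases i <;> fin_cases j <;> simp [phaseGate, pauliX]

theorem phaseGate_mem_unitary {β : ℂ} (hβ : ‖β‖ = 1) :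
    phaseGate β ∈ Matrix.unitaryGroup (Fin 2) ℂ := by
  rw [Matrix.mem_unitaryGroup_iff, phaseGate_star, phaseGate_mul, mul_star_eq_normSq, hβ]
  simpa using phaseGate_one

/-- Conjugation by `pauliX` inverts the phase gate. So the commutator squares it when the flip is
active and cancels it otherwise, and a controlled phase needs only uncontrolled phases and
controlled flips. -/
theorem gated_conj_phase {P : (Q → Fin 2) → Prop} (β : ℂ) (hβ : ‖β‖ = 1) (x : Q → Fin 2) :
    gated P pauliX x * phaseGate (star β) * gated P pauliX x * phaseGate β
      = gated P (phaseGate (β ^ 2)) x := by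
  unfold gated
  split_ifs
  · rw [pauliX_mul_phaseGate_mul, star_star, phaseGate_mul, sq]
  · rw [one_mul, mul_one, phaseGate_mul, mul_comm, mul_star_eq_normSq, hβ]
    simpa using phaseGate_one

theorem realizable_gated_phase {cs ds : List Q} {t : Q} (hnd : (t :: (cs ++ ds)).Nodup)
    (hlen : cs.length ≤ ds.length + 1) {β : ℂ} (hβ : ‖β‖ = 1) :
    Realizable R (fun _ => fiberwise t (gated (AllZero cs) (phaseGate (β ^ 2)))) 0
      (40 * cs.length + 4) := by
  have ht : t ∉ cs := fun h => (List.nodup_cons.1 hnd).1 (List.mem_append_left _ h)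
  have hX := realizable_toggle_allZero (R := R) hnd hlen
  have h1 := realizable_oneQubit (R := R) t (phaseGate_mem_unitary hβ)
  have h2 := realizable_oneQubit (R := R) t (phaseGate_mem_unitary ((norm_star β).trans hβ))
  have h := (((hX.mul h2).mul hX).mul h1).mono (q' := 0) (k' := 40 * cs.length + 4) (by simp)
    (by omega)
  have hi := (independentOf_allZero ht).gated pauliX
  simp only [fiberwise_mul _ (independentOf_const t _), fiberwise_mul _ hi] at h
  simpa only [gated_conj_phase β hβ] using h

/-- The same commutator trick once more, with flips controlled by `cs` and phases controlled by
`ds`: it is nontrivial only when both groups vanish. Each group borrows the wires of the other,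
which requires the lengths to differ by at most one. The two squarings account for the exponent `4`.
-/
theorem realizable_multiGated_phase {cs ds : List Q} {t : Q} (hnd : (t :: (cs ++ ds)).Nodup)
    (h1 : cs.length ≤ ds.length + 1) (h2 : ds.length ≤ cs.length + 1) {β : ℂ} (hβ : ‖β‖ = 1) :
    Realizable R (fun _ => fiberwise t (gated (AllZero (cs ++ ds)) (phaseGate (β ^ 4)))) 0
      (80 * (cs.length + ds.length) + 10) := by
  have hnd' : (t :: (ds ++ cs)).Nodup :=
    (List.Perm.cons t List.perm_append_comm).nodup_iff.1 hnd
  have hcs : t ∉ cs := fun h => (List.nodup_cons.1 hnd).1 (List.mem_append_left _ h)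
  have hds : t ∉ ds := fun h => (List.nodup_cons.1 hnd).1 (List.mem_append_right _ h)
  have hβ' : ‖star β‖ = 1 := (norm_star β).trans hβ
  have hX := realizable_toggle_allZero (R := R) hnd h1
  have hp := realizable_gated_phase (R := R) hnd' h2 hβ
  have hp' := realizable_gated_phase (R := R) hnd' h2 hβ'
  have h := (((hX.mul hp').mul hX).mul hp).mono (q' := 0)
    (k' := 80 * (cs.length + ds.length) + 10) (by simp) (by omega)
  have hi := (independentOf_allZero hcs).gated pauliX
  have hi2 := (independentOf_allZero hds).gated (phaseGate (β ^ 2))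
  have hi2' := (independentOf_allZero hds).gated (phaseGate (star β ^ 2))
  simp only [fiberwise_mul _ hi, fiberwise_mul _ hi2, fiberwise_mul _ hi2'] at h
  refine (congrArg (fun G => Realizable R (fun _ => fiberwise t G) 0 _) (funext fun x => ?_)).mp h
  by_cases hd : AllZero ds x
  · have e1 : gated (AllZero ds) (phaseGate (star β ^ 2)) x = phaseGate (star (β ^ 2)) := by
      unfold gated; rw [if_pos hd, star_pow]
    have e2 : gated (AllZero ds) (phaseGate (β ^ 2)) x = phaseGate (β ^ 2) := if_pos hd
    rw [e1, e2, gated_conj_phase _ (by rw [norm_pow, hβ, one_pow])]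
    have e3 : AllZero (cs ++ ds) x ↔ AllZero cs x := by simp [allZero_append, hd]
    unfold gated
    rw [propext e3, ← pow_mul]
  · have e1 : gated (AllZero ds) (phaseGate (star β ^ 2)) x = 1 := if_neg hd
    have e2 : gated (AllZero ds) (phaseGate (β ^ 2)) x = 1 := if_neg hd
    rw [e1, e2, mul_one, mul_one]
    have e3 : gated (AllZero (cs ++ ds)) (phaseGate (β ^ 4)) x = 1 :=
      if_neg fun h => hd ((allZero_append _ _ _).1 h).2
    rw [e3]
    unfold gated
    split_ifs
    · exact pauliX_mul_self
    · exact one_mul 1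

/-- A normalized eigenvector completes to a matrix in `SU(2)` which makes `u` upper triangular;
unitarity kills the remaining off-diagonal entry and determinant one makes the second eigenvalue the
conjugate of the first. The fourth root is what two nested commutators consume. -/
theorem exists_diagonalization {u : Matrix (Fin 2) (Fin 2) ℂ}
    (hu : u ∈ Matrix.specialUnitaryGroup (Fin 2) ℂ) :
    ∃ (s : Matrix (Fin 2) (Fin 2) ℂ) (β : ℂ), s ∈ Matrix.unitaryGroup (Fin 2) ℂ ∧ ‖β‖ = 1 ∧
      u = s * phaseGate (β ^ 4) * star s := by
  obtain ⟨lam, hlam⟩ := Module.End.exists_eigenvalue (Matrix.toLin' u)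
  obtain ⟨v, hv⟩ := hlam.exists_hasEigenvector
  have hv1 : u.mulVec v = lam • v := by
    have := hv.apply_eq_smul
    rwa [Matrix.toLin'_apply] at this
  have hs0 : 0 < ‖v 0‖ ^ 2 + ‖v 1‖ ^ 2 := by
    by_contra h
    have h0 : v 0 = 0 := by
      by_contra h0
      have := norm_pos_iff.2 h0
      exact h (by positivity)
    have h1 : v 1 = 0 := by
      by_contra h1
      have := norm_pos_iff.2 h1
      exact h (by positivity)
    apply hv.2
    funext i
    fin_cases i
    · exact h0
    · exact h1
  set r : ℝ := (Real.sqrt (‖v 0‖ ^ 2 + ‖v 1‖ ^ 2))⁻¹ with hr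
  set a : ℂ := r * v 0 with ha
  set b : ℂ := r * v 1 with hb
  have hab : ‖a‖ ^ 2 + ‖b‖ ^ 2 = 1 := by
    rw [ha, hb, norm_mul, norm_mul, mul_pow, mul_pow, ← mul_add]
    simp only [Complex.norm_real, Real.norm_eq_abs, sq_abs, hr, inv_pow]
    rw [Real.sq_sqrt hs0.le, inv_mul_cancel₀ hs0.ne']
  have hsu := su2_mem hab
  have hsU := (Matrix.mem_specialUnitaryGroup_iff.1 hsu).1
  have hss' := Matrix.mem_unitaryGroup_iff'.1 hsU
  have hss := Matrix.mem_unitaryGroup_iff.1 hsU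
  set s := su2 a b with hs
  set w := star s * u * s with hw
  have hwu : w ∈ Matrix.specialUnitaryGroup (Fin 2) ℂ := by
    refine mul_mem (mul_mem ?_ hu) hsu
    rw [Matrix.mem_specialUnitaryGroup_iff]
    refine ⟨Unitary.star_mem hsU, ?_⟩
    rw [Matrix.star_eq_conjTranspose, Matrix.det_conjTranspose,
      (Matrix.mem_specialUnitaryGroup_iff.1 hsu).2, star_one]
  have hv0 := congrFun hv1 0
  have hv1' := congrFun hv1 1
  simp only [Matrix.mulVec, dotProduct, Fin.sum_univ_two, Pi.smul_apply, smul_eq_mul] at hv0 hv1'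
  have hus : ∀ i, (u * s) i 0 = lam * s i 0 := by
    intro i
    rw [Matrix.mul_apply, Fin.sum_univ_two]
    fin_cases i
    · simp [hs, su2, ha, hb]; linear_combination (r : ℂ) * hv0
    · simp [hs, su2, ha, hb]; linear_combination (r : ℂ) * hv1'
  have hwcol : ∀ i, w i 0 = lam * (1 : Matrix (Fin 2) (Fin 2) ℂ) i 0 := by
    intro i
    rw [hw, mul_assoc, Matrix.mul_apply, ← hss', Matrix.mul_apply, Finset.mul_sum]
    exact Finset.sum_congr rfl fun j _ => by rw [hus]; ring
  have w00 : w 0 0 = lam := by rw [hwcol]; simp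
  have w10 : w 1 0 = 0 := by rw [hwcol]; simp
  have hwU := Matrix.mem_unitaryGroup_iff'.1 (Matrix.mem_specialUnitaryGroup_iff.1 hwu).1
  have hwdet := (Matrix.mem_specialUnitaryGroup_iff.1 hwu).2
  have e00 := congrFun (congrFun hwU 0) 0
  have e01 := congrFun (congrFun hwU 0) 1
  simp only [Matrix.mul_apply, Fin.sum_univ_two, Matrix.star_apply, w00, w10, star_zero, zero_mul,
    add_zero, Matrix.one_apply_eq] at e00 e01
  rw [Matrix.one_apply_ne (by decide)] at e01
  rw [Matrix.det_fin_two, w00, w10, mul_zero, sub_zero] at hwdet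
  have hlam1 : ‖lam‖ = 1 := by
    rw [mul_comm, mul_star_eq_normSq] at e00
    have h : ‖lam‖ ^ 2 = 1 := by exact_mod_cast e00
    exact (pow_eq_one_iff_of_nonneg (norm_nonneg _) two_ne_zero).1 h
  have hlam0 : star lam ≠ 0 := star_ne_zero.2 (ne_zero_of_norm_one hlam1)
  have w01 : w 0 1 = 0 := (mul_eq_zero.1 e01).resolve_left hlam0
  have w11 : w 1 1 = star lam := by
    calc w 1 1 = star lam * lam * w 1 1 := by rw [e00, one_mul]
      _ = _ := by rw [mul_assoc, hwdet, mul_one]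
  have hwd : w = phaseGate lam := by
    ext i j; fin_cases i <;> fin_cases j <;> simp [phaseGate, w00, w10, w01, w11]
  obtain ⟨β, hβ⟩ := IsAlgClosed.exists_pow_nat_eq lam (show 0 < 4 by norm_num)
  refine ⟨s, β, hsU, ?_, ?_⟩
  · have h : ‖β‖ ^ 4 = 1 := by rw [← norm_pow, hβ, hlam1]
    exact (pow_eq_one_iff_of_nonneg (norm_nonneg _) (by norm_num)).1 h
  · rw [hβ, ← hwd, hw]
    calc u = (s * star s) * u * (s * star s) := by rw [hss, one_mul, mul_one]
      _ = _ := by simp only [mul_assoc]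

/-- A one-qubit gate of determinant one on `t`, controlled by all the wires of `ws`, can be
implemented without ancillas by linearly many gates. -/
theorem realizable_multiGated {ws : List Q} {t : Q} (hnd : (t :: ws).Nodup)
    {u : Matrix (Fin 2) (Fin 2) ℂ} (hu : u ∈ Matrix.specialUnitaryGroup (Fin 2) ℂ) :
    Realizable R (fun _ => fiberwise t (gated (AllZero ws) u)) 0 (80 * ws.length + 12) := by
  obtain ⟨s, β, hs, hβ, rfl⟩ := exists_diagonalization hu
  have ht : t ∉ ws := (List.nodup_cons.1 hnd).1
  -- Halving the controls yields two groups that can serve as borrowed wires for each other.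
  have hws : ws.take (ws.length / 2) ++ ws.drop (ws.length / 2) = ws := List.take_append_drop _ _
  have h := realizable_multiGated_phase (R := R) (cs := ws.take (ws.length / 2))
    (ds := ws.drop (ws.length / 2)) (t := t) (by rw [hws]; exact hnd)
    (by simp only [List.length_take, List.length_drop]; omega)
    (by simp only [List.length_take, List.length_drop]; omega) hβ
  rw [hws] at h
  have h' := (((realizable_oneQubit (R := R) t hs).mul h).mul
    (realizable_oneQubit t (Unitary.star_mem hs))).mono (q' := 0) (k' := 80 * ws.length + 12)
    (by simp) (by simp only [List.length_take, List.length_drop]; omega)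
  simp only [fiberwise_mul _ ((independentOf_allZero ht).gated _),
    fiberwise_mul _ (independentOf_const t _)] at h'
  refine (congrArg (fun G => Realizable R (fun _ => fiberwise t G) 0 _) (funext fun x => ?_)).mp h'
  unfold gated
  split_ifs
  · rfl
  · rw [mul_one]; exact Matrix.mem_unitaryGroup_iff.1 hs

end Ladder

/-! ### Signal processing with alternating uses of the signal and its inverse. -/

section SignalAlgebra

set_option linter.unusedSectionVars false

variable {A : Type*} [Ring A] [Algebra ℂ A]

/-- A `2 × 2` matrix of scalars, viewed as a matrix over an algebra. -/
noncomputable def liftMatrix (A : Type*) [Ring A] [Algebra ℂ A] (g : Matrix (Fin 2) (Fin 2) ℂ) :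
    Matrix (Fin 2) (Fin 2) A := g.map (algebraMap ℂ A)

/-- The operators of a signal processing circuit with reflection `r` and signal `v`, `w = v⁻¹`. -/
noncomputable def signalOperator (r v w : A) (g : ℕ → Matrix (Fin 2) (Fin 2) ℂ) :
    ℕ → Matrix (Fin 2) (Fin 2) A
  | 0 => Matrix.diagonal ![1, r] * liftMatrix A (g 0) * Matrix.diagonal ![r, 1]
  | i + 1 =>
      (Matrix.diagonal ![1, r] * liftMatrix A (g (2 * i + 2)) * Matrix.diagonal ![r, 1]) *
        (Matrix.diagonal (fun _ => w) *
        ((Matrix.diagonal ![1, r] * liftMatrix A (g (2 * i + 1)) * Matrix.diagonal ![r, 1]) *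
        (Matrix.diagonal (fun _ => v) * signalOperator r v w g i)))

theorem diagonal_const_comm {w : A} {M : Matrix (Fin 2) (Fin 2) A}
    (h : ∀ i j, Commute w (M i j)) :
    Matrix.diagonal (fun _ => w) * M = M * Matrix.diagonal (fun _ => w) := by
  ext i j
  rw [Matrix.diagonal_mul, Matrix.mul_diagonal, (h i j).eq]

/-- With `ω = r w r v`, the factors around `g` are `diag(r w, w r)` and `diag(r v, v r)`.
Multiplying entries gives `ω`, `1`, `1`, `ω⁻¹`, which is `ω⁻¹` times the pattern of `diag(ω, 1) g
diag(ω, 1)`; the scalar entries of `g` commute with everything. -/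
theorem signal_middle {r v w : A} (hr : r * r = 1) (hvw : v * w = 1) (hwv : w * v = 1)
    (g : Matrix (Fin 2) (Fin 2) ℂ) :
    Matrix.diagonal ![r, 1] * Matrix.diagonal (fun _ => w) * Matrix.diagonal ![1, r] *
      liftMatrix A g * (Matrix.diagonal ![r, 1] * Matrix.diagonal (fun _ => v) *
        Matrix.diagonal ![1, r])
      = Matrix.diagonal (fun _ => w * r * v * r) * (Matrix.diagonal ![r * w * r * v, 1] *
        (liftMatrix A g * Matrix.diagonal ![r * w * r * v, 1])) := by
  have hrr : ∀ a : A, r * (r * a) = a := fun a => by rw [← mul_assoc, hr, one_mul]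
  have hvw' : ∀ a : A, v * (w * a) = a := fun a => by rw [← mul_assoc, hvw, one_mul]
  have hwv' : ∀ a : A, w * (v * a) = a := fun a => by rw [← mul_assoc, hwv, one_mul]
  have hc : ∀ (z : ℂ) (x : A), x * algebraMap ℂ A z = algebraMap ℂ A z * x := fun z x =>
    (Algebra.commutes z x).symm
  have hd : ∀ (d e : Fin 2 → A) (z : Fin 2 → Fin 2 → A), Matrix.diagonal d * Matrix.of z *
      Matrix.diagonal e = Matrix.of fun i j => d i * z i j * e j := fun d e z => by
    ext i j
    rw [Matrix.mul_diagonal, Matrix.diagonal_mul]; rfl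
  have hg : liftMatrix A g = Matrix.of fun i j => algebraMap ℂ A (g i j) := rfl
  simp only [Matrix.diagonal_mul_diagonal, ← mul_assoc]
  rw [hg, hd, hd]
  congr 1
  funext i j
  have hcongr : ∀ (z : ℂ) (a b a' b' : A), a * b = a' * b' →
      a * algebraMap ℂ A z * b = a' * algebraMap ℂ A z * b' := fun z a b a' b' h => by
    rw [hc, hc, mul_assoc, h, mul_assoc]
  apply hcongr
  fin_cases i <;> fin_cases j
  · change r * w * 1 * (r * v * 1) = w * r * v * r * (r * w * r * v) * (r * w * r * v)
    simp only [mul_assoc, mul_one, one_mul, hrr, hvw', hwv]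
  · change r * w * 1 * (1 * v * r) = w * r * v * r * (r * w * r * v) * 1
    simp only [mul_assoc, mul_one, one_mul, hrr, hvw', hwv', hr, hwv]
  · change 1 * w * r * (r * v * 1) = w * r * v * r * 1 * (r * w * r * v)
    simp only [mul_assoc, mul_one, one_mul, hrr, hvw', hwv]
  · change 1 * w * r * (1 * v * r) = w * r * v * r * 1 * 1
    simp only [mul_assoc, mul_one, one_mul]

/-- Bookkeeping for one induction step of `signalOperator_eq`: the inverse signal `T` is moved past
the rotations and merged with the power `Ti` already collected. -/
theorem signal_step {B : Type*} [Monoid B] {C₁ C₀ G₁ G₂ W V T Ti Tj X Y : B}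
    (hmid : C₀ * W * C₁ * G₁ * (C₀ * V * C₁) = T * (X * (G₁ * X))) (hT : T * G₂ = G₂ * T)
    (hTi : Ti * (G₂ * X * (G₁ * X)) = G₂ * X * (G₁ * X) * Ti) (hTj : T * Ti = Tj) :
    C₁ * G₂ * C₀ * (W * (C₁ * G₁ * C₀ * (V * (C₁ * (Ti * Y) * C₀))))
      = C₁ * (Tj * (G₂ * X * (G₁ * X) * Y)) * C₀ := by
  calc _ = C₁ * (G₂ * (C₀ * W * C₁ * G₁ * (C₀ * V * C₁)) * (Ti * Y)) * C₀ := by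
        simp only [mul_assoc]
    _ = C₁ * (T * ((G₂ * X * (G₁ * X)) * Ti) * Y) * C₀ := by
        rw [hmid, ← mul_assoc G₂, ← hT]; simp only [mul_assoc]
    _ = _ := by rw [← hTi, ← hTj]; simp only [mul_assoc]

/-- Every round, using `v` and `w` once each, contributes two signal factors `diag(ω, 1)` and one
factor `ω⁻¹`, so a polynomial of degree `2 i` is centred to a Laurent polynomial with exponents from
`-i` to `i`. The outer reflections are harmless in the block on which `r` is the identity. -/
theorem signalOperator_eq {r v w : A} (hr : r * r = 1) (hvw : v * w = 1) (hwv : w * v = 1)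
    (g : ℕ → Matrix (Fin 2) (Fin 2) ℂ) (i : ℕ) :
    signalOperator r v w g i = Matrix.diagonal ![1, r] *
      (Matrix.diagonal (fun _ => (w * r * v * r) ^ i) *
        (signalProduct g (2 * i)).map (Polynomial.aeval (r * w * r * v))) *
      Matrix.diagonal ![r, 1] := by
  set ω := r * w * r * v with hω
  set ω' := w * r * v * r with hω'
  have hrr : ∀ a : A, r * (r * a) = a := fun a => by rw [← mul_assoc, hr, one_mul]
  have hvw' : ∀ a : A, v * (w * a) = a := fun a => by rw [← mul_assoc, hvw, one_mul]
  have hwv' : ∀ a : A, w * (v * a) = a := fun a => by rw [← mul_assoc, hwv, one_mul]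
  have h1 : ω * ω' = 1 := by simp only [hω, hω', mul_assoc, hrr, hvw', hwv', hr]
  have h2 : ω' * ω = 1 := by simp only [hω, hω', mul_assoc, hrr, hvw', hwv]
  have hcomm : ∀ p : Polynomial ℂ, Commute ω' (Polynomial.aeval ω p) := fun p => by
    have hc : Commute ω' ω := h2.trans h1.symm
    induction p using Polynomial.induction_on' with
    | add p q hp hq => rw [map_add]; exact hp.add_right hq
    | monomial n a =>
      rw [Polynomial.aeval_monomial]
      exact (Algebra.commute_algebraMap_right a ω').mul_right (hc.pow_right n)
  induction i with
  | zero =>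
    rw [signalOperator]
    congr 2
    simp only [pow_zero, signalProduct, Matrix.diagonal_one, one_mul]
    ext a b
    simp [liftMatrix]
  | succ i ih =>
    have hmap : ∀ M N : Matrix (Fin 2) (Fin 2) (Polynomial ℂ),
        (M * N).map (Polynomial.aeval ω) = M.map (Polynomial.aeval ω) * N.map (Polynomial.aeval ω) :=
      fun M N => Matrix.map_mul
    have hC : ∀ j, ((g j).map Polynomial.C).map (Polynomial.aeval ω) = liftMatrix A (g j) :=
      fun j => by ext a b; simp [liftMatrix]
    have hX : (Matrix.diagonal ![(Polynomial.X : Polynomial ℂ), 1]).map (Polynomial.aeval ω)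
        = Matrix.diagonal ![ω, 1] := by
      ext a b; fin_cases a <;> fin_cases b <;> simp
    set K : Matrix (Fin 2) (Fin 2) A := liftMatrix A (g (2 * i + 2)) * Matrix.diagonal ![ω, 1] *
      (liftMatrix A (g (2 * i + 1)) * Matrix.diagonal ![ω, 1]) with hK
    have hKmap : K = ((g (2 * i + 2)).map Polynomial.C * Matrix.diagonal ![Polynomial.X, 1] *
      ((g (2 * i + 1)).map Polynomial.C * Matrix.diagonal ![Polynomial.X, 1])).map
        (Polynomial.aeval ω) := by
      rw [hmap, hmap, hmap, hC, hC, hX]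
    have hSP : (signalProduct g (2 * (i + 1))).map (Polynomial.aeval ω)
        = K * (signalProduct g (2 * i)).map (Polynomial.aeval ω) := by
      have hsp : signalProduct g (2 * (i + 1)) = (g (2 * i + 2)).map Polynomial.C *
          Matrix.diagonal ![Polynomial.X, 1] * ((g (2 * i + 1)).map Polynomial.C *
            Matrix.diagonal ![Polynomial.X, 1] * signalProduct g (2 * i)) := rfl
      rw [hKmap, ← hmap, hsp, ← mul_assoc]
    have hKc : Matrix.diagonal (fun _ => ω' ^ i) * K = K * Matrix.diagonal (fun _ => ω' ^ i) :=
      diagonal_const_comm fun a b => by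
        rw [hKmap]
        exact (hcomm _).pow_left i
    have hgc : Matrix.diagonal (fun _ => ω') * liftMatrix A (g (2 * i + 2))
        = liftMatrix A (g (2 * i + 2)) * Matrix.diagonal (fun _ => ω') :=
      diagonal_const_comm fun a b => Algebra.commute_algebraMap_right _ _
    have hmid := signal_middle hr hvw hwv (g (2 * i + 1))
    rw [← hω, ← hω'] at hmid
    have e : Matrix.diagonal (fun _ : Fin 2 => ω') * Matrix.diagonal (fun _ => ω' ^ i)
        = Matrix.diagonal (fun _ => ω' ^ (i + 1)) := by
      rw [Matrix.diagonal_mul_diagonal]; congr 1; funext _; rw [pow_succ']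
    rw [signalOperator, ih, hSP]
    exact signal_step hmid hgc hKc e

end SignalAlgebra

/-! ### Block form with respect to one distinguished qubit. -/

section Blocks

set_option linter.unusedSectionVars false

variable {R S : Type} [Fintype R] [Fintype S] [DecidableEq R] [DecidableEq S]

/-- The operator on `Option S` with given blocks with respect to the qubit `none`. -/
def joinBlocks (X : Matrix (Fin 2) (Fin 2) (QMatrix S)) : QMatrix (Option S) :=
  fun x y => X (x none) (y none) (x ∘ some) (y ∘ some)

theorem joinBlocks_mul (X Y : Matrix (Fin 2) (Fin 2) (QMatrix S)) :
    joinBlocks (X * Y) = joinBlocks X * joinBlocks Y := by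
  ext x y
  have h : ∑ z : Option S → Fin 2, joinBlocks X x z * joinBlocks Y z y
      = ∑ p : Fin 2 × (S → Fin 2), X (x none) p.1 (x ∘ some) p.2 *
          Y p.1 (y none) p.2 (y ∘ some) := by
    symm
    refine Fintype.sum_equiv
      { toFun := fun p o => o.elim p.1 p.2
        invFun := fun z => (z none, z ∘ some)
        left_inv := fun p => rfl
        right_inv := fun z => by funext o; cases o <;> rfl } _ _ fun p => rfl
  rw [Matrix.mul_apply, h, Fintype.sum_prod_type]
  simp only [joinBlocks, Matrix.mul_apply, Matrix.sum_apply]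

theorem onWires_some (G : QMatrix S) :
    onWires Function.Embedding.some G = joinBlocks (Matrix.diagonal fun _ => G) := by
  ext x y
  have h : (∀ q : Option S, (∀ r, Function.Embedding.some r ≠ q) → x q = y q) ↔ x none = y none := by
    constructor
    · intro h; exact h none fun r => by simp
    · intro h q hq
      cases q with
      | none => exact h
      | some s => exact absurd rfl (hq s)
  simp only [onWires, h, joinBlocks, Matrix.diagonal]
  by_cases hxy : x none = y none
  · simp [hxy]
  · simp [hxy]

theorem fiberwise_none (G : (S → Fin 2) → Matrix (Fin 2) (Fin 2) ℂ) :
    fiberwise none (fun x => G (x ∘ some))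
      = joinBlocks (fun i j => Matrix.diagonal fun s => G s i j) := by
  ext x y
  have h : (∀ q : Option S, q ≠ none → x q = y q) ↔ x ∘ some = y ∘ some := by
    constructor
    · intro h; funext s; exact h (some s) (by simp)
    · intro h q hq
      cases q with
      | none => exact absurd rfl hq
      | some s => exact congrFun h s
  simp only [fiberwise, h, joinBlocks, Matrix.diagonal_apply]

theorem controlled_eq_joinBlocks (U : QMatrix R) :
    controlled U = joinBlocks (Matrix.diagonal ![1, U]) := by
  ext x y
  simp only [controlled, joinBlocks, Matrix.diagonal_apply]
  have h01 : ∀ b : Fin 2, b = 0 ∨ b = 1 := by decide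
  by_cases h : x none = y none
  · rw [if_pos h, if_pos h]
    rcases h01 (x none) with h1 | h1 <;> simp [h1]
  · rw [if_neg h, if_neg h]; rfl

theorem liftMatrix_eq (g : Matrix (Fin 2) (Fin 2) ℂ) :
    liftMatrix (QMatrix S) g = fun i j => Matrix.diagonal fun _ => g i j := by
  ext i j : 2
  rw [liftMatrix, Matrix.map_apply, Matrix.algebraMap_eq_diagonal]
  rfl

theorem fiberwise_none_const (g : Matrix (Fin 2) (Fin 2) ℂ) :
    fiberwise (none : Option S) (fun _ => g) = joinBlocks (liftMatrix (QMatrix S) g) := by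
  rw [liftMatrix_eq, ← fiberwise_none (fun _ => g)]

end Blocks

/-! ### The shifted oracle, the signal reflection, and their circuits. -/

section SignalCircuit

variable {m n : ℕ}

/-- The wires that carry the signal: the selection qubit and the ancillas of the oracle. -/
def signalWires (m n : ℕ) : List (Option (Fin m ⊕ Fin n)) :=
  none :: (List.finRange m).map (fun i => some (Sum.inl i))

theorem signalWires_nodup (m n : ℕ) : (signalWires m n).Nodup := by
  unfold signalWires
  rw [List.nodup_cons]
  refine ⟨by simp, (List.nodup_finRange m).map fun i j h => ?_⟩
  simpa using h

theorem signalWires_length (m n : ℕ) : (signalWires m n).length = m + 1 := by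
  simp [signalWires]

/-- The basis state with all signal wires zero and the system register in the state `y`. -/
def systemState (m : ℕ) {n : ℕ} (y : Fin n → Fin 2) : Option (Fin m ⊕ Fin n) → Fin 2 :=
  fun o => o.elim 0 (Sum.elim (fun _ => 0) y)

theorem systemState_injective : Function.Injective (systemState m (n := n)) := fun _ _ h =>
  funext fun j => congrFun h (some (Sum.inr j))

theorem allZero_signalWires_iff (s : Option (Fin m ⊕ Fin n) → Fin 2) :
    AllZero (signalWires m n) s ↔ ∃ y, systemState m y = s := by
  constructor
  · intro h
    refine ⟨fun j => s (some (Sum.inr j)), funext fun o => ?_⟩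
    rcases o with _ | i | j
    · exact (h none (by simp [signalWires])).symm
    · exact (h (some (Sum.inl i)) (by simp [signalWires])).symm
    · rfl
  · rintro ⟨y, rfl⟩ c hc
    simp only [signalWires, List.mem_cons, List.mem_map] at hc
    rcases hc with rfl | ⟨i, -, rfl⟩ <;> rfl

open Classical in
/-- The reflection about the states with all signal wires zero. -/
noncomputable def signalReflection (m n : ℕ) : QMatrix (Option (Fin m ⊕ Fin n)) :=
  Matrix.diagonal fun s => if AllZero (signalWires m n) s then 1 else -1

theorem signalReflection_mul_self : signalReflection m n * signalReflection m n = 1 := by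
  rw [signalReflection, Matrix.diagonal_mul_diagonal, ← Matrix.diagonal_one]
  congr 1
  funext s
  split_ifs <;> simp

/-- The block of an operator on the states with all signal wires zero. -/
def compress (M : QMatrix (Option (Fin m ⊕ Fin n))) : QMatrix (Fin n) :=
  M.submatrix (systemState m) (systemState m)

theorem signalReflection_mul_apply (M : QMatrix (Option (Fin m ⊕ Fin n))) (y : Fin n → Fin 2)
    (s : Option (Fin m ⊕ Fin n) → Fin 2) :
    (signalReflection m n * M) (systemState m y) s = M (systemState m y) s := by
  rw [signalReflection, Matrix.diagonal_mul, if_pos ((allZero_signalWires_iff _).2 ⟨y, rfl⟩),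
    one_mul]

theorem compress_reflection_mul (M : QMatrix (Option (Fin m ⊕ Fin n))) :
    compress (signalReflection m n * M) = compress M := by
  ext x y
  exact signalReflection_mul_apply M x _

theorem compress_mul_reflection (M : QMatrix (Option (Fin m ⊕ Fin n))) :
    compress (M * signalReflection m n) = compress M := by
  ext x y
  rw [compress, Matrix.submatrix_apply, signalReflection, Matrix.mul_diagonal,
    if_pos ((allZero_signalWires_iff _).2 ⟨y, rfl⟩), mul_one]
  rfl

/-- The reflection is `2 Π - 1`, with `Π` the projector onto the states where all signal wires
vanish, and inserting `Π` between `M` and `N` multiplies their blocks. -/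
theorem compress_mul_reflection_mul (M N : QMatrix (Option (Fin m ⊕ Fin n))) :
    compress (M * (signalReflection m n * N))
      = (2 : ℂ) • (compress M * compress N) - compress (M * N) := by
  ext x y
  rw [Matrix.sub_apply, Matrix.smul_apply, Matrix.mul_apply]
  have h : ∑ z : Fin n → Fin 2, compress M x z * compress N z y
      = ∑ s, (open Classical in if AllZero (signalWires m n) s then
          M (systemState m x) s * N s (systemState m y) else 0) := by
    refine Fintype.sum_of_injective (systemState m) systemState_injective _ _ ?_ ?_
    · intro s hs
      rw [if_neg]
      rintro h
      exact hs ((allZero_signalWires_iff s).1 h)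
    · intro z
      rw [if_pos ((allZero_signalWires_iff _).2 ⟨z, rfl⟩)]
      rfl
  rw [h]
  simp only [compress, Matrix.submatrix_apply, Matrix.mul_apply, smul_eq_mul]
  rw [Finset.mul_sum, ← Finset.sum_sub_distrib]
  refine Finset.sum_congr rfl fun s _ => ?_
  rw [← Matrix.mul_apply, signalReflection, Matrix.diagonal_mul]
  split_ifs <;> ring

theorem compress_one : compress (1 : QMatrix (Option (Fin m ⊕ Fin n))) = 1 := by
  ext x y
  simp [compress, Matrix.one_apply, systemState_injective.eq_iff]

/-- The Hadamard gate. -/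
noncomputable def hadamard : Matrix (Fin 2) (Fin 2) ℂ :=
  (((Real.sqrt 2)⁻¹ : ℝ) : ℂ) • !![1, 1; 1, -1]

theorem sqrt_two_inv_mul_self :
    (((Real.sqrt 2)⁻¹ : ℝ) : ℂ) * (((Real.sqrt 2)⁻¹ : ℝ) : ℂ) = 1 / 2 := by
  rw [← Complex.ofReal_mul, ← mul_inv, Real.mul_self_sqrt (by norm_num)]
  norm_num

theorem hadamard_mul_self : hadamard * hadamard = 1 := by
  rw [hadamard, Matrix.smul_mul, Matrix.mul_smul, smul_smul, sqrt_two_inv_mul_self]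
  ext i j
  fin_cases i <;> fin_cases j <;> norm_num

theorem hadamard_mem_unitary : hadamard ∈ Matrix.unitaryGroup (Fin 2) ℂ := by
  rw [Matrix.mem_unitaryGroup_iff]
  have : star hadamard = hadamard := by
    ext i j
    fin_cases i <;> fin_cases j <;> simp [hadamard, Matrix.star_apply]
  rw [this, hadamard_mul_self]

variable {R S : Type} [Fintype R] [DecidableEq R] [Fintype S] [DecidableEq S]

theorem liftMatrix_mul {A : Type*} [Ring A] [Algebra ℂ A] (g h : Matrix (Fin 2) (Fin 2) ℂ) :
    liftMatrix A (g * h) = liftMatrix A g * liftMatrix A h := Matrix.map_mul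

theorem liftMatrix_one {A : Type*} [Ring A] [Algebra ℂ A] : liftMatrix A 1 = 1 :=
  Matrix.map_one _ (map_zero _) (map_one _)

theorem joinBlocks_one : joinBlocks (1 : Matrix (Fin 2) (Fin 2) (QMatrix S)) = 1 := by
  rw [← liftMatrix_one, ← fiberwise_none_const, fiberwise_one]

/-- The block encoding of `(1 + A) / 2` obtained from a block encoding `U` of `A`. -/
noncomputable def shiftedOracle (U : QMatrix R) : QMatrix (Option R) :=
  joinBlocks (liftMatrix (QMatrix R) hadamard * Matrix.diagonal ![1, U] *
    liftMatrix (QMatrix R) hadamard)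

theorem conj_involution_mul {B : Type*} [Monoid B] {L : B} (h : L * L = 1) (D D' : B) :
    L * D * L * (L * D' * L) = L * (D * D') * L := by
  calc L * D * L * (L * D' * L) = L * D * (L * L) * D' * L := by simp only [mul_assoc]
    _ = _ := by rw [h, mul_one]; simp only [mul_assoc]

theorem liftMatrix_hadamard_mul_self :
    liftMatrix (QMatrix R) hadamard * liftMatrix (QMatrix R) hadamard = 1 := by
  rw [← liftMatrix_mul, hadamard_mul_self, liftMatrix_one]

theorem diagonal_one_mul_diagonal_one {A : Type*} [Ring A] (a b : A) :
    Matrix.diagonal ![1, a] * Matrix.diagonal ![1, b] = Matrix.diagonal ![1, a * b] := by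
  rw [Matrix.diagonal_mul_diagonal]
  refine congrArg Matrix.diagonal (funext fun i => ?_)
  fin_cases i <;> simp

theorem shiftedOracle_mul (U U' : QMatrix R) :
    shiftedOracle U * shiftedOracle U' = shiftedOracle (U * U') := by
  unfold shiftedOracle
  rw [← joinBlocks_mul, ← diagonal_one_mul_diagonal_one]
  exact congrArg joinBlocks (conj_involution_mul liftMatrix_hadamard_mul_self _ _)

theorem shiftedOracle_one : shiftedOracle (1 : QMatrix R) = 1 := by
  rw [shiftedOracle]
  have hd : (Matrix.diagonal ![1, 1] : Matrix (Fin 2) (Fin 2) (QMatrix R)) = 1 := by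
    rw [← Matrix.diagonal_one]
    congr 1
    funext i; fin_cases i <;> simp
  rw [hd, mul_one, ← liftMatrix_mul, hadamard_mul_self, liftMatrix_one, joinBlocks_one]

/-- Averaging with the identity moves the spectrum of a Hermitian block from `[-1, 1]` into `[0,
1]`, so that functions even in the new variable can still tell the two sides of a threshold apart.
-/
theorem compress_shiftedOracle (U : QMatrix (Fin m ⊕ Fin n)) :
    compress (shiftedOracle U) = (1 / 2 : ℂ) • (1 + zeroBlock U) := by
  have h00 : (liftMatrix (QMatrix (Fin m ⊕ Fin n)) hadamard * Matrix.diagonal ![1, U] *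
      liftMatrix (QMatrix (Fin m ⊕ Fin n)) hadamard) 0 0 = (1 / 2 : ℂ) • (1 + U) := by
    rw [Matrix.mul_apply, Fin.sum_univ_two, Matrix.mul_diagonal, Matrix.mul_diagonal,
      ← sqrt_two_inv_mul_self]
    simp only [liftMatrix, Matrix.map_apply, hadamard, Algebra.algebraMap_eq_smul_one]
    simp [smul_smul]
  ext x y
  have h1 : ∀ z : Fin n → Fin 2, systemState m z ∘ some = Sum.elim (fun _ => 0) z := fun z => rfl
  have h2 : compress (shiftedOracle U) x y = ((1 / 2 : ℂ) • (1 + U))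
      (Sum.elim (fun _ => 0) x) (Sum.elim (fun _ => 0) y) := by
    rw [← h00]; rfl
  have h3 : (Sum.elim (fun _ => 0) x : Fin m ⊕ Fin n → Fin 2) = Sum.elim (fun _ => 0) y ↔ x = y :=
    ⟨fun h => funext fun j => congrFun h (Sum.inr j), fun h => by rw [h]⟩
  rw [h2]
  simp [Matrix.one_apply, h3, zeroBlock]

theorem onWires_refl (G : QMatrix S) : onWires (Function.Embedding.refl S) G = G := by
  ext x y
  rw [onWires, if_pos]
  · rfl
  · intro q hq
    exact absurd rfl (hq q)

theorem realizable_shiftedOracle (adj : Bool) :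
    Realizable R (fun U => shiftedOracle (if adj then U.conjTranspose else U)) 1 2 := by
  have hq : Realizable R (fun U : QMatrix R => controlled (if adj then U.conjTranspose else U)) 1 0 := by
    refine ⟨[.controlledQuery adj (Function.Embedding.refl _)], fun U => ?_,
      by simp [OracleCircuit.queryCount, CircuitElement.isQuery],
      by simp [OracleCircuit.gateCount, CircuitElement.isQuery]⟩
    simp only [OracleCircuit.toMatrix, CircuitElement.toMatrix, one_mul, onWires_refl]
  have hh := realizable_oneQubit (R := R) (none : Option R) hadamard_mem_unitary
  have h := ((hh.mul hq).mul hh).mono (q' := 1) (k' := 2) (by simp) (by simp)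
  simpa only [shiftedOracle, joinBlocks_mul, fiberwise_none_const, controlled_eq_joinBlocks] using h

/-- `Z g Z` up to sign, for the Pauli matrix `Z`. -/
def negConjZ (g : Matrix (Fin 2) (Fin 2) ℂ) : Matrix (Fin 2) (Fin 2) ℂ :=
  !![-g 0 0, g 0 1; g 1 0, -g 1 1]

theorem negConjZ_mem {g : Matrix (Fin 2) (Fin 2) ℂ}
    (hg : g ∈ Matrix.specialUnitaryGroup (Fin 2) ℂ) :
    negConjZ g ∈ Matrix.specialUnitaryGroup (Fin 2) ℂ := by
  rw [Matrix.mem_specialUnitaryGroup_iff, Matrix.mem_unitaryGroup_iff] at hg ⊢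
  obtain ⟨h1, h2⟩ := hg
  constructor
  · have e : ∀ i j, (g * star g) i j = (1 : Matrix (Fin 2) (Fin 2) ℂ) i j := fun i j => by rw [h1]
    have e00 := e 0 0
    have e01 := e 0 1
    have e10 := e 1 0
    have e11 := e 1 1
    simp only [Matrix.mul_apply, Fin.sum_univ_two, Matrix.star_apply, Matrix.one_apply,
      Fin.isValue, if_true, zero_ne_one, one_ne_zero, if_false] at e00 e01 e10 e11
    ext i j
    fin_cases i <;> fin_cases j <;>
      simp [negConjZ, Matrix.mul_apply, Fin.sum_univ_two, Matrix.star_apply] at e00 e01 e10 e11 ⊢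
    · exact e00
    · linear_combination -e01
    · linear_combination -e10
    · exact e11
  · rw [Matrix.det_fin_two] at h2 ⊢
    simp [negConjZ]
    exact h2

-- Where the signal wires vanish `r = 1` and the operator is `g`; elsewhere `r = -1` and it is
-- `negConjZ g`. So it is `negConjZ g` applied unconditionally after a correction in `SU(2)`
-- controlled by the `m + 1` signal wires.
open Classical in
theorem realizable_signalGate {g : Matrix (Fin 2) (Fin 2) ℂ}
    (hg : g ∈ Matrix.specialUnitaryGroup (Fin 2) ℂ) :
    Realizable R (fun _ => joinBlocks (Matrix.diagonal ![1, signalReflection m n] *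
      liftMatrix _ g * Matrix.diagonal ![signalReflection m n, 1])) 0 (80 * (m + 1) + 13) := by
  have hh := negConjZ_mem hg
  set h := negConjZ g with hdef
  have hhU := (Matrix.mem_specialUnitaryGroup_iff.1 hh).1
  have hu : star h * g ∈ Matrix.specialUnitaryGroup (Fin 2) ℂ := by
    refine mul_mem ?_ hg
    rw [Matrix.mem_specialUnitaryGroup_iff]
    refine ⟨Unitary.star_mem hhU, ?_⟩
    rw [Matrix.star_eq_conjTranspose, Matrix.det_conjTranspose,
      (Matrix.mem_specialUnitaryGroup_iff.1 hh).2, star_one]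
  have hnd : ((none : Option (Option (Fin m ⊕ Fin n))) :: (signalWires m n).map some).Nodup := by
    rw [List.nodup_cons]
    exact ⟨by simp, (signalWires_nodup m n).map (Option.some_injective _)⟩
  have hnone := (List.nodup_cons.1 hnd).1
  have h1 := realizable_multiGated (R := R) hnd hu
  have h2 := realizable_oneQubit (R := R) (none : Option (Option (Fin m ⊕ Fin n))) hhU
  have h3 := (h2.mul h1).mono (q' := 0) (k' := 80 * (m + 1) + 13) (by simp)
    (by rw [List.length_map, signalWires_length]; omega)
  simp only [fiberwise_mul _ ((independentOf_allZero hnone).gated _)] at h3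
  refine (congrArg (fun M => Realizable R (fun _ => M) 0 _) ?_).mp h3
  have hz : ∀ x : Option (Option (Fin m ⊕ Fin n)) → Fin 2,
      AllZero ((signalWires m n).map some) x ↔ AllZero (signalWires m n) (x ∘ some) := fun x => by
    simp [AllZero]
  have h4 : (fun x : Option (Option (Fin m ⊕ Fin n)) → Fin 2 =>
      h * gated (AllZero ((signalWires m n).map some)) (star h * g) x)
      = fun x => (fun s => if AllZero (signalWires m n) s then g else h) (x ∘ some) := by
    funext x
    unfold gated
    simp only [hz]
    split_ifs
    · rw [← mul_assoc, Matrix.mem_unitaryGroup_iff.1 hhU, one_mul]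
    · rw [mul_one]
  rw [h4, fiberwise_none (fun s => if AllZero (signalWires m n) s then g else h)]
  congr 1
  funext i j
  rw [Matrix.mul_diagonal, Matrix.diagonal_mul, liftMatrix_eq]
  have h01 : ∀ b : Fin 2, b = 0 ∨ b = 1 := by decide
  rcases h01 i with rfl | rfl <;> rcases h01 j with rfl | rfl <;>
    simp only [Matrix.cons_val_zero, Matrix.cons_val_one, one_mul, mul_one,
      signalReflection, Matrix.diagonal_mul_diagonal] <;>
    congr 1 <;> funext s <;> split_ifs <;> simp [hdef, negConjZ]

/-- There are `2 i + 1` reflected rotations and `2 i` shifted oracles; each of the latter costs one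
query and two Hadamard gates, which explains `15 = 13 + 2`. -/
theorem realizable_signalOperator {g : ℕ → Matrix (Fin 2) (Fin 2) ℂ}
    (hg : ∀ i, g i ∈ Matrix.specialUnitaryGroup (Fin 2) ℂ) (i : ℕ) :
    Realizable (Fin m ⊕ Fin n) (fun U => joinBlocks (signalOperator (signalReflection m n)
      (shiftedOracle U) (shiftedOracle U.conjTranspose) g i)) (2 * i)
      ((2 * i + 1) * (80 * (m + 1) + 15)) := by
  induction i with
  | zero =>
    simp only [signalOperator]
    exact (realizable_signalGate (hg 0)).mono (by simp) (by omega)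
  | succ i ih =>
    have hv : ∀ adj : Bool, Realizable (Fin m ⊕ Fin n) (fun U => joinBlocks (Matrix.diagonal fun _ =>
        shiftedOracle (if adj then U.conjTranspose else U))) 1 2 := fun adj => by
      simp only [← onWires_some]
      exact (realizable_shiftedOracle adj).onWires _
    have hV := hv false
    have hW := hv true
    simp only [if_true, Bool.false_eq_true, if_false] at hV hW
    have h := (realizable_signalGate (R := Fin m ⊕ Fin n) (m := m) (n := n) (hg (2 * i + 2))).mul
      (hW.mul ((realizable_signalGate (R := Fin m ⊕ Fin n) (m := m) (n := n) (hg (2 * i + 1))).mul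
        (hV.mul ih)))
    simp only [signalOperator, joinBlocks_mul] at h ⊢
    refine h.mono (by omega) ?_
    have e : (2 * (i + 1) + 1) * (80 * (m + 1) + 15)
        = (2 * i + 1) * (80 * (m + 1) + 15) + 2 * (80 * (m + 1) + 15) := by ring
    rw [e]; omega

end SignalCircuit

/-! ### Functions of a Hermitian matrix in its eigenbasis. -/

section Spectral

variable {n : ℕ} {H : QMatrix (Fin n)}

/-- The operator `∑ k, f (λ_k) |ψ_k⟩⟨ψ_k|`. -/
noncomputable def spectralMap (hH : H.IsHermitian) (f : ℝ → ℂ) : QMatrix (Fin n) :=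
  (hH.eigenvectorUnitary : QMatrix (Fin n)) * Matrix.diagonal (fun k => f (hH.eigenvalues k)) *
    star (hH.eigenvectorUnitary : QMatrix (Fin n))

theorem spectralMap_congr (hH : H.IsHermitian) {f g : ℝ → ℂ}
    (h : ∀ k, f (hH.eigenvalues k) = g (hH.eigenvalues k)) :
    spectralMap hH f = spectralMap hH g := by
  unfold spectralMap
  rw [funext h]

theorem spectralMap_mul (hH : H.IsHermitian) (f g : ℝ → ℂ) :
    spectralMap hH f * spectralMap hH g = spectralMap hH (fun t => f t * g t) := by
  unfold spectralMap
  have h : star (hH.eigenvectorUnitary : QMatrix (Fin n)) * (hH.eigenvectorUnitary : QMatrix (Fin n))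
      = 1 := Matrix.mem_unitaryGroup_iff'.1 hH.eigenvectorUnitary.2
  rw [← Matrix.diagonal_mul_diagonal]
  calc _ = (hH.eigenvectorUnitary : QMatrix (Fin n)) *
        Matrix.diagonal (fun k => f (hH.eigenvalues k)) *
        (star (hH.eigenvectorUnitary : QMatrix (Fin n)) *
          (hH.eigenvectorUnitary : QMatrix (Fin n))) *
        Matrix.diagonal (fun k => g (hH.eigenvalues k)) *
        star (hH.eigenvectorUnitary : QMatrix (Fin n)) := by simp only [mul_assoc]
    _ = _ := by rw [h, mul_one]; simp only [mul_assoc]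

theorem spectralMap_add (hH : H.IsHermitian) (f g : ℝ → ℂ) :
    spectralMap hH f + spectralMap hH g = spectralMap hH (fun t => f t + g t) := by
  unfold spectralMap
  rw [← Matrix.diagonal_add, mul_add, add_mul]

theorem spectralMap_sub (hH : H.IsHermitian) (f g : ℝ → ℂ) :
    spectralMap hH f - spectralMap hH g = spectralMap hH (fun t => f t - g t) := by
  unfold spectralMap
  rw [← Matrix.diagonal_sub, mul_sub, sub_mul]

theorem spectralMap_smul (hH : H.IsHermitian) (c : ℂ) (f : ℝ → ℂ) :
    c • spectralMap hH f = spectralMap hH (fun t => c * f t) := by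
  unfold spectralMap
  have : (Matrix.diagonal fun k => c * f (hH.eigenvalues k))
      = c • Matrix.diagonal (fun k => f (hH.eigenvalues k)) := by
    rw [← Matrix.diagonal_smul]; rfl
  rw [this, Matrix.mul_smul, Matrix.smul_mul]

theorem spectralMap_sum (hH : H.IsHermitian) {ι : Type*} (s : Finset ι) (f : ι → ℝ → ℂ) :
    ∑ i ∈ s, spectralMap hH (f i) = spectralMap hH (fun t => ∑ i ∈ s, f i t) := by
  classical
  induction s using Finset.induction_on with
  | empty => simp [spectralMap]
  | insert a s ha ih => simp only [Finset.sum_insert ha, ih, spectralMap_add]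

theorem spectralMap_one (hH : H.IsHermitian) : spectralMap hH (fun _ => 1) = 1 := by
  unfold spectralMap
  rw [Matrix.diagonal_one, mul_one]
  exact Matrix.mem_unitaryGroup_iff.1 hH.eigenvectorUnitary.2

theorem spectralMap_id (hH : H.IsHermitian) : spectralMap hH (fun t => (t : ℂ)) = H := by
  conv_rhs => rw [hH.spectral_theorem]
  rfl

theorem norm_spectralMap_le (hH : H.IsHermitian) {f : ℝ → ℂ} {ε : ℝ} (hε : 0 ≤ ε)
    (h : ∀ k, ‖f (hH.eigenvalues k)‖ ≤ ε) : ‖spectralMap hH f‖ ≤ ε := by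
  unfold spectralMap
  have h1 := CStarRing.norm_of_mem_unitary hH.eigenvectorUnitary.2
  have h2 : ‖star (hH.eigenvectorUnitary : QMatrix (Fin n))‖ = 1 := (norm_star _).trans h1
  refine (norm_mul_le _ _).trans ?_
  rw [h2, mul_one]
  refine (norm_mul_le _ _).trans ?_
  rw [h1, one_mul, Matrix.l2_opNorm_diagonal]
  exact (pi_norm_le_iff_of_nonneg hε).2 h

theorem sum_eigenKetBra (hH : H.IsHermitian) (p : ℝ → Prop) [DecidablePred p] :
    ∑ k with p (hH.eigenvalues k), eigenKetBra hH k
      = spectralMap hH (fun t => if p t then 1 else 0) := by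
  ext x y
  unfold spectralMap
  rw [Matrix.sum_apply, Matrix.mul_apply, Finset.sum_filter]
  refine Finset.sum_congr rfl fun k _ => ?_
  rw [Matrix.mul_diagonal, Matrix.star_apply, Matrix.IsHermitian.eigenvectorUnitary_apply,
    Matrix.IsHermitian.eigenvectorUnitary_apply]
  by_cases h : p (hH.eigenvalues k) <;> simp [h, eigenKetBra, Matrix.vecMulVec_apply]

theorem projectorLT_eq (hH : H.IsHermitian) (μ : ℝ) :
    projectorLT hH μ = spectralMap hH (fun t => if t < μ then 1 else 0) :=
  sum_eigenKetBra hH (fun t => t < μ)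

/-- Since `μ` is not an eigenvalue, the complement of the lower spectral part is the upper one. -/
theorem reflectorLT_eq (hH : H.IsHermitian) {μ : ℝ} (hμ : ∀ k, hH.eigenvalues k ≠ μ) :
    reflectorLT hH μ = spectralMap hH (fun t => if t < μ then 1 else -1) := by
  unfold reflectorLT
  rw [sum_eigenKetBra hH (fun t => t < μ), sum_eigenKetBra hH (fun t => μ < t), spectralMap_sub]
  refine spectralMap_congr hH fun k => ?_
  rcases lt_or_gt_of_ne (hμ k) with h | h
  · simp [h, h.not_gt]
  · simp [h, h.not_gt]

end Spectral

/-! ### Chebyshev recurrence for the blocks of the walk operator. -/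

section Walk

variable {m n : ℕ}

/-- The walk operator built from the signal reflection and the shifted oracle. -/
noncomputable def walkUnit {U : QMatrix (Fin m ⊕ Fin n)}
    (hU : U ∈ Matrix.unitaryGroup (Fin m ⊕ Fin n → Fin 2) ℂ) :
    (QMatrix (Option (Fin m ⊕ Fin n)))ˣ where
  val := signalReflection m n * shiftedOracle U.conjTranspose * signalReflection m n *
    shiftedOracle U
  inv := shiftedOracle U.conjTranspose * signalReflection m n * shiftedOracle U *
    signalReflection m n
  val_inv := by
    have h1 : shiftedOracle U * shiftedOracle U.conjTranspose = 1 := by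
      rw [shiftedOracle_mul, ← shiftedOracle_one]
      exact congrArg _ (Matrix.mem_unitaryGroup_iff.1 hU)
    have h2 : shiftedOracle U.conjTranspose * shiftedOracle U = 1 := by
      rw [shiftedOracle_mul, ← shiftedOracle_one]
      exact congrArg _ (Matrix.mem_unitaryGroup_iff'.1 hU)
    have hr := signalReflection_mul_self (m := m) (n := n)
    generalize signalReflection m n = r at *
    generalize shiftedOracle U = v at *
    generalize shiftedOracle U.conjTranspose = w at *
    calc r * w * r * v * (w * r * v * r) = r * w * r * (v * w) * r * v * r := by
          simp only [mul_assoc]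
      _ = r * w * (r * r) * v * r := by rw [h1, mul_one]; simp only [mul_assoc]
      _ = r * (w * v) * r := by rw [hr, mul_one]; simp only [mul_assoc]
      _ = 1 := by rw [h2, mul_one, hr]
  inv_val := by
    have h1 : shiftedOracle U * shiftedOracle U.conjTranspose = 1 := by
      rw [shiftedOracle_mul, ← shiftedOracle_one]
      exact congrArg _ (Matrix.mem_unitaryGroup_iff.1 hU)
    have h2 : shiftedOracle U.conjTranspose * shiftedOracle U = 1 := by
      rw [shiftedOracle_mul, ← shiftedOracle_one]
      exact congrArg _ (Matrix.mem_unitaryGroup_iff'.1 hU)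
    have hr := signalReflection_mul_self (m := m) (n := n)
    generalize signalReflection m n = r at *
    generalize shiftedOracle U = v at *
    generalize shiftedOracle U.conjTranspose = w at *
    calc w * r * v * r * (r * w * r * v) = w * r * v * (r * r) * w * r * v := by
          simp only [mul_assoc]
      _ = w * r * (v * w) * r * v := by rw [hr, mul_one]; simp only [mul_assoc]
      _ = w * (r * r) * v := by rw [h1, mul_one]; simp only [mul_assoc]
      _ = 1 := by rw [hr, mul_one, h2]

/-- The integer powers of the walk operator. -/
noncomputable def walkPow {U : QMatrix (Fin m ⊕ Fin n)}
    (hU : U ∈ Matrix.unitaryGroup (Fin m ⊕ Fin n → Fin 2) ℂ) (l : ℤ) :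
    QMatrix (Option (Fin m ⊕ Fin n)) := (walkUnit hU ^ l).val

/-- The block of the walk operator. -/
noncomputable def walkBlock (U : QMatrix (Fin m ⊕ Fin n)) : QMatrix (Fin n) :=
  compress (shiftedOracle U.conjTranspose * signalReflection m n * shiftedOracle U)

/-- With `K = w r v` the walk is `r K` and its inverse `K r`. The next power is `r K` times the
current one and the previous is `K r` times it; the outer `r` is invisible to the block, and the
inner one is resolved by `compress_mul_reflection_mul`. -/
theorem compress_walk_succ {U : QMatrix (Fin m ⊕ Fin n)}
    (hU : U ∈ Matrix.unitaryGroup (Fin m ⊕ Fin n → Fin 2) ℂ) (l : ℤ) :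
    compress (walkPow hU (l + 1))
      = (2 : ℂ) • (walkBlock U * compress (walkPow hU l))
        - compress (walkPow hU (l - 1)) := by
  have e1 : (walkPow hU (l + 1))
      = signalReflection m n * ((shiftedOracle U.conjTranspose * signalReflection m n *
        shiftedOracle U) * (walkPow hU l)) := by
    unfold walkPow
    rw [add_comm, zpow_add, zpow_one, Units.val_mul]
    change signalReflection m n * shiftedOracle U.conjTranspose * signalReflection m n *
      shiftedOracle U * _ = _
    simp only [mul_assoc]
  have e2 : (walkPow hU (l - 1))
      = (shiftedOracle U.conjTranspose * signalReflection m n * shiftedOracle U) *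
        (signalReflection m n * (walkPow hU l)) := by
    unfold walkPow
    rw [sub_eq_neg_add, zpow_add, zpow_neg_one, Units.val_mul]
    change shiftedOracle U.conjTranspose * signalReflection m n * shiftedOracle U *
      signalReflection m n * _ = _
    simp only [mul_assoc]
  rw [e1, e2, compress_reflection_mul, compress_mul_reflection_mul, walkBlock]
  abel

theorem compress_walk_one {U : QMatrix (Fin m ⊕ Fin n)}
    (hU : U ∈ Matrix.unitaryGroup (Fin m ⊕ Fin n → Fin 2) ℂ) :
    compress (walkPow hU (1 : ℤ))
      = walkBlock U := by
  rw [walkPow, zpow_one]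
  change compress (signalReflection m n * shiftedOracle U.conjTranspose * signalReflection m n *
      shiftedOracle U) = _
  rw [mul_assoc, mul_assoc, compress_reflection_mul, walkBlock, mul_assoc]

/-- This is `2 x ^ 2 - 1` for `x = (1 + B) / 2`, the case of the second Chebyshev polynomial. -/
theorem walkBlock_eq {U : QMatrix (Fin m ⊕ Fin n)}
    (hU : U ∈ Matrix.unitaryGroup (Fin m ⊕ Fin n → Fin 2) ℂ) (hB : (zeroBlock U).IsHermitian) :
    walkBlock U = (1 / 2 : ℂ) • ((1 + zeroBlock U) * (1 + zeroBlock U)) - 1 := by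
  have hz : zeroBlock U.conjTranspose = zeroBlock U := hB
  have h2 : shiftedOracle U.conjTranspose * shiftedOracle U = 1 := by
    rw [shiftedOracle_mul, ← shiftedOracle_one]
    exact congrArg _ (Matrix.mem_unitaryGroup_iff'.1 hU)
  rw [walkBlock, mul_assoc, compress_mul_reflection_mul, h2, compress_one, compress_shiftedOracle,
    compress_shiftedOracle, hz, Matrix.smul_mul, Matrix.mul_smul, smul_smul, smul_smul]
  norm_num

/-- The walk operator acts as a rotation by the angle `2 arccos ((1 + λ / α) / 2)`. -/
noncomputable def walkAngle (α t : ℝ) : ℝ := 2 * Real.arccos ((1 + t / α) / 2)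

/-- The blocks and the cosines satisfy the same second-order recurrence with the same values at `0`
and `1`. The spectral bound puts `(1 + t / α) / 2` in the range where `cos (arccos x) = x`. -/
theorem compress_walk_zpow {α : ℝ} (hα : 0 < α) {H : QMatrix (Fin n)} (hH : H.IsHermitian)
    {U : QMatrix (Fin m ⊕ Fin n)} (hU : U ∈ Matrix.unitaryGroup (Fin m ⊕ Fin n → Fin 2) ℂ)
    (hUH : H = (α : ℂ) • zeroBlock U) (hbound : ∀ k, |hH.eigenvalues k| ≤ α) (l : ℤ) :
    compress (walkPow hU l)
      = spectralMap hH (fun t => ((Real.cos (l * walkAngle α t) : ℝ) : ℂ)) := by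
  have hα' : (α : ℂ) ≠ 0 := Complex.ofReal_ne_zero.2 hα.ne'
  have hz : zeroBlock U = spectralMap hH (fun t => ((α : ℂ))⁻¹ * (t : ℂ)) := by
    rw [← spectralMap_smul, spectralMap_id]
    conv_rhs => rw [hUH]
    rw [smul_smul, inv_mul_cancel₀ hα', one_smul]
  have hherm : (zeroBlock U).IsHermitian := by
    have h1 : zeroBlock U = ((α⁻¹ : ℝ) : ℂ) • H := by
      rw [hUH, smul_smul]
      push_cast
      rw [inv_mul_cancel₀ hα', one_smul]
    rw [h1, Matrix.IsHermitian, Matrix.conjTranspose_smul, hH.eq]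
    congr 1
    exact Complex.conj_ofReal _
  have hB : walkBlock U = spectralMap hH (fun t => ((Real.cos (walkAngle α t) : ℝ) : ℂ)) := by
    rw [walkBlock_eq hU hherm, hz, ← spectralMap_one hH, spectralMap_add, spectralMap_mul,
      spectralMap_smul, spectralMap_sub]
    refine spectralMap_congr hH fun k => ?_
    have h1 := abs_le.1 (hbound k)
    have h2 : -1 ≤ hH.eigenvalues k / α := by rw [le_div_iff₀ hα]; linarith
    have h3 : hH.eigenvalues k / α ≤ 1 := by rw [div_le_iff₀ hα]; linarith
    rw [walkAngle, Real.cos_two_mul, Real.cos_arccos (by linarith) (by linarith)]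
    push_cast
    field_simp
  have h0 : compress (walkPow hU (0 : ℤ))
      = spectralMap hH (fun t => ((Real.cos ((0 : ℤ) * walkAngle α t) : ℝ) : ℂ)) := by
    rw [walkPow, zpow_zero, Units.val_one, compress_one, ← spectralMap_one hH]
    simp
  have h1 : compress (walkPow hU (1 : ℤ))
      = spectralMap hH (fun t => ((Real.cos ((1 : ℤ) * walkAngle α t) : ℝ) : ℂ)) := by
    rw [compress_walk_one, hB]
    simp
  have hrec : ∀ l : ℤ, spectralMap hH (fun t => ((Real.cos ((l + 1 : ℤ) * walkAngle α t) : ℝ) : ℂ))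
      = (2 : ℂ) • (walkBlock U * spectralMap hH
          (fun t => ((Real.cos (l * walkAngle α t) : ℝ) : ℂ)))
        - spectralMap hH (fun t => ((Real.cos ((l - 1 : ℤ) * walkAngle α t) : ℝ) : ℂ)) := by
    intro l
    rw [hB, spectralMap_mul, spectralMap_smul, spectralMap_sub]
    congr 1
    funext t
    push_cast
    rw [add_mul, sub_mul, one_mul, Complex.cos_add, Complex.cos_sub]
    ring
  -- Two consecutive values are carried along, so that the recurrence can be run in both directions
  -- over the integers.
  suffices h : ∀ l : ℤ,
      compress (walkPow hU l)
        = spectralMap hH (fun t => ((Real.cos (l * walkAngle α t) : ℝ) : ℂ)) ∧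
      compress (walkPow hU (l + 1))
        = spectralMap hH (fun t => ((Real.cos ((l + 1 : ℤ) * walkAngle α t) : ℝ) : ℂ)) from (h l).1
  intro l
  induction l using Int.induction_on with
  | zero => exact ⟨h0, by rw [zero_add]; exact h1⟩
  | succ i ih =>
    refine ⟨ih.2, ?_⟩
    rw [compress_walk_succ hU, hrec, ih.2, add_sub_cancel_right, ih.1]
  | pred i ih =>
    have ha := compress_walk_succ hU (-(i : ℤ))
    have hb := hrec (-(i : ℤ))
    rw [ih.1, ih.2, hb] at ha
    refine ⟨?_, by rw [sub_add_cancel]; exact ih.1⟩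
    exact (sub_right_injective ha).symm

end Walk

/-! ### From polynomials to threshold circuits. -/

section Assembly

variable {m n : ℕ}

/-- A signal processing circuit implements a polynomial of the walk operator. -/
theorem exists_realizable_polynomial (m n : ℕ) {D : ℕ} {P : Polynomial ℂ}
    (hP : P.natDegree ≤ 2 * D) (hlt : ∀ w : ℂ, ‖w‖ = 1 → ‖P.eval w‖ < 1) :
    ∃ X : QMatrix (Fin m ⊕ Fin n) → Matrix (Fin 2) (Fin 2) (QMatrix (Option (Fin m ⊕ Fin n))),
      Realizable (Fin m ⊕ Fin n) (fun U => joinBlocks (X U)) (2 * D)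
        ((2 * D + 1) * (80 * (m + 1) + 15)) ∧
      ∀ (U : QMatrix (Fin m ⊕ Fin n)) (hU : U ∈ Matrix.unitaryGroup (Fin m ⊕ Fin n → Fin 2) ℂ),
        compress (X U 0 0) = ∑ l ∈ Finset.range (2 * D + 1),
          P.coeff l • compress (walkPow hU ((l : ℤ) - D)) := by
  obtain ⟨Q, hQ, hPQ⟩ := exists_complement hP hlt
  obtain ⟨g, hg, hgP, -⟩ := exists_signalProduct (2 * D) P Q hP hQ hPQ
  refine ⟨_, realizable_signalOperator hg D, fun U hU => ?_⟩
  have h1 : shiftedOracle U * shiftedOracle U.conjTranspose = 1 := by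
    rw [shiftedOracle_mul, ← shiftedOracle_one]
    exact congrArg _ (Matrix.mem_unitaryGroup_iff.1 hU)
  have h2 : shiftedOracle U.conjTranspose * shiftedOracle U = 1 := by
    rw [shiftedOracle_mul, ← shiftedOracle_one]
    exact congrArg _ (Matrix.mem_unitaryGroup_iff'.1 hU)
  -- The upper left entry is `ω⁻¹ ^ D * P(ω) * r` for the walk `ω`, and the trailing reflection
  -- disappears in the block.
  rw [signalOperator_eq signalReflection_mul_self h1 h2, Matrix.mul_diagonal, Matrix.diagonal_mul,
    Matrix.diagonal_mul, Matrix.map_apply, hgP]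
  simp only [Matrix.cons_val_zero, one_mul]
  rw [compress_mul_reflection, Polynomial.aeval_eq_sum_range' (Nat.lt_succ_of_le hP),
    Finset.mul_sum]
  have hpow : ∀ l : ℕ, (shiftedOracle U.conjTranspose * signalReflection m n * shiftedOracle U *
      signalReflection m n) ^ D * (signalReflection m n * shiftedOracle U.conjTranspose *
        signalReflection m n * shiftedOracle U) ^ l = walkPow hU ((l : ℤ) - D) := fun l => by
    rw [walkPow, sub_eq_neg_add, zpow_add, zpow_neg, zpow_natCast, zpow_natCast, Units.val_mul,
      ← inv_pow, Units.val_pow_eq_pow_val, Units.val_pow_eq_pow_val]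
    rfl
  simp only [Matrix.mul_smul, hpow]
  ext x y
  simp only [compress, Matrix.submatrix_apply, Matrix.sum_apply, Matrix.smul_apply]

/-- The wires of the signal processing circuit inside a register with `M ≥ m + 2` ancillas. -/
def signalEmbedding {M : ℕ} (hM : m + 2 ≤ M) (n : ℕ) :
    Option (Option (Fin m ⊕ Fin n)) ↪ Fin M ⊕ Fin n where
  toFun
    | none => Sum.inl ⟨m + 1, by omega⟩
    | some none => Sum.inl ⟨m, by omega⟩
    | some (some (Sum.inl i)) => Sum.inl ⟨i, by omega⟩
    | some (some (Sum.inr j)) => Sum.inr j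
  inj' := by
    rintro (_ | _ | i | j) (_ | _ | i' | j') h <;> simp at h ⊢
    · have := i'.2; omega
    · have := i'.2; omega
    · have := i.2; omega
    · have := i.2; omega
    · exact Fin.ext h
    · exact h

theorem zeroBlock_onWires_signalEmbedding {M : ℕ} (hM : m + 2 ≤ M)
    (X : Matrix (Fin 2) (Fin 2) (QMatrix (Option (Fin m ⊕ Fin n)))) :
    zeroBlock (onWires (signalEmbedding hM n) (joinBlocks X)) = compress (X 0 0) := by
  have h : ∀ z : Fin n → Fin 2, (Sum.elim (fun _ => 0) z ∘ signalEmbedding hM n) ∘ some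
      = systemState m z := fun z => by
    funext o
    rcases o with _ | i | j <;> rfl
  ext x y
  rw [zeroBlock, onWires, if_pos]
  · rw [joinBlocks, h, h]
    rfl
  · rintro (i | j) hq
    · rfl
    · exact absurd rfl (hq (some (some (Sum.inr j))))

theorem cos_sum_eq {D : ℕ} {P : Polynomial ℂ} (hP : P.natDegree ≤ 2 * D) (θ : ℝ) :
    ∑ l ∈ Finset.range (2 * D + 1),
        P.coeff l * ((Real.cos (((l : ℤ) - D : ℤ) * (2 * θ)) : ℝ) : ℂ)
      = (P.eval (Complex.exp (θ * Complex.I) ^ 2) * (Complex.exp (-θ * Complex.I) ^ 2) ^ D +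
        P.eval (Complex.exp (-θ * Complex.I) ^ 2) * (Complex.exp (θ * Complex.I) ^ 2) ^ D) / 2 := by
  rw [Polynomial.eval_eq_sum_range' (Nat.lt_succ_of_le hP),
    Polynomial.eval_eq_sum_range' (Nat.lt_succ_of_le hP), Finset.sum_mul, Finset.sum_mul,
    ← Finset.sum_add_distrib, Finset.sum_div]
  refine Finset.sum_congr rfl fun l _ => ?_
  rw [Complex.ofReal_cos, Complex.cos, mul_assoc, mul_assoc, ← mul_add, mul_div_assoc]
  simp only [← Complex.exp_nat_mul, ← Complex.exp_add]
  congr 3 <;> congr 1 <;> push_cast <;> ring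

/-- The cosine sum is the mean of `z ^ (-2 D) * P (z ^ 2)` over `z = exp (i θ)` and its conjugate.
Both points have real part `cos θ`, so the approximation applies to each, and `P` need not have any
symmetry. -/
theorem norm_cos_sum_sub_le {D : ℕ} {P : Polynomial ℂ} (hP : P.natDegree ≤ 2 * D) {θ v ε : ℝ}
    (h : ∀ z : ℂ, ‖z‖ = 1 → z.re = Real.cos θ →
      ‖P.eval (z ^ 2) - v * (z ^ 2) ^ D‖ ≤ ε) :
    ‖(v : ℂ) - ∑ l ∈ Finset.range (2 * D + 1),
      P.coeff l * ((Real.cos (((l : ℤ) - D : ℤ) * (2 * θ)) : ℝ) : ℂ)‖ ≤ ε := by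
  have hre : ∀ t : ℝ, (Complex.exp (t * Complex.I)).re = Real.cos t := fun t =>
    Complex.exp_ofReal_mul_I_re t
  have h1 := h _ (Complex.norm_exp_ofReal_mul_I θ) (hre θ)
  have h2 := h _ (Complex.norm_exp_ofReal_mul_I (-θ)) (by rw [hre, Real.cos_neg])
  have n1 := Complex.norm_exp_ofReal_mul_I θ
  have n2 := Complex.norm_exp_ofReal_mul_I (-θ)
  rw [cos_sum_eq hP]
  rw [Complex.ofReal_neg] at h2 n2
  set z := Complex.exp (θ * Complex.I) with hz
  set z' := Complex.exp (-θ * Complex.I) with hz'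
  have hzz : z * z' = 1 := by
    rw [hz, hz', ← Complex.exp_add]; simp
  have hzD : (z ^ 2) ^ D * (z' ^ 2) ^ D = 1 := by
    rw [← mul_pow, ← mul_pow, hzz]; simp
  have e : (v : ℂ) - (P.eval (z ^ 2) * (z' ^ 2) ^ D + P.eval (z' ^ 2) * (z ^ 2) ^ D) / 2
      = -(((P.eval (z ^ 2) - v * (z ^ 2) ^ D) * (z' ^ 2) ^ D +
        (P.eval (z' ^ 2) - v * (z' ^ 2) ^ D) * (z ^ 2) ^ D) / 2) := by
    linear_combination (-(v : ℂ)) * hzD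
  rw [e, norm_neg, norm_div]
  have h3 := norm_add_le ((P.eval (z ^ 2) - v * (z ^ 2) ^ D) * (z' ^ 2) ^ D)
    ((P.eval (z' ^ 2) - v * (z' ^ 2) ^ D) * (z ^ 2) ^ D)
  rw [norm_mul, norm_mul, norm_pow, norm_pow, norm_pow, norm_pow, n1, n2] at h3
  simp only [one_pow, mul_one] at h3
  rw [Complex.norm_ofNat, div_le_iff₀ two_pos]
  linarith

/-- The block is `E† U E` for the isometry `E` that adjoins ancillas in the zero state. -/
theorem norm_zeroBlock_le {U : QMatrix (Fin m ⊕ Fin n)}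
    (hU : U ∈ Matrix.unitaryGroup (Fin m ⊕ Fin n → Fin 2) ℂ) : ‖zeroBlock U‖ ≤ 1 := by
  have hUn : ‖U‖ = 1 := CStarRing.norm_of_mem_unitary hU
  obtain ⟨E, hE⟩ : ∃ E : Matrix (Fin m ⊕ Fin n → Fin 2) (Fin n → Fin 2) ℂ,
      ∀ s y, E s y = if s = Sum.elim (fun _ => 0) y then 1 else 0 := ⟨fun _ _ => _, fun _ _ => rfl⟩
  have hinj : ∀ x y : Fin n → Fin 2,
      (Sum.elim (fun _ => 0) x : Fin m ⊕ Fin n → Fin 2) = Sum.elim (fun _ => 0) y ↔ x = y :=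
    fun x y => ⟨fun h => funext fun j => congrFun h (Sum.inr j), fun h => by rw [h]⟩
  have hEE : E.conjTranspose * E = 1 := by
    ext x y
    simp [Matrix.mul_apply, hE, Matrix.one_apply, hinj, apply_ite, eq_comm]
  have hEn : ‖E‖ = 1 := by
    have h := Matrix.l2_opNorm_conjTranspose_mul_self E
    rw [hEE, norm_one] at h
    nlinarith [norm_nonneg E]
  have hz : zeroBlock U = E.conjTranspose * U * E := by
    ext x y
    simp [Matrix.mul_apply, hE, zeroBlock, apply_ite]
  rw [hz]
  refine (Matrix.l2_opNorm_mul _ _).trans ?_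
  rw [hEn, mul_one]
  refine (Matrix.l2_opNorm_mul _ _).trans ?_
  rw [Matrix.l2_opNorm_conjTranspose, hEn, hUn, one_mul]

theorem IsBlockEncoding.eq_smul {α : ℝ} {U : QMatrix (Fin m ⊕ Fin n)} {H : QMatrix (Fin n)}
    (h : IsBlockEncoding α m 0 U H) : H = (α : ℂ) • zeroBlock U :=
  sub_eq_zero.1 (norm_le_zero_iff.1 h.2)

theorem IsBlockEncoding.abs_eigenvalues_le {α : ℝ} (hα : 0 < α) {U : QMatrix (Fin m ⊕ Fin n)}
    {H : QMatrix (Fin n)} (h : IsBlockEncoding α m 0 U H) (hH : H.IsHermitian)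
    (k : Fin n → Fin 2) : |hH.eigenvalues k| ≤ α := by
  have h1 : ‖H‖ ≤ α := by
    rw [h.eq_smul, norm_smul, Complex.norm_real, Real.norm_eq_abs, abs_of_pos hα]
    exact mul_le_of_le_one_right hα.le (norm_zeroBlock_le h.1)
  have h2 := spectrum.norm_le_norm_of_mem (hH.eigenvalues_mem_spectrum_real k)
  rw [Real.norm_eq_abs] at h2
  exact h2.trans h1

/-- The threshold function equal to `v₁` below `μ` and to `v₂` elsewhere is block encoded by a
circuit with the stated resources. -/
theorem exists_threshold_circuit_of_le {M : ℕ} (hM : m + 2 ≤ M) (n : ℕ) {α Δ μ ε v₁ v₂ : ℝ}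
    (hα : 0 < α) (hΔ : 0 < Δ) (hΔα : Δ ≤ 2 * α) (hε : 0 < ε) (hε1 : ε < 1)
    (hv₁ : |v₁| ≤ 1) (hv₂ : |v₂| ≤ 1) :
    ∃ c : OracleCircuit (Fin m ⊕ Fin n) (Fin M ⊕ Fin n),
      (c.queryCount : ℝ) ≤ 20000 * (α / Δ * Real.log (2 / ε)) ∧
      (c.gateCount : ℝ) ≤ 20000 * ((m + 1) * max 1 (α / Δ) * Real.log (2 / ε)) ∧
      ∀ (H : QMatrix (Fin n)) (hH : H.IsHermitian) (U : QMatrix (Fin m ⊕ Fin n)),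
        IsBlockEncoding α m 0 U H → (∀ k, Δ / 2 ≤ |μ - hH.eigenvalues k|) →
          IsBlockEncoding 1 M ε (c.toMatrix U)
            (spectralMap hH fun t => if t < μ then (v₁ : ℂ) else (v₂ : ℂ)) := by
  -- A distance `Δ / 2` from `μ` to an eigenvalue becomes `Δ / (4 α)` in the variable `x = (1 + t /
  -- α) / 2`, where the threshold sits at `(1 + μ / α) / 2`.
  have hδ : 0 < Δ / (4 * α) := by positivity
  have hδ1 : Δ / (4 * α) ≤ 1 := by rw [div_le_one (by positivity)]; linarith
  obtain ⟨D, P, hD, hP, hlt, happ⟩ := exists_step_polynomial (x₀ := (1 + μ / α) / 2) hδ hδ1 hε hε1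
    hv₁ hv₂
  obtain ⟨X, hX, hXU⟩ := exists_realizable_polynomial m n hP hlt
  obtain ⟨c, hc, hcq, hck⟩ := hX.onWires (signalEmbedding hM n)
  have hL : 1 / 2 ≤ Real.log (2 / ε) := by
    have h1 : Real.log 2 ≤ Real.log (2 / ε) := Real.log_le_log (by norm_num) (by
      rw [le_div_iff₀ hε]; linarith)
    linarith [Real.log_two_gt_d9]
  set L := Real.log (2 / ε) with hLdef
  have hD' : (D : ℝ) ≤ 96 * (α / Δ * L) := by
    refine hD.trans (le_of_eq ?_)
    field_simp
    ring
  refine ⟨c, ?_, ?_, fun H hH U hUH hgap => ?_⟩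
  · have h1 : (c.queryCount : ℝ) ≤ 2 * D := by exact_mod_cast hcq
    have : 0 ≤ α / Δ * L := by positivity
    linarith
  · have h1 : (c.gateCount : ℝ) ≤ (2 * D + 1) * (80 * (m + 1) + 15) := by exact_mod_cast hck
    have h2 : α / Δ * L ≤ max 1 (α / Δ) * L :=
      mul_le_mul_of_nonneg_right (le_max_right _ _) (by linarith)
    have h3 : 1 * L ≤ max 1 (α / Δ) * L :=
      mul_le_mul_of_nonneg_right (le_max_left _ _) (by linarith)
    -- Here `194 = 2 * 96 + 2`: the additional `1` is at most `2 L` because `L ≥ 1 / 2`.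
    have h4 : 2 * (D : ℝ) + 1 ≤ 194 * (max 1 (α / Δ) * L) := by linarith
    have h5 : 80 * ((m : ℝ) + 1) + 15 ≤ 95 * (m + 1) := by
      have : (0 : ℝ) ≤ m := Nat.cast_nonneg m
      linarith
    have h6 : (2 * (D : ℝ) + 1) * (80 * (m + 1) + 15)
        ≤ 194 * (max 1 (α / Δ) * L) * (95 * (m + 1)) :=
      mul_le_mul h4 h5 (by positivity) (by linarith)
    have h7 : 0 ≤ (m + 1) * max 1 (α / Δ) * L := by positivity
    have h8 : 194 * (max 1 (α / Δ) * L) * (95 * ((m : ℝ) + 1))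
        = 18430 * ((m + 1) * max 1 (α / Δ) * L) := by ring
    linarith
  · have hbound := hUH.abs_eigenvalues_le hα hH
    refine ⟨OracleCircuit.toMatrix_mem_unitary hUH.1 c, ?_⟩
    rw [hc, zeroBlock_onWires_signalEmbedding, hXU U hUH.1, Complex.ofReal_one, one_smul]
    simp only [compress_walk_zpow hα hH hUH.1 hUH.eq_smul hbound, spectralMap_smul]
    rw [spectralMap_sum, spectralMap_sub]
    refine norm_spectralMap_le hH hε.le fun k => ?_
    set t := hH.eigenvalues k with ht
    have ht1 := abs_le.1 (hbound k)
    have hx1 : -1 ≤ t / α := by rw [le_div_iff₀ hα]; linarith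
    have hx2 : t / α ≤ 1 := by rw [div_le_iff₀ hα]; linarith
    have hcos : Real.cos (Real.arccos ((1 + t / α) / 2)) = (1 + t / α) / 2 :=
      Real.cos_arccos (by linarith) (by linarith)
    have hre : ∀ z : ℂ, z.re = Real.cos (Real.arccos ((1 + t / α) / 2)) →
        |z.re| = (1 + t / α) / 2 := fun z hz => by
      rw [hz, hcos, abs_of_nonneg (by linarith)]
    have hgk := hgap k
    rw [← ht] at hgk
    have hdiff : (1 + μ / α) / 2 - (1 + t / α) / 2 = (μ - t) / (2 * α) := by field_simp; ring
    by_cases hlt' : t < μ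
    · simp only [if_pos hlt', walkAngle]
      refine norm_cos_sum_sub_le hP fun z hz hzre => (happ z hz).1 ?_
      rw [hre z hzre]
      rw [abs_of_pos (by linarith)] at hgk
      have h1 : Δ / (4 * α) ≤ (μ - t) / (2 * α) := by
        rw [div_le_div_iff₀ (by positivity) (by positivity)]; nlinarith
      linarith
    · simp only [if_neg hlt', walkAngle]
      refine norm_cos_sum_sub_le hP fun z hz hzre => (happ z hz).2 ?_
      rw [hre z hzre]
      rw [abs_of_nonpos (by linarith)] at hgk
      have h1 : Δ / (4 * α) ≤ (t - μ) / (2 * α) := by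
        rw [div_le_div_iff₀ (by positivity) (by positivity)]; nlinarith
      have h2 : (t - μ) / (2 * α) = -((μ - t) / (2 * α)) := by ring
      linarith

theorem zeroBlock_fiberwise_const {M : ℕ} (i : Fin M) (g : Matrix (Fin 2) (Fin 2) ℂ) :
    zeroBlock (fiberwise (Sum.inl i : Fin M ⊕ Fin n) (fun _ => g)) = g 0 0 • 1 := by
  ext x y
  have h : (∀ q : Fin M ⊕ Fin n, q ≠ Sum.inl i →
      (Sum.elim (fun _ => 0) x : Fin M ⊕ Fin n → Fin 2) q = Sum.elim (fun _ => 0) y q) ↔ x = y :=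
    ⟨fun h => funext fun j => h (Sum.inr j) (by simp), fun h => by rw [h]; simp⟩
  rw [zeroBlock, fiberwise, Matrix.smul_apply, Matrix.one_apply]
  simp only [h, Sum.elim_inl]
  split_ifs <;> simp

/-- For `Δ > 2 α` the query budget may be below one, so the oracle must be avoided. The bound `|λ| ≤
α < Δ / 2` and the gap then put every eigenvalue on the side of `μ` determined by the sign of `μ`,
and the target is a constant times the identity, which a single gate on one ancilla encodes exactly.
-/
theorem exists_threshold_circuit {M : ℕ} (hM : m + 2 ≤ M) (n : ℕ) {α Δ μ ε v₁ v₂ : ℝ}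
    (hα : 0 < α) (hΔ : 0 < Δ) (hε : 0 < ε) (hε1 : ε < 1)
    (hv₁ : |v₁| ≤ 1) (hv₂ : |v₂| ≤ 1) :
    ∃ c : OracleCircuit (Fin m ⊕ Fin n) (Fin M ⊕ Fin n),
      (c.queryCount : ℝ) ≤ 20000 * (α / Δ * Real.log (2 / ε)) ∧
      (c.gateCount : ℝ) ≤ 20000 * ((m + 1) * max 1 (α / Δ) * Real.log (2 / ε)) ∧
      ∀ (H : QMatrix (Fin n)) (hH : H.IsHermitian) (U : QMatrix (Fin m ⊕ Fin n)),
        IsBlockEncoding α m 0 U H → (∀ k, Δ / 2 ≤ |μ - hH.eigenvalues k|) →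
          IsBlockEncoding 1 M ε (c.toMatrix U)
            (spectralMap hH fun t => if t < μ then (v₁ : ℂ) else (v₂ : ℂ)) := by
  by_cases hmain : Δ ≤ 2 * α
  · exact exists_threshold_circuit_of_le hM n hα hΔ hmain hε hε1 hv₁ hv₂
  set v : ℝ := if 0 ≤ μ then v₁ else v₂ with hv
  have hv1 : |v| ≤ 1 := by rw [hv]; split_ifs <;> assumption
  have hL : 1 / 2 ≤ Real.log (2 / ε) := by
    have h1 : Real.log 2 ≤ Real.log (2 / ε) := Real.log_le_log (by norm_num) (by
      rw [le_div_iff₀ hε]; linarith)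
    linarith [Real.log_two_gt_d9]
  have hg : su2 (v : ℂ) (Real.sqrt (1 - v ^ 2) : ℝ) ∈ Matrix.unitaryGroup (Fin 2) ℂ := by
    refine (Matrix.mem_specialUnitaryGroup_iff.1 (su2_mem ?_)).1
    rw [Complex.norm_real, Complex.norm_real, Real.norm_eq_abs, Real.norm_eq_abs, sq_abs, sq_abs,
      Real.sq_sqrt]
    · ring
    · have := (sq_le_one_iff_abs_le_one v).2 hv1
      linarith
  obtain ⟨c, hc, hcq, hck⟩ := realizable_oneQubit (R := Fin m ⊕ Fin n)
    (Sum.inl ⟨0, by omega⟩ : Fin M ⊕ Fin n) hg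
  refine ⟨c, ?_, ?_, fun H hH U hUH hgap => ?_⟩
  · rw [Nat.le_zero.1 hcq]
    have : 0 ≤ α / Δ * Real.log (2 / ε) := by positivity
    simpa using this
  · have h1 : (c.gateCount : ℝ) ≤ 1 := by exact_mod_cast hck
    have h2 : (1 : ℝ) * 1 ≤ (m + 1) * max 1 (α / Δ) :=
      mul_le_mul (by linarith [(Nat.cast_nonneg m : (0 : ℝ) ≤ m)]) (le_max_left _ _) zero_le_one
        (by positivity)
    have h3 : 1 * Real.log (2 / ε) ≤ (m + 1) * max 1 (α / Δ) * Real.log (2 / ε) :=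
      mul_le_mul_of_nonneg_right (by linarith) (by linarith)
    linarith
  · refine ⟨OracleCircuit.toMatrix_mem_unitary hUH.1 c, ?_⟩
    have hbound := hUH.abs_eigenvalues_le hα hH
    have h00 : su2 (v : ℂ) (Real.sqrt (1 - v ^ 2) : ℝ) 0 0 = v := rfl
    rw [hc, zeroBlock_fiberwise_const, h00, Complex.ofReal_one, one_smul,
      ← spectralMap_one hH, spectralMap_smul, spectralMap_sub]
    refine norm_spectralMap_le hH hε.le fun k => ?_
    have hb := abs_le.1 (hbound k)
    have hgk := hgap k
    have hcase : (if hH.eigenvalues k < μ then (v₁ : ℂ) else (v₂ : ℂ)) = v := by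
      rw [not_le] at hmain
      rw [hv]
      by_cases h0 : 0 ≤ μ
      · rw [if_pos h0, if_pos]
        by_contra h
        rw [abs_of_nonpos (by linarith)] at hgk
        linarith
      · rw [if_neg h0, if_neg]
        rw [not_le] at h0
        intro h
        rw [abs_of_pos (by linarith)] at hgk
        linarith
    rw [hcase, mul_one, sub_self, norm_zero]
    exact hε.le

end Assembly

theorem mainTheorem6 :
    ∃ C : ℝ, 0 < C ∧
      ∀ (n m : ℕ) (α μ Δ ε : ℝ), 0 < α → 0 < Δ → 0 < ε → ε < 1 →
        ∃ (REF : OracleCircuit (Fin m ⊕ Fin n) (Fin (m + 2) ⊕ Fin n))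
          (PROJ : OracleCircuit (Fin m ⊕ Fin n) (Fin (m + 3) ⊕ Fin n)),
          ((REF.queryCount : ℝ) ≤ C * (α / Δ * Real.log (2 / ε)) ∧
            (REF.gateCount : ℝ) ≤ C * ((m + 1) * max 1 (α / Δ) * Real.log (2 / ε)) ∧
            (PROJ.queryCount : ℝ) ≤ C * (α / Δ * Real.log (2 / ε)) ∧
            (PROJ.gateCount : ℝ) ≤ C * ((m + 1) * max 1 (α / Δ) * Real.log (2 / ε))) ∧
          ∀ (H : QMatrix (Fin n)) (hH : H.IsHermitian) (U : QMatrix (Fin m ⊕ Fin n)),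
            IsBlockEncoding α m 0 U H →
            (∀ x ∈ spectrum ℝ H, Δ / 2 ≤ |μ - x|) →
              IsBlockEncoding 1 (m + 2) ε (REF.toMatrix U) (reflectorLT hH μ) ∧
              IsBlockEncoding 1 (m + 3) (ε / 2) (PROJ.toMatrix U) (projectorLT hH μ) := by
  refine ⟨40000, by norm_num, fun n m α μ Δ ε hα hΔ hε hε1 => ?_⟩
  obtain ⟨REF, hRq, hRk, hR⟩ := exists_threshold_circuit (m := m) (M := m + 2) le_rfl n (μ := μ)
    (v₁ := 1) (v₂ := -1) hα hΔ hε hε1 (by simp) (by simp)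
  -- The projector is built directly as a threshold function with values `1` and `0` and precision
  -- `ε / 2`; the third additional ancilla stays idle in the main case.
  obtain ⟨PROJ, hPq, hPk, hP⟩ := exists_threshold_circuit (m := m) (M := m + 3) (by omega) n
    (μ := μ) (v₁ := 1) (v₂ := 0) hα hΔ (half_pos hε) (by linarith) (by simp) (by simp)
  have hlog2 : 0 < Real.log 2 := Real.log_pos (by norm_num)
  have hL : Real.log 2 ≤ Real.log (2 / ε) := Real.log_le_log (by norm_num) (by
    rw [le_div_iff₀ hε]; linarith)
  -- Halving the precision adds `log 2`, which is at most `log (2 / ε)` since `ε < 1`; hence the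
  -- final constant is twice that of the threshold circuit.
  have hL2 : Real.log (2 / (ε / 2)) ≤ 2 * Real.log (2 / ε) := by
    rw [show 2 / (ε / 2) = 2 * (2 / ε) by field_simp, Real.log_mul (by norm_num) (by positivity)]
    linarith
  have hL0 : 0 < Real.log (2 / ε) := by linarith
  have h1 : 0 ≤ α / Δ * Real.log (2 / ε) := by positivity
  have h2 : 0 ≤ (m + 1) * max 1 (α / Δ) * Real.log (2 / ε) := by positivity
  have h3 : α / Δ * Real.log (2 / (ε / 2)) ≤ α / Δ * (2 * Real.log (2 / ε)) :=
    mul_le_mul_of_nonneg_left hL2 (by positivity)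
  have h4 : (m + 1) * max 1 (α / Δ) * Real.log (2 / (ε / 2))
      ≤ (m + 1) * max 1 (α / Δ) * (2 * Real.log (2 / ε)) :=
    mul_le_mul_of_nonneg_left hL2 (by positivity)
  refine ⟨REF, PROJ, ⟨by linarith, by linarith, by linarith, by linarith⟩,
    fun H hH U hU hgap => ?_⟩
  have hgap' : ∀ k, Δ / 2 ≤ |μ - hH.eigenvalues k| := fun k =>
    hgap _ (hH.eigenvalues_mem_spectrum_real k)
  have hne : ∀ k, hH.eigenvalues k ≠ μ := fun k h => by
    have := hgap' k
    rw [h, sub_self, abs_zero] at this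
    linarith
  rw [reflectorLT_eq hH hne, projectorLT_eq]
  have hR' := hR H hH U hU hgap'
  have hP' := hP H hH U hU hgap'
  simp only [Complex.ofReal_one, Complex.ofReal_neg, Complex.ofReal_zero] at hR' hP'
  exact ⟨hR', hP'⟩
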